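/- **Setting.** Let $\ell\ge 1$ and let $\Omega\subset\mathbb R^\ell$ be a bounded open set whose boundary has finite $(\ell-1)$-dimensional Hausdorff measure and has an exterior unit normal $\eta(x)$ at $\mathcal H^{\ell-1}$-a.e. $x\in\partial\Omega$: a unit vector such that, for every $\varepsilon>0$, the points $y$ near $x$ with $(y-x)\cdot\eta<-\varepsilon|y-x|$ are in $\Omega$ and those with $(y-x)\cdot\eta>\varepsilon|y-x|$ are not (bounded Lipschitz domains are of this kind). Let $T>0$, $u_{\max}>0$, let $f:\mathbb R\to\mathbb R^\ell$ be Lipschitz with $f(0)=f(u_{\max})=0$, let $\phi:\mathbb R\to\mathbb R$ be non-decreasing and Lipschitz, and let $u_0\in L^\infty(\Omega;[0,u_{\max}])$. **Meshes.** An admissible mesh $\mathcal O$ of $\Omega$ is a finite family of pairwise disjoint open control volumes $K\subset\Omega$ that cover $\Omega$ up to a Lebesgue-null set, with centres $x_K\in\overline K$ such that $K$ contains the open segment from $x_K$ to each of its points (for instance $K$ convex). For $K\ne L$ let $\sigma=K|L=\overline K\cap\overline L\cap\Omega$, and $m(\sigma)=\mathcal H^{\ell-1}(\sigma)$. If $m(\sigma)>0$,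 then $K,L$ are called neighbours and $\sigma$ an inner interface; it is required that $x_K\neq x_L$ and that $\sigma$ lies in a hyperplane orthogonal to $x_L-x_K$. Let $\varepsilon_K$ be the set of inner interfaces of $K$ and, for $\sigma=K|L$, $d_\sigma=|x_L-x_K|$, $n_{K,\sigma}=(x_L-x_K)/d_\sigma$, $\tau_{K,\sigma}=m(\sigma)/d_\sigma$. The size of $\mathcal O$ is $\max_K\operatorname{diam}(K)$. **Scheme.** Let $\delta t>0$. For every $K$ and $\sigma=K|L\in\varepsilon_K$ let $F_{K,\sigma}:\mathbb R^2\to\mathbb R$ be a numerical flux that is consistent, $F_{K,\sigma}(s,s)=m(\sigma)f(s)\cdot n_{K,\sigma}$; monotone, i.e. non-decreasing in its first and non-increasing in its second argument; conservative, $F_{K,\sigma}(a,b)=-F_{L,\sigma}(b,a)$; and Lipschitz, $|F_{K,\sigma}(a,b)-F_{K,\sigma}(a',b')|\le M\,m(\sigma)(|a-a'|+|b-b'|)$ for some $M$. A discretization consists of $\mathcal O$, $\delta t$ and $(F_{K,\sigma})$, and $h=\max(\text{size of }\mathcal O,\ \delta t)$ is its size. The values $(u^n_K)$ solve the scheme if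 $u_K^0=\frac1{m(K)}\int_Ku_0\,dx$ and, for all $n\ge0$ and all $K$ (with $u_{K,\sigma}=u_L$ for $\sigma=K|L$), $$m(K)\frac{u_K^{n+1}-u_K^n}{\delta t}+\sum_{\sigma\in\varepsilon_K}\Bigl(F_{K,\sigma}(u_K^{n+1},u_{K,\sigma}^{n+1})-\tau_{K,\sigma}\bigl(\phi(u_{K,\sigma}^{n+1})-\phi(u_K^{n+1})\bigr)\Bigr)=0 .$$ The approximate solution is $u_{\mathcal O,\delta t}(t,x)=u_K^{n+1}$ for $x\in K$, $t\in(n\delta t,(n+1)\delta t]$. The discrete gradient $\nabla_{\mathcal O}\phi(u_{\mathcal O,\delta t})(t,x)$ equals $\ell\,\frac{\phi(u_L^{n+1})-\phi(u_K^{n+1})}{d_\sigma}\,n_{K,\sigma}$ for $t\in(n\delta t,(n+1)\delta t]$ and $x$ in the diamond of $\sigma=K|L$ (the union of the two cones with base $\sigma$ and apexes $x_K$, $x_L$), and it vanishes outside the diamonds of the inner interfaces. **Theorem 1.** There are numbers $\upsilon_{\mathcal O,\delta t}(\xi)$, depending on the discretization and on $\xi$ (and on the data $\Omega,T,u_{\max},f,\phi,u_0$),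 but not on $k$, such that every approximate solution satisfies, for all $k\in[0,u_{\max}]$ and all $\xi\in C^\infty([0,T]\times\mathbb R^\ell)$ with $\xi\ge0$, $$\begin{aligned}&\int_0^T\!\!\int_\Omega\Bigl\{|u_{\mathcal O,\delta t}-k|\,\xi_t+\operatorname{sign}(u_{\mathcal O,\delta t}-k)\bigl[f(u_{\mathcal O,\delta t})-f(k)-\nabla_{\mathcal O}\phi(u_{\mathcal O,\delta t})\bigr]\cdot\nabla\xi\Bigr\}\,dx\,dt\\&+\int_0^T\!\!\int_{\partial\Omega}|f(k)\cdot\eta(x)|\,\xi(t,x)\,d\mathcal H^{\ell-1}(x)\,dt+\int_\Omega|u_0-k|\,\xi(0,x)\,dx\ \ge\ -\upsilon_{\mathcal O,\delta t}(\xi),\end{aligned}$$ where $\operatorname{sign}(0)=0$, and such that for every $\xi\in C^\infty([0,T]\times\mathbb R^\ell)$ and all constants $\zeta,M$, $\upsilon_{\mathcal O,\delta t}(\xi)\to0$ as $h\to0$ within the discretizations that satisfy $\operatorname{diam}(K)\sum_{\sigma\in\varepsilon_K}m(\sigma)\le\zeta\,m(K)$ for all $K$ and whose numerical fluxes are Lipschitz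 with the constant $M$ as above. ($\mathcal H^{\ell-1}$ is normalized to agree with Lebesgue measure on hyperplanes.) -/

import Mathlib

open Set Filter Topology MeasureTheory
open scoped ContDiff RealInnerProductSpace

noncomputable section

namespace ZeroFluxFV

/-- The Euclidean space of dimension `ℓ`. -/
abbrev Space (ℓ : ℕ) : Type := EuclideanSpace ℝ (Fin ℓ)

/-- The `(ℓ-1)`-dimensional Hausdorff measure on `ℝ^ℓ`, normalized so that it agrees with the
`(ℓ-1)`-dimensional Lebesgue measure on hyperplanes. -/
def surfaceMeasure (ℓ : ℕ) : Measure (Space ℓ) := μHE[ℓ - 1]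

/-! ### The domain and its exterior normal -/

/-- `ν` is the exterior unit normal to `Ω` at `x`: near `x`, up to cones of arbitrarily small
opening around the hyperplane orthogonal to `ν`, the set `Ω` coincides with the half-space
`{y | ⟪y - x, ν⟫ < 0}`. -/
def IsExteriorNormal {ℓ : ℕ} (Ω : Set (Space ℓ)) (x ν : Space ℓ) : Prop :=
  ‖ν‖ = 1 ∧ ∀ ε : ℝ, 0 < ε → ∀ᶠ y in 𝓝 x,
    (⟪y - x, ν⟫ < -(ε * ‖y - x‖) → y ∈ Ω) ∧ (ε * ‖y - x‖ < ⟪y - x, ν⟫ → y ∉ Ω)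

open Classical in
/-- The exterior unit normal field of `Ω` (zero at the points where there is no normal). -/
def exteriorNormal {ℓ : ℕ} (Ω : Set (Space ℓ)) (x : Space ℓ) : Space ℓ :=
  if h : ∃ ν, IsExteriorNormal Ω x ν then h.choose else 0

/-- The exterior normal at a point is unique, so that the choice above is harmless. -/
theorem IsExteriorNormal.unique {ℓ : ℕ} {Ω : Set (Space ℓ)} {x ν ν' : Space ℓ}
    (h : IsExteriorNormal Ω x ν) (h' : IsExteriorNormal Ω x ν') : ν = ν' := by
  by_contra hne
  have hn := h.1
  have hn' := h'.1
  set c : ℝ := ⟪ν, ν'⟫ with hc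
  have hc1 : c < 1 := (inner_lt_one_iff_real_of_norm_eq_one hn hn').2 hne
  set w : Space ℓ := ν - ν' with hw
  have hwν : ⟪w, ν⟫ = 1 - c := by
    rw [hw, inner_sub_left, real_inner_self_eq_norm_sq, hn, real_inner_comm, ← hc]; norm_num
  have hwν' : ⟪w, ν'⟫ = -(1 - c) := by
    rw [hw, inner_sub_left, real_inner_self_eq_norm_sq, hn', ← hc]; norm_num
  have hwpos : 0 < ‖w‖ := norm_pos_iff.2 (sub_ne_zero.2 hne)
  set ε : ℝ := (1 - c) / (2 * ‖w‖) with hε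
  have hεpos : 0 < ε := by rw [hε]; apply div_pos <;> linarith
  have hεw : ε * ‖w‖ = (1 - c) / 2 := by rw [hε]; field_simp
  have hlim : Tendsto (fun t : ℝ => x + t • w) (𝓝[>] 0) (𝓝 x) := by
    have : Tendsto (fun t : ℝ => x + t • w) (𝓝 0) (𝓝 (x + (0 : ℝ) • w)) :=
      (Continuous.tendsto (by fun_prop) 0)
    rw [zero_smul, add_zero] at this
    exact this.mono_left nhdsWithin_le_nhds
  have hev := (hlim.eventually ((h.2 ε hεpos).and (h'.2 ε hεpos))).and self_mem_nhdsWithin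
  obtain ⟨t, ⟨h1, h2⟩, ht⟩ := hev.exists
  have ht : 0 < t := ht
  have hnorm : ε * ‖t • w‖ = t * ((1 - c) / 2) := by
    rw [norm_smul, Real.norm_of_nonneg ht.le, ← hεw]; ring
  simp only [add_sub_cancel_left, inner_smul_left, hnorm, hwν, hwν'] at h1 h2
  refine h1.2 ?_ (h2.1 ?_)
  · simp only [conj_trivial]; nlinarith
  · simp only [conj_trivial]; nlinarith

/-- A regular bounded domain: a bounded open set whose boundary has finite surface measure and
carries an exterior unit normal at almost every point (in particular every bounded open set with
`C¹` or Lipschitz boundary, and every convex polytope). -/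
structure IsRegularDomain {ℓ : ℕ} (Ω : Set (Space ℓ)) : Prop where
  isOpen : IsOpen Ω
  isBounded : Bornology.IsBounded Ω
  boundary_finite : surfaceMeasure ℓ (frontier Ω) < ⊤
  ae_normal : ∀ᵐ x ∂(surfaceMeasure ℓ).restrict (frontier Ω), ∃ ν, IsExteriorNormal Ω x ν

/-! ### Admissible meshes -/

/-- The part inside `Ω` of the common boundary of two disjoint open control volumes. -/
def innerInterface {ℓ : ℕ} (Ω K L : Set (Space ℓ)) : Set (Space ℓ) :=
  closure K ∩ closure L ∩ Ω

/-- An admissible finite volume mesh of `Ω`. The control volumes are open, pairwise disjoint, fill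
`Ω` up to a null set, and are star-shaped with respect to their centres (the standard case: convex
control volumes, with a centre in the closure of its control volume). Every inner interface of
positive surface measure is flat, and orthogonal to the line through the two neighbouring centres,
which are distinct. Nothing is asked of the part of the boundary of a control volume that lies
on `∂Ω`. -/
structure AdmissibleMesh {ℓ : ℕ} (Ω : Set (Space ℓ)) where
  /-- the number of control volumes -/
  card : ℕ
  /-- the control volumes -/
  cell : Fin card → Set (Space ℓ)
  /-- the centres of the control volumes -/
  center : Fin card → Space ℓ
  cell_open : ∀ i, IsOpen (cell i)
  cell_subset : ∀ i, cell i ⊆ Ω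
  cell_disjoint : ∀ i j, i ≠ j → Disjoint (cell i) (cell j)
  cell_cover : volume (Ω \ ⋃ i, cell i) = 0
  center_mem : ∀ i, center i ∈ closure (cell i)
  cell_star : ∀ i, ∀ y ∈ cell i, openSegment ℝ (center i) y ⊆ cell i
  center_ne : ∀ i j, i ≠ j → surfaceMeasure ℓ (innerInterface Ω (cell i) (cell j)) ≠ 0 →
    center i ≠ center j
  orthogonal : ∀ i j, i ≠ j → surfaceMeasure ℓ (innerInterface Ω (cell i) (cell j)) ≠ 0 →
    ∀ y ∈ innerInterface Ω (cell i) (cell j), ∀ z ∈ innerInterface Ω (cell i) (cell j),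
      ⟪center j - center i, y - z⟫ = 0

namespace AdmissibleMesh

variable {ℓ : ℕ} {Ω : Set (Space ℓ)} (m : AdmissibleMesh Ω)

/-- The inner interface between two control volumes. -/
def interface (i j : Fin m.card) : Set (Space ℓ) := innerInterface Ω (m.cell i) (m.cell j)

/-- Two control volumes are neighbours if they share an inner interface of positive measure. -/
def Adj (i j : Fin m.card) : Prop := i ≠ j ∧ surfaceMeasure ℓ (m.interface i j) ≠ 0

open Classical in
/-- The neighbours of a control volume, which index its inner interfaces. -/
def neighbors (i : Fin m.card) : Finset (Fin m.card) := Finset.univ.filter (m.Adj i)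

/-- The surface measure of an interface. -/
def area (i j : Fin m.card) : ℝ := (surfaceMeasure ℓ).real (m.interface i j)

/-- The distance between two centres. -/
def centerDist (i j : Fin m.card) : ℝ := ‖m.center j - m.center i‖

/-- The unit normal to the interface between `i` and `j`, pointing from `i` to `j`. -/
def normal (i j : Fin m.card) : Space ℓ :=
  (m.centerDist i j)⁻¹ • (m.center j - m.center i)

/-- The transmissivity coefficient of an interface. -/
def transmissivity (i j : Fin m.card) : ℝ := m.area i j / m.centerDist i j

/-- The mesh size: the largest diameter of a control volume. -/
def size : ℝ := ⨆ i, Metric.diam (m.cell i)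

/-- The diamond of an interface: the union of the two cones over the interface with apexes at the
two neighbouring centres. -/
def diamond (i j : Fin m.card) : Set (Space ℓ) :=
  convexJoin ℝ {m.center i} (m.interface i j) ∪ convexJoin ℝ {m.center j} (m.interface i j)

open Classical in
/-- The diamond discrete gradient of the discrete function `w`: on the diamond of the interface
between `i` and `j` it is `ℓ (w j - w i) / d_{ij}` times the unit normal from `i` to `j`. It
vanishes outside the diamonds of the inner interfaces. The expression is symmetric in `(i, j)`,
and each interface is counted once. -/
def discreteGradient (w : Fin m.card → ℝ) (x : Space ℓ) : Space ℓ :=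
  ∑ i, ∑ j ∈ m.neighbors i with i < j,
    (m.diamond i j).indicator
      (fun _ => ((ℓ : ℝ) * (w j - w i) / m.centerDist i j) • m.normal i j) x

/-- The piecewise constant function equal to `w i` on the control volume `i`. -/
def piecewiseConst (w : Fin m.card → ℝ) (x : Space ℓ) : ℝ :=
  ∑ i, (m.cell i).indicator (fun _ => w i) x

end AdmissibleMesh

/-! ### The scheme -/

/-- The numerical convection fluxes `F i j` through the inner interfaces are Lipschitz with
constant `M` per unit of surface. -/
def FluxLipschitz {ℓ : ℕ} {Ω : Set (Space ℓ)} (m : AdmissibleMesh Ω)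
    (F : Fin m.card → Fin m.card → ℝ → ℝ → ℝ) (M : ℝ) : Prop :=
  ∀ i j, m.Adj i j → ∀ a b a' b',
    |F i j a b - F i j a' b'| ≤ M * m.area i j * (|a - a'| + |b - b'|)

/-- The data of the scheme on `Ω` for the flux `f`: an admissible mesh, a time step, and numerical
convection fluxes (integrated over the interfaces) that are consistent with `f`, monotone,
Lipschitz and conservative. -/
structure Discretization {ℓ : ℕ} (Ω : Set (Space ℓ)) (f : ℝ → Space ℓ) where
  /-- the mesh -/
  mesh : AdmissibleMesh Ω
  /-- the time step -/
  dt : ℝ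
  /-- the numerical fluxes, `flux i j` being the flux from `i` to `j` -/
  flux : Fin mesh.card → Fin mesh.card → ℝ → ℝ → ℝ
  dt_pos : 0 < dt
  consistent : ∀ i j, mesh.Adj i j → ∀ s, flux i j s s = mesh.area i j * ⟪f s, mesh.normal i j⟫
  monotone_left : ∀ i j, mesh.Adj i j → ∀ b, Monotone fun a => flux i j a b
  antitone_right : ∀ i j, mesh.Adj i j → ∀ a, Antitone fun b => flux i j a b
  conservative : ∀ i j, mesh.Adj i j → ∀ a b, flux i j a b = -flux j i b a
  lipschitz : ∃ M, FluxLipschitz mesh flux M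

namespace Discretization

variable {ℓ : ℕ} {Ω : Set (Space ℓ)} {f : ℝ → Space ℓ} (D : Discretization Ω f)

/-- The discretization size: the larger one of the mesh size and the time step. -/
def size : ℝ := max D.mesh.size D.dt

/-- The bounds that are uniform along a family of discretizations: the shape regularity
`diam(K) ∑_σ m(σ) ≤ ζ m(K)` of the mesh, and the Lipschitz constant `M` of the numerical fluxes
per unit of surface. -/
def IsUniform (ζ M : ℝ) : Prop :=
  (∀ i, Metric.diam (D.mesh.cell i) * ∑ j ∈ D.mesh.neighbors i, D.mesh.area i j ≤
    ζ * volume.real (D.mesh.cell i)) ∧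
  FluxLipschitz D.mesh D.flux M

/-- `u n i` (the value in the control volume `i` at the time level `n`) solves the implicit finite
volume scheme with initial datum `u₀`. No flux crosses `∂Ω`. -/
def IsSolution (φ : ℝ → ℝ) (u₀ : Space ℓ → ℝ) (u : ℕ → Fin D.mesh.card → ℝ) : Prop :=
  (∀ i, u 0 i = (volume.real (D.mesh.cell i))⁻¹ * ∫ x in D.mesh.cell i, u₀ x) ∧
  ∀ n i, volume.real (D.mesh.cell i) * ((u (n + 1) i - u n i) / D.dt) +
    ∑ j ∈ D.mesh.neighbors i,
      (D.flux i j (u (n + 1) i) (u (n + 1) j) -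
        D.mesh.transmissivity i j * (φ (u (n + 1) j) - φ (u (n + 1) i))) = 0

/-- The discrete values at time `t`: `u (n + 1)` for `t ∈ (n dt, (n + 1) dt]`. -/
def valuesAt (u : ℕ → Fin D.mesh.card → ℝ) (t : ℝ) : Fin D.mesh.card → ℝ := u ⌈t / D.dt⌉₊

/-- The approximate solution: the value is `u (n + 1) i` for `x` in the control volume `i` and
`t ∈ (n dt, (n + 1) dt]`. -/
def approxSolution (u : ℕ → Fin D.mesh.card → ℝ) (t : ℝ) (x : Space ℓ) : ℝ :=
  D.mesh.piecewiseConst (D.valuesAt u t) x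

/-- The discrete gradient of `φ` of the approximate solution. -/
def approxGradient (φ : ℝ → ℝ) (u : ℕ → Fin D.mesh.card → ℝ) (t : ℝ) (x : Space ℓ) : Space ℓ :=
  D.mesh.discreteGradient (fun i => φ (D.valuesAt u t i)) x

end Discretization

/-! ### The entropy functional -/

/-- Test functions: smooth on `[0,T] × ℝ^ℓ`, up to `t = 0` and `t = T`. -/
def IsTestFunction {ℓ : ℕ} (T : ℝ) (ξ : ℝ × Space ℓ → ℝ) : Prop :=
  ContDiffOn ℝ ∞ ξ (Icc 0 T ×ˢ univ)

/-- The left-hand side of the entropy inequality with constant `k` and test function `ξ`, for a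
function `v` and a field `G` that stands for the gradient of `φ(v)`. -/
def entropyFunctional {ℓ : ℕ} (Ω : Set (Space ℓ)) (T : ℝ) (f : ℝ → Space ℓ) (u₀ : Space ℓ → ℝ)
    (v : ℝ → Space ℓ → ℝ) (G : ℝ → Space ℓ → Space ℓ) (k : ℝ) (ξ : ℝ × Space ℓ → ℝ) : ℝ :=
  (∫ t in (0 : ℝ)..T, ∫ x in Ω,
    (|v t x - k| * deriv (fun s => ξ (s, x)) t +
      Real.sign (v t x - k) * ⟪f (v t x) - f k - G t x, gradient (fun y => ξ (t, y)) x⟫)) +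
  (∫ t in (0 : ℝ)..T, ∫ x in frontier Ω,
    |⟪f k, exteriorNormal Ω x⟫| * ξ (t, x) ∂(surfaceMeasure ℓ)) +
  ∫ x in Ω, |u₀ x - k| * ξ (0, x)

end ZeroFluxFV

end

/-! This is the weak-BV entropy argument for monotone implicit schemes. The difficulty is geometric:
near `∂Ω` the domain and the mesh are too rough for a divergence theorem in each control volume. It
is replaced by a single inequality summed over the mesh, `AdmissibleMesh.abs_gaussGreen_le`. For C¹
functions ψ_K with |ψ_K| ≤ g on K and a fixed direction a, the sum over K of ∫_K ∂_a ψ_K minus the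
fluxes of ψ_K through the inner interfaces is bounded in absolute value by ∫_{∂Ω} |a·η| g. An
absolute value is enough, since the boundary term of the theorem is |f(k)·η|.

To prove it, extend the ψ_K to one function Ψ that vanishes outside the control volumes. Then ∫ (Ψ(x
+ sa) - Ψ(x)) dx = 0. For small s this variation takes place inside one control volume (which yields
∂_a ψ_K), across one interface (which yields a jump), or across `∂Ω`; what remains is o(s). The set
of points whose segment [x, x + sa] meets E ⊂ ∂Ω has volume at most s ∫_E |a·η|
(`IsRegularDomain.volume_shadow_le`): `∂Ω` is cut into countably many almost flat pieces, and
sweeping such a piece along a is almost an affine map. Segments that leave Ω and come back have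
volume o(s). On the mesh side, star-shapedness and orthogonality ensure that almost every point of
an interface has exactly its two control volumes on its two sides, in the expected order.

The analysis starts from the maximum principle, which holds because f vanishes at both ends of [0,
umax]. Testing the scheme with u bounds the time integral of a dissipation: the primitive of f
contributes only through `∂Ω`, by Gauss-Green with constant ψ. The dissipation contains ∫_a^b
(F(s,s) - F(a,b)) ds, which dominates squares of flux differences (`sq_flux_sub_le`), and τ (φ(u_L)
- φ(u_K)) (u_L - u_K), which dominates τ times the squared increments of φ.

Testing with sign(u - k) ξ(t, x_K) gives a discrete entropy inequality, which is compared with the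
continuous one in three respects. Convection: the numerical entropy flux is antisymmetric, so the
interface mean of ξ can be subtracted from ξ(x_K); the weak BV bound replaces this flux by the exact
one in each control volume, Gauss-Green produces ∫ ·∇ξ, and the remaining flux f(k) gives the
boundary term. Diffusion: on each half diamond the discrete gradient reproduces τ (ξ(foot) -
ξ(x_K)), where the foot of the perpendicular is common to both neighbours; the terms with ξ(foot)
have a sign, because sign and φ are monotone. Time: summation by parts for step functions. The total
error is at most |A| (√h + h), where A does not depend on k; υ is the infimum of the admissible
errors. -/

namespace ZeroFluxFV

/-! ### Hyperplanes, shadows and cones -/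

/-- The set of the points `x` such that the segment `[x, x + s a]` meets `E`. -/
def shadow {ℓ : ℕ} (a : Space ℓ) (s : ℝ) (E : Set (Space ℓ)) : Set (Space ℓ) :=
  {x | ∃ t ∈ Icc 0 s, x + t • a ∈ E}

theorem shadow_mono {ℓ : ℕ} {a : Space ℓ} {s : ℝ} {E F : Set (Space ℓ)} (h : E ⊆ F) :
    shadow a s E ⊆ shadow a s F := fun _ ⟨t, ht, hx⟩ => ⟨t, ht, h hx⟩

theorem shadow_iUnion {ℓ : ℕ} {ι : Sort*} (a : Space ℓ) (s : ℝ) (E : ι → Set (Space ℓ)) :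
    shadow a s (⋃ i, E i) = ⋃ i, shadow a s (E i) := by
  ext x
  simp only [shadow, mem_iUnion, mem_ofPred_eq]
  grind

theorem shadow_union {ℓ : ℕ} (a : Space ℓ) (s : ℝ) (E F : Set (Space ℓ)) :
    shadow a s (E ∪ F) = shadow a s E ∪ shadow a s F := by
  ext x
  simp only [shadow, mem_union, mem_ofPred_eq]
  grind

/-- `ι` parametrizes the hyperplane through the origin orthogonal to `n`. -/
def IsFrame {d : ℕ} (n : Space (d + 1)) (ι : Space d →ₗᵢ[ℝ] Space (d + 1)) : Prop :=
  (∀ q, ⟪ι q, n⟫ = 0) ∧ ∀ y, ⟪y, n⟫ = 0 → ∃ q, ι q = y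

theorem exists_isFrame {d : ℕ} {n : Space (d + 1)} (hn : ‖n‖ = 1) :
    ∃ ι : Space d →ₗᵢ[ℝ] Space (d + 1), IsFrame n ι := by
  have : Fact (Module.finrank ℝ (Space (d + 1)) = d + 1) := ⟨by simp⟩
  have hn0 : n ≠ 0 := by
    rintro rfl
    simp at hn
  let b := OrthonormalBasis.fromOrthogonalSpanSingleton (𝕜 := ℝ) d hn0
  refine ⟨(ℝ ∙ n)ᗮ.subtypeₗᵢ.comp b.repr.symm.toLinearIsometry, fun q => ?_, fun y hy => ?_⟩
  · have h := (b.repr.symm q).2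
    rw [Submodule.mem_orthogonal_singleton_iff_inner_left] at h
    exact h
  · refine ⟨b.repr ⟨y, Submodule.mem_orthogonal_singleton_iff_inner_left.2 hy⟩, ?_⟩
    simp

section Frame

variable {d : ℕ} {n : Space (d + 1)} {ι : Space d →ₗᵢ[ℝ] Space (d + 1)}

/-- The orthogonal splitting into the line of `n` and its complement is a linear isometry, for the
Euclidean product norm, between spaces of equal dimension. -/
theorem IsFrame.measurePreserving (hι : IsFrame n ι) (hn : ‖n‖ = 1) :
    MeasurePreserving (fun p : ℝ × Space d => p.1 • n + ι p.2) := by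
  let L : WithLp 2 (ℝ × Space d) →ₗᵢ[ℝ] Space (d + 1) :=
    { toFun := fun p => p.fst • n + ι p.snd
      map_add' := fun p q => by simp [add_smul]; abel
      map_smul' := fun c p => by simp [mul_smul]
      norm_map' := fun p => by
        have h1 : ‖p.fst • n + ι p.snd‖ ^ 2 = ‖p.fst‖ ^ 2 + ‖p.snd‖ ^ 2 := by
          rw [norm_add_sq_real, inner_smul_left, real_inner_comm, hι.1, norm_smul, hn]
          simp
        have h2 := WithLp.prod_norm_sq_eq_of_L2 p
        simp only [LinearMap.coe_mk, AddHom.coe_mk]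
        rw [← sq_eq_sq₀ (norm_nonneg _) (norm_nonneg _), h1, h2] }
  have hfr : Module.finrank ℝ (WithLp 2 (ℝ × Space d)) = Module.finrank ℝ (Space (d + 1)) := by
    rw [LinearEquiv.finrank_eq (WithLp.linearEquiv 2 ℝ (ℝ × Space d)), Module.finrank_prod]
    simp
    omega
  exact (L.toLinearIsometryEquiv hfr).measurePreserving.comp
    (WithLp.volume_preserving_toLp ℝ (Space d))

theorem IsFrame.exists_eq (hι : IsFrame n ι) (hn : ‖n‖ = 1) (y : Space (d + 1)) :
    ∃ q, y = ⟪y, n⟫ • n + ι q := by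
  obtain ⟨q, hq⟩ := hι.2 (y - ⟪y, n⟫ • n) (by
    rw [inner_sub_left, inner_smul_left, real_inner_self_eq_norm_sq, hn]; simp)
  exact ⟨q, by rw [hq]; abel⟩

theorem IsFrame.inner_eq (hι : IsFrame n ι) (hn : ‖n‖ = 1) (t : ℝ) (q : Space d) :
    ⟪t • n + ι q, n⟫ = t := by
  rw [inner_add_left, inner_smul_left, hι.1, real_inner_self_eq_norm_sq, hn]
  simp

/-- Replacing the axis `n` by `a` amounts to the transvection `y ↦ y + ⟪y, n⟫ • (a - n)`, whose
determinant is `⟪a, n⟫`; the translation by `c • n` changes nothing. -/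
theorem IsFrame.map_shear (hι : IsFrame n ι) (hn : ‖n‖ = 1) (a : Space (d + 1))
    (ha : ⟪a, n⟫ ≠ 0) (c : ℝ) :
    Measure.map (fun p : ℝ × Space d => c • n + (p.1 • a + ι p.2)) volume =
      ENNReal.ofReal |⟪a, n⟫⁻¹| • volume := by
  let M : Space (d + 1) →ₗ[ℝ] Space (d + 1) := LinearMap.transvection (innerₗ _ n) (a - n)
  have hM : LinearMap.det M = ⟪a, n⟫ := by
    rw [LinearMap.transvection.det]
    simp [inner_sub_right, hn, real_inner_comm]
  have hcomp : (fun p : ℝ × Space d => c • n + (p.1 • a + ι p.2)) =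
      (fun x => c • n + x) ∘ M ∘ fun p : ℝ × Space d => p.1 • n + ι p.2 := by
    funext p
    have := hι.inner_eq hn p.1 p.2
    rw [real_inner_comm] at this
    simp only [Function.comp, M, LinearMap.transvection.apply, innerₗ_apply_apply, this, smul_sub]
    abel
  have hMc : Continuous M := LinearMap.continuous_of_finiteDimensional M
  have hF := hι.measurePreserving hn
  rw [hcomp, ← Measure.map_map (by fun_prop) (hMc.measurable.comp hF.measurable),
    ← Measure.map_map hMc.measurable hF.measurable, hF.map_eq,
    Measure.map_linearMap_addHaar_eq_smul_addHaar _ (by rw [hM]; exact ha), hM,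
    Measure.map_smul, (measurePreserving_add_left volume (c • n)).map_eq]

theorem isometry_hyperplane (c : ℝ) (n : Space (d + 1)) (ι : Space d →ₗᵢ[ℝ] Space (d + 1)) :
    Isometry fun q => c • n + ι q := (isometry_add_left (c • n)).comp ι.isometry

theorem IsFrame.range_hyperplane (hι : IsFrame n ι) (hn : ‖n‖ = 1) (c : ℝ) :
    range (fun q => c • n + ι q) = {y | ⟪y, n⟫ = c} := by
  ext y
  constructor
  · rintro ⟨q, rfl⟩
    exact hι.inner_eq hn c q
  · intro hy
    obtain ⟨q, hq⟩ := hι.exists_eq hn y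
    exact ⟨q, by rw [hq, show ⟪y, n⟫ = c from hy]⟩

theorem IsFrame.map_hyperplane (hι : IsFrame n ι) (hn : ‖n‖ = 1) (c : ℝ) :
    Measure.map (fun q => c • n + ι q) volume =
      (surfaceMeasure (d + 1)).restrict {y | ⟪y, n⟫ = c} := by
  rw [← hι.range_hyperplane hn c, surfaceMeasure, Nat.add_sub_cancel,
    ← (isometry_hyperplane c n ι).map_euclideanHausdorffMeasure,
    EuclideanSpace.euclideanHausdorffMeasure_eq_volume]

theorem IsFrame.surfaceMeasure_eq (hι : IsFrame n ι) (hn : ‖n‖ = 1) {c : ℝ}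
    {S : Set (Space (d + 1))} (hS : S ⊆ {y | ⟪y, n⟫ = c}) :
    surfaceMeasure (d + 1) S = volume ((fun q => c • n + ι q) ⁻¹' S) := by
  rw [← EuclideanSpace.euclideanHausdorffMeasure_eq_volume d,
    (isometry_hyperplane c n ι).euclideanHausdorffMeasure_preimage, hι.range_hyperplane hn,
    inter_eq_left.2 hS]
  rfl

theorem IsFrame.measurableEmbedding_shear (hι : IsFrame n ι) (a : Space (d + 1))
    (ha : ⟪a, n⟫ ≠ 0) (c : ℝ) :
    MeasurableEmbedding (fun p : ℝ × Space d => c • n + (p.1 • a + ι p.2)) := by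
  have h0 := ι.continuous
  refine Continuous.measurableEmbedding (by fun_prop) ?_
  rintro ⟨t, q⟩ ⟨t', q'⟩ h
  simp only [add_right_inj] at h
  have h2 := congrArg (fun y => ⟪y, n⟫) h
  simp only [inner_add_left, inner_smul_left, hι.1, add_zero, conj_trivial] at h2
  obtain rfl := mul_right_cancel₀ ha h2
  simpa using h

end Frame

theorem isBounded_surfaceMeasure_lt_top {d : ℕ} {n : Space (d + 1)} (hn : ‖n‖ = 1) {c : ℝ}
    {S : Set (Space (d + 1))} (hS : S ⊆ {y | ⟪y, n⟫ = c}) (hb : Bornology.IsBounded S) :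
    surfaceMeasure (d + 1) S < ⊤ := by
  obtain ⟨ι, hι⟩ := exists_isFrame hn
  rw [hι.surfaceMeasure_eq hn hS]
  have := (isometry_hyperplane c n ι).antilipschitz.isBounded_preimage hb
  exact this.measure_lt_top

theorem volume_hyperplane {d : ℕ} {n : Space (d + 1)} (hn : ‖n‖ = 1) (c : ℝ) :
    volume {y : Space (d + 1) | ⟪y, n⟫ = c} = 0 := by
  obtain ⟨ι, hι⟩ := exists_isFrame hn
  rw [← (hι.measurePreserving hn).measure_preimage
    (measurableSet_eq_fun (by fun_prop) (by fun_prop)).nullMeasurableSet]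
  have : (fun p : ℝ × Space d => p.1 • n + ι p.2) ⁻¹' {y | ⟪y, n⟫ = c} = {c} ×ˢ univ := by
    ext ⟨t, q⟩
    simp [hι.inner_eq hn]
  rw [this, Measure.volume_eq_prod, Measure.prod_prod]
  simp

section ShadowHyperplane

variable {d : ℕ} {n : Space (d + 1)} {c s : ℝ} {S : Set (Space (d + 1))} {a : Space (d + 1)}

/-- A line along `a` meets the hyperplane exactly once, so in sheared coordinates the shadow of a
flat set is a box. All computations with shadows of interfaces use this. -/
theorem IsFrame.preimage_shadow {ι : Space d →ₗᵢ[ℝ] Space (d + 1)} (hι : IsFrame n ι)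
    (hn : ‖n‖ = 1) (hS : S ⊆ {y | ⟪y, n⟫ = c}) (ha : ⟪a, n⟫ ≠ 0) :
    (fun p : ℝ × Space d => c • n + (p.1 • a + ι p.2)) ⁻¹' shadow a s S =
      Icc (-s) 0 ×ˢ ((fun q => c • n + ι q) ⁻¹' S) := by
  ext ⟨t, q⟩
  simp only [shadow, mem_preimage, mem_ofPred_eq, mem_prod]
  constructor
  · rintro ⟨r, hr, h⟩
    have h1 : ⟪c • n + (t • a + ι q) + r • a, n⟫ = c := hS h
    have h2 : c • n + (t • a + ι q) + r • a = c • n + ι q + (t + r) • a := by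
      rw [add_smul]; abel
    rw [h2, inner_add_left, hι.inner_eq hn, inner_smul_left] at h1
    have h3 : t + r = 0 := by
      have : (t + r) * ⟪a, n⟫ = 0 := by simpa using h1
      exact (mul_eq_zero.1 this).resolve_right ha
    rw [h2, h3, zero_smul, add_zero] at h
    exact ⟨⟨by linarith [hr.2], by linarith [hr.1]⟩, h⟩
  · rintro ⟨ht, h⟩
    refine ⟨-t, ⟨by linarith [ht.2], by linarith [ht.1]⟩, ?_⟩
    have h2 : c • n + (t • a + ι q) + (-t) • a = c • n + ι q := by
      rw [neg_smul]; abel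
    rwa [h2]

/-- The shadow is a prism with base `S` and height `s * |⟪a, n⟫|`: the volume of the box of
`IsFrame.preimage_shadow` times the determinant of the shear. -/
theorem volume_shadow_hyperplane (hn : ‖n‖ = 1) (hS : S ⊆ {y | ⟪y, n⟫ = c})
    (ha : ⟪a, n⟫ ≠ 0) :
    volume (shadow a s S) = ENNReal.ofReal (s * |⟪a, n⟫|) * surfaceMeasure (d + 1) S := by
  obtain ⟨ι, hι⟩ := exists_isFrame hn
  have h1 : Measure.map (fun p : ℝ × Space d => c • n + (p.1 • a + ι p.2)) volume
      (shadow a s S) = ENNReal.ofReal s * surfaceMeasure (d + 1) S := by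
    rw [(hι.measurableEmbedding_shear a ha c).map_apply, hι.preimage_shadow hn hS ha,
      Measure.volume_eq_prod, Measure.prod_prod, hι.surfaceMeasure_eq hn hS, Real.volume_Icc]
    simp
  rw [hι.map_shear hn a ha c, Measure.smul_apply, smul_eq_mul] at h1
  rw [mul_comm s, ENNReal.ofReal_mul (abs_nonneg _), mul_assoc, ← h1, ← mul_assoc,
    ← ENNReal.ofReal_mul (abs_nonneg _), abs_inv, mul_inv_cancel₀ (abs_ne_zero.2 ha)]
  simp

theorem measurableSet_shadow_hyperplane (hn : ‖n‖ = 1) (hS : S ⊆ {y | ⟪y, n⟫ = c})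
    (ha : ⟪a, n⟫ ≠ 0) (hSm : MeasurableSet S) : MeasurableSet (shadow a s S) := by
  obtain ⟨ι, hι⟩ := exists_isFrame hn
  have hemb := hι.measurableEmbedding_shear a ha c
  have hm : Measurable fun q => c • n + ι q := (isometry_hyperplane c n ι).continuous.measurable
  have h2 : shadow a s S ⊆ range fun p : ℝ × Space d => c • n + (p.1 • a + ι p.2) := by
    rintro x ⟨t, ht, hx⟩
    obtain ⟨q, hq⟩ := (hι.range_hyperplane hn c).ge (hS hx)
    refine ⟨(-t, q), ?_⟩
    have hq : c • n + ι q = x + t • a := hq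
    calc c • n + (-t • a + ι q) = c • n + ι q - t • a := by rw [neg_smul]; abel
      _ = x := by rw [hq]; abel
  rw [← image_preimage_eq_of_subset h2, hemb.measurableSet_image, hι.preimage_shadow hn hS ha]
  exact measurableSet_Icc.prod (hm hSm)

/-- The integral over the shadow of a flat set, to first order in `s`. -/
theorem abs_integral_shadow_sub_le (hn : ‖n‖ = 1) (hS : S ⊆ {y | ⟪y, n⟫ = c})
    (ha : ⟪a, n⟫ ≠ 0) (hs : 0 ≤ s) (hSm : MeasurableSet S)
    (hfin : surfaceMeasure (d + 1) S < ⊤) {θ : Space (d + 1) → ℝ} {C : NNReal} {B : ℝ}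
    (hθ : LipschitzWith C θ) (hB : ∀ x, |θ x| ≤ B) :
    |(∫ x in shadow a s S, θ x) - s * |⟪a, n⟫| * ∫ x in S, θ x ∂surfaceMeasure (d + 1)| ≤
      C * ‖a‖ * |⟪a, n⟫| * (surfaceMeasure (d + 1)).real S * s ^ 2 := by
  obtain ⟨ι, hι⟩ := exists_isFrame hn
  set b := ⟪a, n⟫ with hb
  set Λ := fun p : ℝ × Space d => c • n + (p.1 • a + ι p.2) with hΛ
  set Q := (fun q => c • n + ι q) ⁻¹' S with hQ
  have hemb : MeasurableEmbedding Λ := hι.measurableEmbedding_shear a ha c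
  have hbpos : 0 < |b| := abs_pos.2 ha
  have hQfin : volume Q < ⊤ := by rwa [← hι.surfaceMeasure_eq hn hS]
  have hm : Measurable fun q => c • n + ι q := (isometry_hyperplane c n ι).continuous.measurable
  have hQm : MeasurableSet Q := hm hSm
  have hvol : (volume : Measure (Space (d + 1))) =
      ENNReal.ofReal |b| • Measure.map Λ volume := by
    rw [hι.map_shear hn a ha c, smul_smul, ← ENNReal.ofReal_mul hbpos.le, abs_inv,
      mul_inv_cancel₀ hbpos.ne']
    simp
  have hI : (∫ x in shadow a s S, θ x) = |b| * ∫ p in Icc (-s) 0 ×ˢ Q, θ (Λ p) := by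
    rw [← hι.preimage_shadow hn hS ha, ← hemb.setIntegral_map, hvol, Measure.restrict_smul,
      integral_smul_measure, ENNReal.toReal_ofReal hbpos.le, smul_eq_mul]
  have hJ : ∫ x in S, θ x ∂surfaceMeasure (d + 1) = ∫ q in Q, θ (c • n + ι q) := by
    have : (surfaceMeasure (d + 1)).restrict S =
        ((surfaceMeasure (d + 1)).restrict {y | ⟪y, n⟫ = c}).restrict S := by
      rw [Measure.restrict_restrict hSm, inter_eq_left.2 hS]
    rw [this, ← hι.map_hyperplane hn c,
      (isometry_hyperplane c n ι).isClosedEmbedding.measurableEmbedding.setIntegral_map]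
  have hJ' : s * ∫ q in Q, θ (c • n + ι q) =
      ∫ p in Icc (-s) 0 ×ˢ Q, θ (c • n + ι p.2) := by
    have := setIntegral_prod_mul (μ := (volume : Measure ℝ)) (ν := (volume : Measure (Space d)))
      (fun _ => (1 : ℝ)) (fun q => θ (c • n + ι q)) (Icc (-s) 0) Q
    rw [← Measure.volume_eq_prod] at this
    simp only [one_mul] at this
    rw [this]
    simp [hs]
  have hfin2 : volume (Icc (-s) 0 ×ˢ Q) < ⊤ := by
    rw [Measure.volume_eq_prod, Measure.prod_prod]
    exact ENNReal.mul_lt_top (by simp) hQfin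
  have hθc := hθ.continuous
  have hιc := ι.continuous
  have hbd : ∀ {F : ℝ × Space d → Space (d + 1)}, Continuous F →
      IntegrableOn (fun p => θ (F p)) (Icc (-s) 0 ×ˢ Q) := by
    intro F hF
    refine Measure.integrableOn_of_bounded hfin2.ne (by fun_prop) (M := B) ?_
    exact Eventually.of_forall fun x => hB _
  rw [hI, hJ, mul_comm s, mul_assoc, hJ', ← mul_sub, ← integral_sub (hbd (by fun_prop))
    (hbd (by fun_prop)), abs_mul, abs_abs]
  -- The two evaluation points lie on the same fibre, at distance `|p.1| * ‖a‖ ≤ s * ‖a‖`; the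
  -- volume of the box supplies the second factor `s`.
  have key : ‖∫ p in Icc (-s) 0 ×ˢ Q, (θ (Λ p) - θ (c • n + ι p.2))‖ ≤
      C * (s * ‖a‖) * volume.real (Icc (-s) 0 ×ˢ Q) := by
    refine norm_setIntegral_le_of_norm_le_const hfin2 fun p hp => ?_
    rw [← dist_eq_norm]
    refine (hθ.dist_le_mul _ _).trans ?_
    gcongr
    have : dist (Λ p) (c • n + ι p.2) = |p.1| * ‖a‖ := by
      have h1 : Λ p - (c • n + ι p.2) = p.1 • a := by
        simp only [hΛ]
        abel
      rw [dist_eq_norm, h1, norm_smul, Real.norm_eq_abs]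
    rw [this]
    gcongr
    rw [abs_of_nonpos hp.1.2]
    linarith [hp.1.1]
  have hreal : volume.real (Icc (-s) 0 ×ˢ Q) = s * (surfaceMeasure (d + 1)).real S := by
    rw [Measure.real, Measure.real, Measure.volume_eq_prod, Measure.prod_prod,
      hι.surfaceMeasure_eq hn hS, ENNReal.toReal_mul, Real.volume_Icc,
      ENNReal.toReal_ofReal (by linarith)]
    ring
  rw [hreal, Real.norm_eq_abs] at key
  calc _ ≤ |b| * (C * (s * ‖a‖) * (s * (surfaceMeasure (d + 1)).real S)) := by gcongr
    _ = _ := by ring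

end ShadowHyperplane

theorem volume_eq_zero_of_surfaceMeasure {d : ℕ} {Z : Set (Space (d + 1))}
    (hZ : surfaceMeasure (d + 1) Z < ⊤) : volume Z = 0 := by
  have := Measure.euclideanHausdorffMeasure_zero_or_top (Nat.lt_succ_self d) Z
  rw [EuclideanSpace.euclideanHausdorffMeasure_eq_volume] at this
  exact this.resolve_right hZ.ne

/-- Maps with Lipschitz constant 1 do not increase Hausdorff measure, and both sides carry the same
normalizing constant because both measures have dimension `d`. -/
theorem surfaceMeasure_image_le {d : ℕ} {f : Space (d + 1) → Space d} (hf : LipschitzWith 1 f)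
    (Z : Set (Space (d + 1))) : volume (f '' Z) ≤ surfaceMeasure (d + 1) Z := by
  have := hf.hausdorffMeasure_image_le (d := d) (by positivity) Z
  rw [← EuclideanSpace.euclideanHausdorffMeasure_eq_volume d, surfaceMeasure, Nat.add_sub_cancel,
    Measure.euclideanHausdorffMeasure_def, Measure.euclideanHausdorffMeasure_def,
    Measure.smul_apply, Measure.smul_apply]
  gcongr
  simpa using this

/-- The orthogonal projection onto the hyperplane orthogonal to `n`, in the coordinates of a
frame. -/
theorem IsFrame.exists_proj {d : ℕ} {n : Space (d + 1)} {ι : Space d →ₗᵢ[ℝ] Space (d + 1)}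
    (hι : IsFrame n ι) (hn : ‖n‖ = 1) :
    ∃ P : Space (d + 1) → Space d, LipschitzWith 1 P ∧ (∀ y, y = ⟪y, n⟫ • n + ι (P y)) := by
  choose P hP using hι.exists_eq hn
  refine ⟨P, LipschitzWith.of_dist_le_mul fun x y => ?_, hP⟩
  have h1 : x - y = ⟪x - y, n⟫ • n + ι (P x - P y) := by
    conv_lhs => rw [hP x, hP y]
    rw [inner_sub_left, sub_smul, map_sub]
    abel
  have h2 : ‖x - y‖ ^ 2 = ⟪x - y, n⟫ ^ 2 + ‖P x - P y‖ ^ 2 := by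
    conv_lhs => rw [h1]
    rw [norm_add_sq_real, inner_smul_left, real_inner_comm (ι _) n, hι.1, norm_smul, hn,
      LinearIsometry.norm_map]
    simp
  rw [dist_eq_norm, dist_eq_norm, NNReal.coe_one, one_mul]
  exact le_of_sq_le_sq (by nlinarith [sq_nonneg ⟪x - y, n⟫]) (norm_nonneg _)

/-- For `a ≠ 0` the shadow lies in the cylinder along `a` over the orthogonal projection of `Z`, and
that projection is null in dimension `d`. Flatness of `Z` is not needed, so this disposes of
negligible interfaces and of the exceptional part of `∂Ω`. -/
theorem volume_shadow_null {d : ℕ} {Z : Set (Space (d + 1))} (hZ : surfaceMeasure (d + 1) Z = 0)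
    (a : Space (d + 1)) (s : ℝ) : volume (shadow a s Z) = 0 := by
  rcases eq_or_ne a 0 with rfl | ha
  · refine measure_mono_null (t := Z) ?_ (volume_eq_zero_of_surfaceMeasure (by simp [hZ]))
    rintro x ⟨t, -, hx⟩
    simpa using hx
  · obtain ⟨n, hn, han⟩ : ∃ n : Space (d + 1), ‖n‖ = 1 ∧ a = ‖a‖ • n := by
      refine ⟨‖a‖⁻¹ • a, ?_, ?_⟩
      · rw [norm_smul, norm_inv, norm_norm, inv_mul_cancel₀ (norm_ne_zero_iff.2 ha)]
      · rw [smul_smul, mul_inv_cancel₀ (norm_ne_zero_iff.2 ha), one_smul]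
    obtain ⟨ι, hι⟩ := exists_isFrame hn
    obtain ⟨P, hP, hP'⟩ := hι.exists_proj hn
    have hnull : volume (P '' Z) = 0 := le_antisymm ((surfaceMeasure_image_le hP Z).trans hZ.le)
      (zero_le)
    have hnull2 : volume ((univ : Set ℝ) ×ˢ (P '' Z)) = 0 := by
      rw [Measure.volume_eq_prod, Measure.prod_prod, hnull, mul_zero]
    have hshear := hι.map_shear hn n (by rw [real_inner_self_eq_norm_sq, hn]; simp) 0
    rw [real_inner_self_eq_norm_sq, hn] at hshear
    simp only [zero_smul, zero_add, one_pow, inv_one, abs_one, ENNReal.ofReal_one, one_smul]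
      at hshear
    have hemb := hι.measurableEmbedding_shear n
      (by rw [real_inner_self_eq_norm_sq, hn]; simp) 0
    simp only [zero_smul, zero_add] at hemb
    rw [← hshear, hemb.map_apply]
    refine measure_mono_null ?_ hnull2
    rintro ⟨r, q⟩ ⟨t, -, hx⟩
    refine ⟨trivial, _, hx, ?_⟩
    have h1 := hP' (r • n + ι q + t • a)
    have h2 : r • n + ι q + t • a = (r + t * ‖a‖) • n + ι q := by
      conv_lhs => rw [han]
      rw [add_smul, smul_smul]; abel
    rw [h2, hι.inner_eq hn] at h1
    have := ι.injective (add_left_cancel h1)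
    simp only [h2]
    exact this.symm

/-! ### Cones over flat sets -/

section Cone

variable {d : ℕ} {n p : Space (d + 1)} {c α : ℝ} {S : Set (Space (d + 1))}

/-- Each point of the cone is described by its height over the apex and its radial projection to the
hyperplane, a form that is measurable and can be sliced. The apex stands apart because it has no
radial projection. -/
theorem convexJoin_singleton_eq (hS : S ⊆ {y | ⟪y, n⟫ = c}) (hα : 0 < α) (hp : ⟪p, n⟫ = c - α)
    (hne : S.Nonempty) : convexJoin ℝ {p} S =
      {p} ∪ {x | ⟪x - p, n⟫ ∈ Ioc 0 α ∧ p + (α / ⟪x - p, n⟫) • (x - p) ∈ S} := by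
  have hin : ∀ z ∈ S, ⟪z - p, n⟫ = α := by
    intro z hz
    have : ⟪z, n⟫ = c := hS hz
    rw [inner_sub_left, this, hp]
    ring
  ext x
  simp only [mem_convexJoin, mem_singleton_iff, exists_eq_left, mem_union, mem_ofPred_eq]
  constructor
  · rintro ⟨z, hz, hx⟩
    rw [segment_eq_image_lineMap] at hx
    obtain ⟨r, hr, rfl⟩ := hx
    rcases eq_or_lt_of_le hr.1 with h0 | h0
    · left
      simp [← h0]
    · right
      have h1 : AffineMap.lineMap p z r - p = r • (z - p) := by
        rw [AffineMap.lineMap_apply]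
        simp
      rw [h1, inner_smul_left, hin z hz]
      simp only [conj_trivial]
      refine ⟨⟨by positivity, by nlinarith [hr.2]⟩, ?_⟩
      rw [smul_smul, show α / (r * α) * r = 1 by field_simp]
      simpa using hz
  · rintro (rfl | ⟨h, hz⟩)
    · exact ⟨hne.some, hne.some_mem, left_mem_segment ℝ _ _⟩
    · refine ⟨_, hz, ?_⟩
      rw [segment_eq_image_lineMap]
      refine ⟨⟪x - p, n⟫ / α, ⟨by have := h.1; positivity, (div_le_one hα).2 h.2⟩, ?_⟩
      rw [AffineMap.lineMap_apply]
      simp only [vsub_eq_sub, add_sub_cancel_left, vadd_eq_add, smul_smul]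
      have := h.1.ne'
      rw [show ⟪x - p, n⟫ / α * (α / ⟪x - p, n⟫) = 1 by field_simp]
      simp

/-- The slice at height `t` is the base scaled by `t / α`, of measure `(t / α) ^ d` times that of
the base; integration over `(0, α]` gives the factor `α / (d + 1)`. The value `α = 0` is included
because a centre may lie in the hyperplane of an interface. -/
theorem nullMeasurableSet_convexJoin_singleton (hn : ‖n‖ = 1) (hS : S ⊆ {y | ⟪y, n⟫ = c})
    (hα : 0 ≤ α) (hp : ⟪p, n⟫ = c - α) (hSm : MeasurableSet S) :
    NullMeasurableSet (convexJoin ℝ {p} S) ∧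
      volume (convexJoin ℝ {p} S) =
        ENNReal.ofReal (α / (d + 1 : ℕ)) * surfaceMeasure (d + 1) S := by
  rcases S.eq_empty_or_nonempty with rfl | hne
  · simp
  rcases hα.eq_or_lt with rfl | hα
  · have hnull : volume (convexJoin ℝ {p} S) = 0 := by
      refine measure_mono_null ?_ (volume_hyperplane hn c)
      intro x hx
      rw [mem_convexJoin] at hx
      obtain ⟨p', rfl, z, hz, hx⟩ := hx
      have hz : ⟪z, n⟫ = c := hS hz
      obtain ⟨u, v, -, -, huv, rfl⟩ := hx
      change ⟪u • p' + v • z, n⟫ = c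
      rw [inner_add_left, inner_smul_left, inner_smul_left, hz, hp]
      simp only [conj_trivial]
      linear_combination c * huv
    exact ⟨.of_null hnull, by rw [hnull]; simp⟩
  rw [convexJoin_singleton_eq hS hα hp hne]
  set C := {x | ⟪x - p, n⟫ ∈ Ioc 0 α ∧ p + (α / ⟪x - p, n⟫) • (x - p) ∈ S} with hC
  have hCm : MeasurableSet C := by
    refine MeasurableSet.inter ?_ ?_
    · exact measurableSet_Ioc.preimage
        (Continuous.measurable (by fun_prop : Continuous fun x => ⟪x - p, n⟫))
    · refine hSm.preimage (f := fun x => p + (α / ⟪x - p, n⟫) • (x - p)) ?_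
      have h1 : Measurable fun x : Space (d + 1) => ⟪x - p, n⟫ :=
        Continuous.measurable (by fun_prop)
      exact measurable_const.add ((measurable_const.div h1).smul
        (measurable_id.sub measurable_const))
  refine ⟨((measurableSet_singleton p).union hCm).nullMeasurableSet, ?_⟩
  have hun : volume ({p} ∪ C) = volume C :=
    le_antisymm ((measure_union_le _ _).trans (by simp)) (measure_mono subset_union_right)
  rw [hun]
  obtain ⟨ι, hι⟩ := exists_isFrame hn
  obtain ⟨q₀, hq₀⟩ := hι.exists_eq hn p
  set Q := (fun q => c • n + ι q) ⁻¹' S with hQ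
  have hQm : MeasurableSet Q := (isometry_hyperplane c n ι).continuous.measurable hSm
  have hMP : MeasurePreserving (fun z : ℝ × Space d => p + (z.1 • n + ι z.2)) :=
    (measurePreserving_add_left volume p).comp (hι.measurePreserving hn)
  have hpre : (fun z : ℝ × Space d => p + (z.1 • n + ι z.2)) ⁻¹' C =
      {z | z.1 ∈ Ioc 0 α ∧ (α / z.1) • z.2 ∈ (fun q => q₀ + q) ⁻¹' Q} := by
    ext ⟨t, q⟩
    simp only [hC, hQ, mem_preimage, mem_ofPred_eq, add_sub_cancel_left, hι.inner_eq hn]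
    refine and_congr_right fun ht => ?_
    have h2 : p + (α / t) • (t • n + ι q) = c • n + ι (q₀ + (α / t) • q) := by
      conv_lhs => rw [hq₀, hp]
      have := ht.1.ne'
      rw [smul_add, smul_smul, show α / t * t = α by field_simp, map_add, map_smul, sub_smul]
      abel
    rw [h2]
  have hpm := hMP.measurable hCm
  rw [← hMP.measure_preimage hCm.nullMeasurableSet, hpre, Measure.volume_eq_prod,
    Measure.prod_apply (hpre ▸ hpm), hι.surfaceMeasure_eq hn hS]
  have hslice : ∀ t : ℝ, volume (Prod.mk t ⁻¹' {z : ℝ × Space d |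
      z.1 ∈ Ioc 0 α ∧ (α / z.1) • z.2 ∈ (fun q => q₀ + q) ⁻¹' Q}) =
      (Ioc 0 α).indicator (fun t => ENNReal.ofReal ((t / α) ^ d) * volume Q) t := by
    intro t
    by_cases ht : t ∈ Ioc 0 α
    · have h1 : Prod.mk t ⁻¹' {z : ℝ × Space d |
          z.1 ∈ Ioc 0 α ∧ (α / z.1) • z.2 ∈ (fun q => q₀ + q) ⁻¹' Q} =
          (fun q => (α / t) • q) ⁻¹' ((fun q => q₀ + q) ⁻¹' Q) := by
        ext q
        simp [ht.1, ht.2]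
      rw [h1, Measure.addHaar_preimage_smul _ (by have := ht.1; positivity),
        measure_preimage_add, indicator_of_mem ht]
      congr 2
      have := ht.1
      rw [abs_of_pos (by positivity), finrank_euclideanSpace_fin, ← inv_pow, inv_div]
    · rw [indicator_of_notMem ht]
      have h1 : Prod.mk t ⁻¹' {z : ℝ × Space d |
          z.1 ∈ Ioc 0 α ∧ (α / z.1) • z.2 ∈ (fun q => q₀ + q) ⁻¹' Q} = ∅ := by
        ext q
        simp only [mem_preimage, mem_ofPred_eq, mem_empty_iff_false, iff_false]
        tauto
      rw [h1, measure_empty]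
  simp_rw [hslice]
  rw [lintegral_indicator measurableSet_Ioc, lintegral_mul_const _ (by fun_prop)]
  congr 1
  rw [← ofReal_integral_eq_lintegral_ofReal]
  · rw [← intervalIntegral.integral_of_le hα.le]
    congr 1
    simp_rw [div_pow]
    rw [intervalIntegral.integral_div, integral_pow]
    push_cast
    field_simp
    ring
  · change IntegrableOn _ _ _
    rw [← intervalIntegrable_iff_integrableOn_Ioc_of_le hα.le]
    exact Continuous.intervalIntegrable (by fun_prop) _ _
  · filter_upwards [ae_restrict_mem measurableSet_Ioc] with t ht
    have := ht.1
    positivity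

end Cone

end ZeroFluxFV

namespace ZeroFluxFV

/-! ### The boundary of a regular domain -/

section Normal

variable {ℓ : ℕ} {Ω : Set (Space ℓ)} {x ν : Space ℓ} {ε r : ℝ}

theorem exteriorNormal_spec (h : ∃ ν, IsExteriorNormal Ω x ν) :
    IsExteriorNormal Ω x (exteriorNormal Ω x) := by
  rw [exteriorNormal, dif_pos h]
  exact h.choose_spec

theorem norm_exteriorNormal_le (Ω : Set (Space ℓ)) (x : Space ℓ) : ‖exteriorNormal Ω x‖ ≤ 1 := by
  by_cases h : ∃ ν, IsExteriorNormal Ω x ν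
  · exact (exteriorNormal_spec h).1.le
  · simp [exteriorNormal, h]

/-- The quantitative form of the condition that defines the exterior normal. -/
def ConeCondition (Ω : Set (Space ℓ)) (ε r : ℝ) (x ν : Space ℓ) : Prop :=
  ∀ y, dist y x < r →
    (⟪y - x, ν⟫ < -(ε * ‖y - x‖) → y ∈ Ω) ∧ (ε * ‖y - x‖ < ⟪y - x, ν⟫ → y ∉ Ω)

/-- For fixed `y` the condition fails exactly on an open set of pairs, its premises being strict
inequalities; then intersect over `y`. -/
theorem isClosed_coneCondition (Ω : Set (Space ℓ)) (ε r : ℝ) :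
    IsClosed {p : Space ℓ × Space ℓ | ConeCondition Ω ε r p.1 p.2} := by
  simp only [ConeCondition, ofPred_forall]
  refine isClosed_iInter fun y => ?_
  have h1 : IsOpen {p : Space ℓ × Space ℓ | dist y p.1 < r} :=
    isOpen_lt (by fun_prop) (by fun_prop)
  have h2 : IsOpen {p : Space ℓ × Space ℓ | ⟪y - p.1, p.2⟫ < -(ε * ‖y - p.1‖)} :=
    isOpen_lt (by fun_prop) (by fun_prop)
  have h3 : IsOpen {p : Space ℓ × Space ℓ | ε * ‖y - p.1‖ < ⟪y - p.1, p.2⟫} :=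
    isOpen_lt (by fun_prop) (by fun_prop)
  by_cases hy : y ∈ Ω
  · convert! (h1.inter h3).isClosed_compl using 1
    ext p
    simp [hy]
  · convert! (h1.inter h2).isClosed_compl using 1
    ext p
    simp [hy]

/-- The boundary points with an approximate normal close to `ν`. -/
def flatPiece (Ω : Set (Space ℓ)) (ν : Space ℓ) (ε r : ℝ) : Set (Space ℓ) :=
  {x | x ∈ frontier Ω ∧ ∃ ν' ∈ Metric.sphere (0 : Space ℓ) 1 ∩ Metric.closedBall ν ε,
    ConeCondition Ω ε r x ν'}

/-- The cone condition is closed in the pair (point, normal), and projecting out a normal that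
ranges over a compact set preserves closedness. The measurability of the normal field rests on this.
-/
theorem isClosed_flatPiece (Ω : Set (Space ℓ)) (ν : Space ℓ) (ε r : ℝ) :
    IsClosed (flatPiece Ω ν ε r) := by
  refine isClosed_frontier.inter ?_
  set K := Metric.sphere (0 : Space ℓ) 1 ∩ Metric.closedBall ν ε
  have hK : IsCompact K := (isCompact_sphere _ _).inter_right Metric.isClosed_closedBall
  have : CompactSpace K := isCompact_iff_compactSpace.1 hK
  have hc : IsClosed {p : Space ℓ × K | ConeCondition Ω ε r p.1 p.2} :=
    (isClosed_coneCondition Ω ε r).preimage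
      (f := fun p : Space ℓ × K => (p.1, (p.2 : Space ℓ))) (by fun_prop)
  have himg : Prod.fst '' {p : Space ℓ × K | ConeCondition Ω ε r p.1 p.2} =
      {x | ∃ ν' ∈ K, ConeCondition Ω ε r x ν'} := by
    ext x
    simp
  have hcl := isClosedMap_fst_of_compactSpace _ hc
  rwa [himg] at hcl

/-- A boundary point does not belong to the open set `Ω`, so it avoids the inner cone; it is a limit
of points of `Ω`, so it avoids the open outer cone. -/
theorem abs_inner_le_of_coneCondition (hΩ : IsOpen Ω) {x' : Space ℓ} (hx' : x' ∈ frontier Ω)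
    (h : ConeCondition Ω ε r x ν) (hr : dist x' x < r) :
    |⟪x' - x, ν⟫| ≤ ε * ‖x' - x‖ := by
  have hnot : x' ∉ Ω := fun h' => (hΩ.frontier_eq ▸ hx').2 h'
  rw [abs_le]
  constructor
  · by_contra! hlt
    exact hnot ((h x' hr).1 hlt)
  · by_contra! hlt
    have ho : IsOpen {y | dist y x < r ∧ ε * ‖y - x‖ < ⟪y - x, ν⟫} :=
      IsOpen.inter (isOpen_lt (f := fun y => dist y x) (g := fun _ => r) (by fun_prop)
        (by fun_prop)) (isOpen_lt (f := fun y => ε * ‖y - x‖) (g := fun y => ⟪y - x, ν⟫)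
        (by fun_prop) (by fun_prop))
    have hcl : x' ∈ closure Ω := hx'.1
    obtain ⟨y, ⟨hy1, hy2⟩, hy⟩ := mem_closure_iff.1 hcl _ ho ⟨hr, hlt⟩
    exact (h y hy1).2 hy2 hy

/-- Let `w = ν - ν'`. If `‖w‖ > 2 * ε`, then `ε * ‖w‖ < ‖w‖ ^ 2 / 2 = ⟪w, ν⟫ = -⟪w, ν'⟫`, and a
small step along `w` would lie outside `Ω` according to `ν` and inside according to `ν'`. -/
theorem norm_sub_le_of_coneCondition {ν' : Space ℓ} (hε : 0 < ε) (hr : 0 < r) (hν : ‖ν‖ = 1)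
    (h : ConeCondition Ω ε r x ν) (h' : IsExteriorNormal Ω x ν') : ‖ν - ν'‖ ≤ 2 * ε := by
  by_contra! hlt
  have hν' := h'.1
  set c : ℝ := ⟪ν, ν'⟫ with hc
  set w : Space ℓ := ν - ν' with hw
  have hwν : ⟪w, ν⟫ = 1 - c := by
    rw [hw, inner_sub_left, real_inner_self_eq_norm_sq, hν, real_inner_comm, ← hc]; norm_num
  have hwν' : ⟪w, ν'⟫ = -(1 - c) := by
    rw [hw, inner_sub_left, real_inner_self_eq_norm_sq, hν', ← hc]; norm_num
  have hww : ‖w‖ ^ 2 = 2 * (1 - c) := by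
    rw [hw, norm_sub_sq_real, hν, hν', ← hc]; ring
  have hlim : Tendsto (fun t : ℝ => x + t • w) (𝓝[>] 0) (𝓝 x) := by
    have : Tendsto (fun t : ℝ => x + t • w) (𝓝 0) (𝓝 (x + (0 : ℝ) • w)) :=
      (Continuous.tendsto (by fun_prop) 0)
    rw [zero_smul, add_zero] at this
    exact this.mono_left nhdsWithin_le_nhds
  have hb : ∀ᶠ y in 𝓝 x, dist y x < r := Metric.ball_mem_nhds x hr
  obtain ⟨t, ⟨h1, h2⟩, ht⟩ :=
    ((hlim.eventually (hb.and (h'.2 ε hε))).and self_mem_nhdsWithin).exists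
  have ht : 0 < t := ht
  have h3 := h _ h1
  have hnorm : ε * ‖t • w‖ = t * (ε * ‖w‖) := by
    rw [norm_smul, Real.norm_of_nonneg ht.le]; ring
  have hlt2 : ε * ‖w‖ < 1 - c := by nlinarith
  simp only [add_sub_cancel_left, inner_smul_left, hnorm, hwν, hwν', conj_trivial] at h2 h3
  exact h3.2 (by nlinarith) (h2.1 (by nlinarith))

theorem mem_flatPiece_of_isExteriorNormal (hx : x ∈ frontier Ω) (h : IsExteriorNormal Ω x ν)
    {ν₀ : Space ℓ} (hε : 0 < ε) (hν : dist ν ν₀ ≤ ε) :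
    ∃ m : ℕ, x ∈ flatPiece Ω ν₀ ε (1 / (m + 1)) := by
  obtain ⟨r, hr, hr'⟩ := Metric.eventually_nhds_iff.1 (h.2 ε hε)
  obtain ⟨m, hm⟩ := exists_nat_one_div_lt hr
  exact ⟨m, hx, ν, ⟨by simpa using h.1, hν⟩, fun y hy => hr' (hy.trans hm)⟩

theorem norm_exteriorNormal_sub_le {ν₀ : Space ℓ} (hε : 0 < ε) (hr : 0 < r)
    (hx : x ∈ flatPiece Ω ν₀ ε r) (h : ∃ ν, IsExteriorNormal Ω x ν) :
    ‖exteriorNormal Ω x - ν₀‖ ≤ 3 * ε := by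
  obtain ⟨-, ν', ⟨h1, h2⟩, h3⟩ := hx
  have h4 := norm_sub_le_of_coneCondition hε hr (by simpa using h1) h3 (exteriorNormal_spec h)
  calc _ = ‖(ν' - ν₀) - (ν' - exteriorNormal Ω x)‖ := by congr 1; abel
    _ ≤ ‖ν' - ν₀‖ + ‖ν' - exteriorNormal Ω x‖ := norm_sub_le _ _
    _ ≤ ε + 2 * ε := add_le_add (by simpa [dist_eq_norm] using h2) h4
    _ = _ := by ring

/-- The normal is produced by choice, so its measurability comes from uniform approximation: take
the first member of a dense sequence whose flat pieces with tolerance `ε / 3` contain the point. It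
is within `3 * (ε / 3)` of the normal. -/
theorem IsRegularDomain.aemeasurable_exteriorNormal (hΩ : IsRegularDomain Ω) :
    AEMeasurable (exteriorNormal Ω) ((surfaceMeasure ℓ).restrict (frontier Ω)) := by
  classical
  refine aemeasurable_of_unif_approx fun ε hε => ?_
  set D : ℕ → Space ℓ := TopologicalSpace.denseSeq (Space ℓ)
  set G : ℕ → Set (Space ℓ) := fun i => ⋃ m : ℕ, flatPiece Ω (D i) (ε / 3) (1 / (m + 1))
  have hG : ∀ i, MeasurableSet (G i) := fun i =>
    MeasurableSet.iUnion fun m => (isClosed_flatPiece _ _ _ _).measurableSet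
  -- The second alternative only makes the search for the first index total.
  have hex : ∀ x, ∃ i, x ∈ G i ∨ x ∉ ⋃ j, G j := by
    intro x
    by_cases h : x ∈ ⋃ j, G j
    · obtain ⟨i, hi⟩ := mem_iUnion.1 h
      exact ⟨i, Or.inl hi⟩
    · exact ⟨0, Or.inr h⟩
  refine ⟨fun x => D (Nat.find (hex x)), Measurable.aemeasurable ?_, ?_⟩
  · exact Measurable.find (f := fun i _ => D i) (p := fun i x => x ∈ G i ∨ x ∉ ⋃ j, G j) (fun _ => measurable_const)
      (fun i => (hG i).union (MeasurableSet.iUnion hG).compl) hex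
  · filter_upwards [hΩ.ae_normal, ae_restrict_mem isClosed_frontier.measurableSet] with x hx hxf
    have hmem : x ∈ ⋃ j, G j := by
      have hd := (TopologicalSpace.denseRange_denseSeq (Space ℓ)).exists_dist_lt
        (exteriorNormal Ω x) (show 0 < ε / 3 by positivity)
      obtain ⟨i, hi⟩ := hd
      obtain ⟨m, hm⟩ := mem_flatPiece_of_isExteriorNormal hxf (exteriorNormal_spec hx)
        (show 0 < ε / 3 by positivity) hi.le
      exact mem_iUnion.2 ⟨i, mem_iUnion.2 ⟨m, hm⟩⟩
    have h1 := (Nat.find_spec (hex x)).resolve_right (by simpa using hmem)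
    obtain ⟨m, hm⟩ := mem_iUnion.1 h1
    have h2 := norm_exteriorNormal_sub_le (show 0 < ε / 3 by positivity) (by positivity) hm hx
    rw [dist_comm, dist_eq_norm]
    linarith

end Normal

/-! ### The volume of the shadow of the boundary -/

/-- Almost flat sets: the volume of their shadow is almost that of a prism. -/
theorem exists_volume_shadow_le {d : ℕ} {ν : Space (d + 1)} (hν : ‖ν‖ = 1) (a : Space (d + 1))
    {m : NNReal} (hm : ENNReal.ofReal |⟪a, ν⟫| < m) :
    ∃ δ : ℝ, 0 < δ ∧ ∀ E : Set (Space (d + 1)),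
      (∀ x ∈ E, ∀ y ∈ E, |⟪x - y, ν⟫| ≤ δ * ‖x - y‖) → ∀ s : ℝ,
        volume (shadow a s E) ≤ m * (ENNReal.ofReal s * surfaceMeasure (d + 1) E) := by
  let M : Space (d + 1) →ₗ[ℝ] Space (d + 1) := LinearMap.transvection (innerₗ _ ν) (a - ν)
  have hM : LinearMap.det M = ⟪a, ν⟫ := by
    rw [LinearMap.transvection.det]
    simp [inner_sub_right, hν, real_inner_comm]
  have hMx : ∀ y, M y = y + ⟪y, ν⟫ • (a - ν) := by
    intro y
    simp only [M, LinearMap.transvection.apply, innerₗ_apply_apply]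
    rw [real_inner_comm]
  let A : Space (d + 1) →L[ℝ] Space (d + 1) := LinearMap.toContinuousLinearMap M
  have hA : A.det = ⟪a, ν⟫ := by
    rw [← hM]; rfl
  -- A map close to the linear map `A` in the sense of `ApproximatesLinearOn` multiplies volumes by
  -- at most `m`, as `m` exceeds the absolute value of the determinant. The shadow is contained in
  -- the image of a straight box under such a map.
  obtain ⟨δ₀, hδ₀, hδ₀pos⟩ := ((addHaar_image_le_mul_of_det_lt volume A (m := m)
    (by rwa [hA])).and self_mem_nhdsWithin).exists
  have hδ₀pos : 0 < δ₀ := hδ₀pos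
  obtain ⟨ι, hι⟩ := exists_isFrame hν
  obtain ⟨P, hP, hP'⟩ := hι.exists_proj hν
  refine ⟨min (δ₀ / 2) (1 / 2), by positivity, fun E hE s => ?_⟩
  set δ : ℝ := min (δ₀ / 2) (1 / 2) with hδ
  have hdiff : ∀ x y, x - y = ⟪x - y, ν⟫ • ν + ι (P x - P y) := by
    intro x y
    conv_lhs => rw [hP' x, hP' y]
    rw [inner_sub_left, sub_smul, map_sub]
    abel
  -- As `δ ≤ 1 / 2`, at most half of the distance lies along `ν`. Hence `P` is injective on `E`, and
  -- its inverse `g` is Lipschitz with constant 2.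
  have hexp : ∀ x ∈ E, ∀ y ∈ E, ‖x - y‖ ≤ 2 * ‖P x - P y‖ := by
    intro x hx y hy
    have h1 : ‖x - y‖ ≤ |⟪x - y, ν⟫| + ‖P x - P y‖ := by
      conv_lhs => rw [hdiff x y]
      refine (norm_add_le _ _).trans ?_
      rw [norm_smul, hν, LinearIsometry.norm_map]
      simp
    have h2 := hE x hx y hy
    have h3 : δ ≤ 1 / 2 := min_le_right _ _
    nlinarith [norm_nonneg (x - y)]
  have hg : ∀ q : Space d, ∃ z, q ∈ P '' E → z ∈ E ∧ P z = q := by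
    intro q
    by_cases h : q ∈ P '' E
    · obtain ⟨z, hz, rfl⟩ := h
      exact ⟨z, fun _ => ⟨hz, rfl⟩⟩
    · exact ⟨0, fun h' => absurd h' h⟩
  choose g hg using hg
  set S : Set (Space (d + 1)) := (fun p : ℝ × Space d => p.1 • ν + ι p.2) ''
    (Icc (-s) 0 ×ˢ (P '' E)) with hS
  have hemb : MeasurableEmbedding fun p : ℝ × Space d => p.1 • ν + ι p.2 := by
    have := hι.measurableEmbedding_shear ν (by rw [real_inner_self_eq_norm_sq, hν]; simp) 0
    simpa using this
  have hvolS : volume S ≤ ENNReal.ofReal s * surfaceMeasure (d + 1) E := by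
    rw [← (hι.measurePreserving hν).map_eq, hemb.map_apply, hS,
      preimage_image_eq _ hemb.injective, Measure.volume_eq_prod, Measure.prod_prod,
      Real.volume_Icc]
    simp only [sub_neg_eq_add, zero_add]
    gcongr
    exact surfaceMeasure_image_le hP E
  have hPι : ∀ (t : ℝ) (q : Space d), P (t • ν + ι q) = q := by
    intro t q
    have h1 := hP' (t • ν + ι q)
    rw [hι.inner_eq hν] at h1
    exact (ι.injective (add_left_cancel h1)).symm
  -- `f` sends the base of the box to `E` itself, seen as a graph over its projection, and the
  -- segments along `ν` to segments along `a`.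
  set f : Space (d + 1) → Space (d + 1) := fun y => g (P y) + ⟪y, ν⟫ • a with hf
  have happ : ApproximatesLinearOn f A S δ₀ := by
    rw [hS]
    rintro _ ⟨⟨t, q⟩, ⟨-, hq⟩, rfl⟩ _ ⟨⟨t', q'⟩, ⟨-, hq'⟩, rfl⟩
    dsimp only at hq hq' ⊢
    obtain ⟨h1, h2⟩ := hg q hq
    obtain ⟨h1', h2'⟩ := hg q' hq'
    -- Only the tilt of `E` separates `f` from `A`; it is at most `δ * (2 * ‖q - q'‖) ≤ δ₀ * ‖q -
    -- q'‖`.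
    have h3 : f (t • ν + ι q) - f (t' • ν + ι q') - A (t • ν + ι q - (t' • ν + ι q')) =
        ⟪g q - g q', ν⟫ • ν := by
      have h4 := hdiff (g q) (g q')
      rw [h2, h2'] at h4
      have h5 : ⟪t • ν + ι q - (t' • ν + ι q'), ν⟫ = t - t' := by
        rw [inner_sub_left, hι.inner_eq hν, hι.inner_eq hν]
      change g (P (t • ν + ι q)) + ⟪t • ν + ι q, ν⟫ • a -
        (g (P (t' • ν + ι q')) + ⟪t' • ν + ι q', ν⟫ • a) - M _ = _
      rw [hMx, h5, hPι, hPι, hι.inner_eq hν, hι.inner_eq hν]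
      rw [← sub_eq_iff_eq_add] at h4
      rw [← h4, map_sub]
      module
    rw [h3, norm_smul, hν, mul_one, Real.norm_eq_abs]
    have h6 : ‖q - q'‖ ≤ ‖t • ν + ι q - (t' • ν + ι q')‖ := by
      have := hP.dist_le_mul (t • ν + ι q) (t' • ν + ι q')
      rw [hPι, hPι, dist_eq_norm, dist_eq_norm, NNReal.coe_one, one_mul] at this
      exact this
    have h7 := hexp _ h1 _ h1'
    rw [h2, h2'] at h7
    have h8 : δ ≤ δ₀ / 2 := min_le_left _ _
    have h9 : 0 ≤ δ := by positivity
    calc |⟪g q - g q', ν⟫| ≤ δ * ‖g q - g q'‖ := hE _ h1 _ h1'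
      _ ≤ δ₀ / 2 * (2 * ‖q - q'‖) := by gcongr
      _ = δ₀ * ‖q - q'‖ := by ring
      _ ≤ _ := by gcongr
  have hsub : shadow a s E ⊆ f '' S := by
    rintro x ⟨t, ht, hx⟩
    set z := x + t • a with hz
    have hPz : P z ∈ P '' E := mem_image_of_mem P hx
    refine ⟨(-t) • ν + ι (P z), ⟨(-t, P z), ⟨⟨by linarith [ht.2], by linarith [ht.1]⟩, hPz⟩, rfl⟩, ?_⟩
    have h1 : g (P z) = z := by
      obtain ⟨h2, h3⟩ := hg _ hPz
      have h4 := hexp _ h2 _ hx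
      rw [h3, sub_self, norm_zero, mul_zero] at h4
      exact sub_eq_zero.1 (norm_le_zero_iff.1 h4)
    change g (P ((-t) • ν + ι (P z))) + ⟪(-t) • ν + ι (P z), ν⟫ • a = x
    rw [hPι, h1, hι.inner_eq hν, hz]
    module
  calc volume (shadow a s E) ≤ volume (f '' S) := measure_mono hsub
    _ ≤ m * volume S := hδ₀ S f happ
    _ ≤ _ := by gcongr

theorem mul_measure_le_setLIntegral {α : Type*} [MeasurableSpace α] {μ : Measure α} {E : Set α}
    {f : α → ENNReal} {c : ENNReal} (h : ∀ᵐ x ∂μ.restrict E, c ≤ f x) :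
    c * μ E ≤ ∫⁻ x in E, f x ∂μ := by
  rw [← setLIntegral_const]
  exact lintegral_mono_ae h

/-- The boundary is covered, up to a null set, by countably many closed sets on which the volume of
shadows is controlled. -/
theorem IsRegularDomain.exists_pieces {d : ℕ} {Ω : Set (Space (d + 1))} (hΩ : IsRegularDomain Ω)
    (a : Space (d + 1)) {ε : NNReal} (hε : 0 < ε) :
    ∃ F : ℕ → Set (Space (d + 1)), (∀ k, MeasurableSet (F k)) ∧
      surfaceMeasure (d + 1) (frontier Ω \ ⋃ k, F k) = 0 ∧
      ∀ k, ∀ E ⊆ F k, E ⊆ frontier Ω → ∀ s : ℝ, volume (shadow a s E) ≤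
        ENNReal.ofReal s * ∫⁻ x in E, (‖⟪a, exteriorNormal Ω x⟫‖ₑ + ε)
          ∂surfaceMeasure (d + 1) := by
  have hA : 0 < (ε : ℝ) / (2 * (‖a‖ + 1)) := by positivity
  -- The radius `δ ν` has two tasks: sets of slope `2 * δ` sweep volume with density at most `|⟪a,
  -- ν⟫| + ε / 2`, and replacing `ν` by the true normal, at distance at most `3 * δ`, costs at most
  -- another `ε / 2`.
  have hδ : ∀ ν : Space (d + 1), ∃ δ : ℝ, 0 < δ ∧ (‖ν‖ = 1 → ∀ E : Set (Space (d + 1)),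
      (∀ x ∈ E, ∀ y ∈ E, |⟪x - y, ν⟫| ≤ 2 * δ * ‖x - y‖) → ∀ s : ℝ,
        volume (shadow a s E) ≤ ((Real.toNNReal |⟪a, ν⟫| + ε / 2 : NNReal) : ENNReal) *
          (ENNReal.ofReal s * surfaceMeasure (d + 1) E)) ∧ 3 * δ ≤ ε / (2 * (‖a‖ + 1)) := by
    intro ν
    by_cases hν : ‖ν‖ = 1
    · obtain ⟨δ, hδ, h⟩ := exists_volume_shadow_le hν a
        (m := Real.toNNReal |⟪a, ν⟫| + ε / 2) (by
          rw [ENNReal.ofReal, ENNReal.coe_lt_coe]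
          exact lt_add_of_pos_right _ (half_pos hε))
      refine ⟨min (δ / 2) (ε / (2 * (‖a‖ + 1)) / 3), by positivity, fun _ E hE s => ?_, ?_⟩
      · refine h E (fun x hx y hy => (hE x hx y hy).trans ?_) s
        gcongr
        linarith [min_le_left (δ / 2) (ε / (2 * (‖a‖ + 1)) / 3)]
      · linarith [min_le_right (δ / 2) (ε / (2 * (‖a‖ + 1)) / 3)]
    · exact ⟨ε / (2 * (‖a‖ + 1)) / 3, by positivity, fun h => absurd h hν, by linarith⟩
  choose δ hδ0 hδ1 hδ2 using hδ
  obtain ⟨t, hts, htc, ht⟩ := TopologicalSpace.countable_cover_nhdsWithin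
    (s := Metric.sphere (0 : Space (d + 1)) 1) (f := fun ν => Metric.closedBall ν (δ ν))
    (fun ν _ => mem_nhdsWithin_of_mem_nhds (Metric.closedBall_mem_nhds ν (hδ0 ν)))
  set D : ℕ → Space (d + 1) := TopologicalSpace.denseSeq (Space (d + 1))
  -- The second factor makes the diameter of a piece smaller than the scale of its cone condition,
  -- so that the condition at one point of the piece applies to all the others.
  let G : t × ℕ × ℕ → Set (Space (d + 1)) := fun p =>
    flatPiece Ω p.1 (δ p.1) (1 / (p.2.1 + 1)) ∩ Metric.ball (D p.2.2) (1 / (p.2.1 + 1) / 2)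
  have hG1 : ∀ p, MeasurableSet (G p) := fun p =>
    (isClosed_flatPiece _ _ _ _).measurableSet.inter Metric.isOpen_ball.measurableSet
  have hG2 : ∀ x ∈ frontier Ω, (∃ ν, IsExteriorNormal Ω x ν) → ∃ p, x ∈ G p := by
    intro x hx hn
    have h1 := exteriorNormal_spec hn
    have h2 := ht (show exteriorNormal Ω x ∈ Metric.sphere (0 : Space (d + 1)) 1 by
      simpa using h1.1)
    simp only [mem_iUnion] at h2
    obtain ⟨ν, hν, h3⟩ := h2
    obtain ⟨m, hm⟩ := mem_flatPiece_of_isExteriorNormal hx h1 (hδ0 ν) h3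
    obtain ⟨i, hi⟩ := (TopologicalSpace.denseRange_denseSeq (Space (d + 1))).exists_dist_lt x
      (show (0 : ℝ) < 1 / (m + 1) / 2 by positivity)
    exact ⟨(⟨ν, hν⟩, m, i), hm, hi⟩
  have hG3 : ∀ p, ∀ E ⊆ G p, E ⊆ frontier Ω → ∀ s : ℝ, volume (shadow a s E) ≤
      ENNReal.ofReal s * ∫⁻ x in E, (‖⟪a, exteriorNormal Ω x⟫‖ₑ + ε)
        ∂surfaceMeasure (d + 1) := by
    rintro ⟨⟨ν, hν⟩, m, i⟩ E hE hEf s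
    have hν1 : ‖ν‖ = 1 := by simpa using hts hν
    have hflat : ∀ x ∈ E, ∀ y ∈ E, |⟪x - y, ν⟫| ≤ 2 * δ ν * ‖x - y‖ := by
      intro x hx y hy
      obtain ⟨⟨-, ν', ⟨h1, h2⟩, h3⟩, h4⟩ := hE hy
      have h5 : dist x y < 1 / ((m : ℝ) + 1) := by
        have h6 : dist x (D i) < 1 / ((m : ℝ) + 1) / 2 := (hE hx).2
        have h7 : dist y (D i) < 1 / ((m : ℝ) + 1) / 2 := h4
        have := dist_triangle_right x y (D i)
        linarith
      have h6 := abs_inner_le_of_coneCondition hΩ.isOpen (hEf hx) h3 h5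
      have h7 : |⟪x - y, ν - ν'⟫| ≤ ‖x - y‖ * δ ν := by
        refine (abs_real_inner_le_norm _ _).trans ?_
        gcongr
        rw [← dist_eq_norm, dist_comm]
        exact h2
      have h8 : ⟪x - y, ν⟫ = ⟪x - y, ν'⟫ + ⟪x - y, ν - ν'⟫ := by
        rw [inner_sub_right]; ring
      rw [h8]
      refine (abs_add_le _ _).trans ?_
      dsimp only at h6
      linarith
    refine (hδ1 ν hν1 E hflat s).trans ?_
    rw [mul_left_comm]
    gcongr
    refine mul_measure_le_setLIntegral ?_
    have hae : ∀ᵐ x ∂(surfaceMeasure (d + 1)).restrict E, ∃ ν, IsExteriorNormal Ω x ν :=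
      ae_restrict_of_ae_restrict_of_subset hEf hΩ.ae_normal
    have hae2 : ∀ᵐ x ∂(surfaceMeasure (d + 1)).restrict E, x ∈ G (⟨ν, hν⟩, m, i) :=
      ae_restrict_of_ae_restrict_of_subset hE (ae_restrict_mem (hG1 _))
    filter_upwards [hae, hae2] with x hx hxG
    have h1 := norm_exteriorNormal_sub_le (hδ0 ν) (by positivity) hxG.1 hx
    have h2 : |⟪a, ν⟫| ≤ |⟪a, exteriorNormal Ω x⟫| + ε / 2 := by
      have h3 : ⟪a, ν⟫ = ⟪a, exteriorNormal Ω x⟫ - ⟪a, exteriorNormal Ω x - ν⟫ := by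
        rw [inner_sub_right]; ring
      rw [h3]
      refine (abs_sub _ _).trans ?_
      gcongr
      refine (abs_real_inner_le_norm _ _).trans ?_
      calc ‖a‖ * ‖exteriorNormal Ω x - ν‖ ≤ (‖a‖ + 1) * (ε / (2 * (‖a‖ + 1))) := by
            gcongr
            · linarith
            · exact h1.trans (hδ2 ν)
        _ = ε / 2 := by field_simp
    have h4 : (Real.toNNReal |⟪a, ν⟫| + ε / 2 : NNReal) ≤ ‖⟪a, exteriorNormal Ω x⟫‖₊ + ε := by
      rw [← NNReal.coe_le_coe]
      push_cast
      rw [Real.coe_toNNReal _ (abs_nonneg _), Real.norm_eq_abs]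
      linarith
    rw [enorm_eq_nnnorm, ← ENNReal.coe_add]
    exact ENNReal.coe_le_coe.2 h4
  have : Countable t := htc.to_subtype
  have hnull : surfaceMeasure (d + 1) (frontier Ω \ ⋃ p, G p) = 0 := by
    have h1 := hΩ.ae_normal
    rw [ae_restrict_iff' isClosed_frontier.measurableSet] at h1
    refine measure_mono_null ?_ h1
    rintro x ⟨hx, hx'⟩ h2
    obtain ⟨p, hp⟩ := hG2 x hx (h2 hx)
    exact hx' (mem_iUnion.2 ⟨p, hp⟩)
  rcases isEmpty_or_nonempty (t × ℕ × ℕ) with hemp | hne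
  · refine ⟨fun _ => ∅, fun _ => .empty, ?_, fun k E hE _ s => ?_⟩
    · simpa using hnull
    · rw [subset_empty_iff.1 hE]
      simp [shadow]
  · obtain ⟨e, he⟩ := exists_surjective_nat (t × ℕ × ℕ)
    refine ⟨fun k => G (e k), fun k => hG1 _, ?_, fun k => hG3 _⟩
    rwa [he.iUnion_comp G]

/-- The volume of the shadow of a part of the boundary is at most the flux of the direction through
it. -/
theorem IsRegularDomain.volume_shadow_le {d : ℕ} {Ω : Set (Space (d + 1))}
    (hΩ : IsRegularDomain Ω) (a : Space (d + 1)) {E : Set (Space (d + 1))}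
    (hE : MeasurableSet E) (hEf : E ⊆ frontier Ω) (s : ℝ) :
    volume (shadow a s E) ≤ ENNReal.ofReal s *
      ∫⁻ x in E, ‖⟪a, exteriorNormal Ω x⟫‖ₑ ∂surfaceMeasure (d + 1) := by
  have hEfin : surfaceMeasure (d + 1) E < ⊤ := (measure_mono hEf).trans_lt hΩ.boundary_finite
  have key : ∀ ε : NNReal, 0 < ε → volume (shadow a s E) ≤ ENNReal.ofReal s *
      ((∫⁻ x in E, ‖⟪a, exteriorNormal Ω x⟫‖ₑ ∂surfaceMeasure (d + 1)) +
        ε * surfaceMeasure (d + 1) E) := by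
    intro ε hε
    obtain ⟨F, hF, hF0, hF1⟩ := hΩ.exists_pieces a hε
    have hcov : E ⊆ (E \ ⋃ k, F k) ∪ ⋃ k, E ∩ disjointed F k := by
      rw [← inter_iUnion, iUnion_disjointed]
      intro x hx
      by_cases h : x ∈ ⋃ k, F k
      · exact Or.inr ⟨hx, h⟩
      · exact Or.inl ⟨hx, h⟩
    have h0 : surfaceMeasure (d + 1) (E \ ⋃ k, F k) = 0 :=
      measure_mono_null (sdiff_subset_sdiff_left hEf) hF0
    have hm : ∀ k, MeasurableSet (E ∩ disjointed F k) := fun k =>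
      hE.inter (MeasurableSet.disjointed hF k)
    have hd : Pairwise (Function.onFun Disjoint fun k => E ∩ disjointed F k) := fun i j hij =>
      (disjoint_disjointed F hij).mono inter_subset_right inter_subset_right
    calc volume (shadow a s E)
        ≤ volume (shadow a s ((E \ ⋃ k, F k) ∪ ⋃ k, E ∩ disjointed F k)) :=
          measure_mono (shadow_mono hcov)
      _ ≤ volume (shadow a s (E \ ⋃ k, F k)) + ∑' k, volume (shadow a s (E ∩ disjointed F k)) := by
          rw [shadow_union, shadow_iUnion]
          exact (measure_union_le _ _).trans (by gcongr; exact measure_iUnion_le _)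
      _ = ∑' k, volume (shadow a s (E ∩ disjointed F k)) := by
          rw [volume_shadow_null h0, zero_add]
      _ ≤ ∑' k, ENNReal.ofReal s * ∫⁻ x in E ∩ disjointed F k,
            (‖⟪a, exteriorNormal Ω x⟫‖ₑ + ε) ∂surfaceMeasure (d + 1) :=
          ENNReal.tsum_le_tsum fun k => hF1 k _
            (inter_subset_right.trans (disjointed_subset F k)) (inter_subset_left.trans hEf) s
      _ = ENNReal.ofReal s * ∫⁻ x in ⋃ k, E ∩ disjointed F k,
            (‖⟪a, exteriorNormal Ω x⟫‖ₑ + ε) ∂surfaceMeasure (d + 1) := by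
          rw [ENNReal.tsum_mul_left, lintegral_iUnion hm hd]
      _ ≤ ENNReal.ofReal s * ∫⁻ x in E, (‖⟪a, exteriorNormal Ω x⟫‖ₑ + ε)
            ∂surfaceMeasure (d + 1) := by
          gcongr
          exact iUnion_subset fun k => inter_subset_left
      _ = _ := by
          rw [lintegral_add_right _ measurable_const, setLIntegral_const]
  -- The finiteness of the surface measure of the boundary makes the excess disappear with `ε`.
  have hlim : Tendsto (fun ε : NNReal => ENNReal.ofReal s *
      ((∫⁻ x in E, ‖⟪a, exteriorNormal Ω x⟫‖ₑ ∂surfaceMeasure (d + 1)) +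
        ε * surfaceMeasure (d + 1) E)) (𝓝[>] 0) (𝓝 (ENNReal.ofReal s *
      ((∫⁻ x in E, ‖⟪a, exteriorNormal Ω x⟫‖ₑ ∂surfaceMeasure (d + 1)) +
        ((0 : NNReal) : ENNReal) * surfaceMeasure (d + 1) E))) := by
    refine ENNReal.Tendsto.const_mul ?_ (Or.inr ENNReal.ofReal_ne_top)
    refine Tendsto.const_add _ (ENNReal.Tendsto.mul_const ?_ (Or.inr hEfin.ne))
    exact (ENNReal.continuous_coe.tendsto 0).mono_left nhdsWithin_le_nhds
  have := ge_of_tendsto hlim (by filter_upwards [self_mem_nhdsWithin] with ε hε using key ε hε)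
  simpa using this

/-- The weighted form of the bound of the volume of the shadow of the boundary. -/
theorem IsRegularDomain.lintegral_shadow_le {d : ℕ} {Ω : Set (Space (d + 1))}
    (hΩ : IsRegularDomain Ω) (a : Space (d + 1)) {s : ℝ}
    {G g : Space (d + 1) → ℝ} (hG : Measurable G) (hG0 : ∀ x, 0 ≤ G x) (hg : Measurable g)
    (hg0 : ∀ x, 0 ≤ g x)
    (h : ∀ x, ∀ t ∈ Icc 0 s, x + t • a ∈ frontier Ω → G x ≤ g (x + t • a)) :
    ∫⁻ x in shadow a s (frontier Ω), ENNReal.ofReal (G x) ≤ ENNReal.ofReal s *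
      ∫⁻ x in frontier Ω, ‖⟪a, exteriorNormal Ω x⟫‖ₑ * ENNReal.ofReal (g x)
        ∂surfaceMeasure (d + 1) := by
  have hfm := (isClosed_frontier (s := Ω)).measurableSet
  have haem : AEMeasurable (fun x => ‖⟪a, exteriorNormal Ω x⟫‖ₑ)
      ((surfaceMeasure (d + 1)).restrict (frontier Ω)) :=
    ((aemeasurable_const.inner hΩ.aemeasurable_exteriorNormal)).enorm
  set μ := ((surfaceMeasure (d + 1)).restrict (frontier Ω)).withDensity
    (fun x => ‖⟪a, exteriorNormal Ω x⟫‖ₑ) with hμ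
  have hR : ∫⁻ x in frontier Ω, ‖⟪a, exteriorNormal Ω x⟫‖ₑ * ENNReal.ofReal (g x)
        ∂surfaceMeasure (d + 1) = ∫⁻ x, ENNReal.ofReal (g x) ∂μ := by
    rw [hμ, lintegral_withDensity_eq_lintegral_mul₀ haem (by fun_prop)]
    rfl
  -- Layer cake on both sides: at every level `l`, the part of the shadow where `G > l` lies in the
  -- shadow of the part of the boundary where `g > l`.
  rw [hR, lintegral_eq_lintegral_meas_lt _ (Eventually.of_forall hG0) hG.aemeasurable,
    lintegral_eq_lintegral_meas_lt _ (Eventually.of_forall hg0) hg.aemeasurable,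
    ← lintegral_const_mul' _ _ ENNReal.ofReal_ne_top]
  refine lintegral_mono fun l => ?_
  have hl : MeasurableSet {x | l < g x} := measurableSet_lt measurable_const hg
  rw [Measure.restrict_apply (measurableSet_lt measurable_const hG), hμ,
    withDensity_apply _ hl, Measure.restrict_restrict hl]
  refine le_trans (measure_mono ?_) (hΩ.volume_shadow_le a (hl.inter hfm) inter_subset_right s)
  rintro x ⟨hx, t, ht, hxt⟩
  exact ⟨t, ht, lt_of_lt_of_le hx (h x t ht hxt), hxt⟩

/-- The points `x` such that the segment `[x, x + s a]` leaves the domain and comes back. -/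
def returnSet {ℓ : ℕ} (Ω : Set (Space ℓ)) (a : Space ℓ) (s : ℝ) : Set (Space ℓ) :=
  {x | x ∈ shadow a s (frontier Ω) ∧ x ∈ Ω ∧ x + s • a ∈ Ω}

/-- A returning segment meets `∂Ω` at a point with points of `Ω` both before and after it on the
line. Where `⟪a, η⟫ ≠ 0`, one of the two is in the outer cone once `s` is small, which is
impossible; where `⟪a, η⟫ = 0`, the density of the shadow bound vanishes. Dominated convergence then
makes the volume o(s). -/
theorem IsRegularDomain.exists_volume_returnSet_le {d : ℕ} {Ω : Set (Space (d + 1))}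
    (hΩ : IsRegularDomain Ω) (a : Space (d + 1)) :
    ∃ ρ : ℝ → ENNReal, Tendsto ρ (𝓝[>] 0) (𝓝 0) ∧
      ∀ s, volume (returnSet Ω a s) ≤ ENNReal.ofReal s * ρ s := by
  set W : ℝ → Set (Space (d + 1)) := fun s =>
    ⋃ t ∈ Icc 0 s, {z | z - t • a ∈ Ω ∧ z + (s - t) • a ∈ Ω} with hW
  have hWo : ∀ s, IsOpen (W s) := fun s => isOpen_biUnion fun t _ =>
    (hΩ.isOpen.preimage (by fun_prop : Continuous fun z => z - t • a)).inter
      (hΩ.isOpen.preimage (by fun_prop : Continuous fun z => z + (s - t) • a))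
  have hfm := (isClosed_frontier (s := Ω)).measurableSet
  refine ⟨fun s => ∫⁻ x in W s ∩ frontier Ω, ‖⟪a, exteriorNormal Ω x⟫‖ₑ
    ∂surfaceMeasure (d + 1), ?_, fun s => ?_⟩
  · have haem : AEMeasurable (fun x => ‖⟪a, exteriorNormal Ω x⟫‖ₑ)
        ((surfaceMeasure (d + 1)).restrict (frontier Ω)) :=
      ((aemeasurable_const.inner hΩ.aemeasurable_exteriorNormal)).enorm
    have h1 : ∀ s, ∫⁻ x in W s ∩ frontier Ω, ‖⟪a, exteriorNormal Ω x⟫‖ₑ ∂surfaceMeasure (d + 1) =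
        ∫⁻ x in frontier Ω, (W s).indicator (fun x => ‖⟪a, exteriorNormal Ω x⟫‖ₑ) x
          ∂surfaceMeasure (d + 1) := by
      intro s
      rw [lintegral_indicator (hWo s).measurableSet,
        Measure.restrict_restrict (hWo s).measurableSet]
    simp_rw [h1]
    have h0 : (0 : ENNReal) = ∫⁻ x in frontier Ω, (0 : ENNReal) ∂surfaceMeasure (d + 1) := by
      simp
    rw [h0]
    refine tendsto_of_seq_tendsto fun s' hs' => ?_
    refine tendsto_lintegral_of_dominated_convergence' (fun _ => ‖a‖ₑ) ?_ ?_ ?_ ?_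
    · exact fun k => haem.indicator (hWo (s' k)).measurableSet
    · refine fun k => Eventually.of_forall fun x => ?_
      refine (indicator_le_self _ _ x).trans ?_
      rw [← enorm_norm a, Real.enorm_eq_ofReal_abs, Real.enorm_eq_ofReal_abs]
      refine ENNReal.ofReal_le_ofReal ((abs_real_inner_le_norm _ _).trans ?_)
      rw [abs_norm]
      exact mul_le_of_le_one_right (norm_nonneg _) (norm_exteriorNormal_le _ _)
    · rw [setLIntegral_const]
      exact (ENNReal.mul_lt_top enorm_lt_top hΩ.boundary_finite).ne
    · filter_upwards [hΩ.ae_normal, ae_restrict_mem hfm] with z hz hzf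
      have hzΩ : z ∉ Ω := fun h' => (hΩ.isOpen.frontier_eq ▸ hzf).2 h'
      have hη := exteriorNormal_spec hz
      set η := exteriorNormal Ω z
      refine Tendsto.comp (g := fun s => (W s).indicator
        (fun x => ‖⟪a, exteriorNormal Ω x⟫‖ₑ) z) ?_ hs'
      by_cases hb : ⟪a, η⟫ = 0
      · refine tendsto_const_nhds.congr fun s => ?_
        by_cases hs : z ∈ W s
        · rw [indicator_of_mem hs, hb]; simp
        · rw [indicator_of_notMem hs]
      have ha : 0 < ‖a‖ := norm_pos_iff.2 (by rintro rfl; simp at hb)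
      have hε : 0 < |⟪a, η⟫| / (2 * ‖a‖) := by positivity
      obtain ⟨r, hr, hr'⟩ := Metric.eventually_nhds_iff.1 (hη.2 _ hε)
      have hev : ∀ᶠ s : ℝ in 𝓝[>] 0, s * ‖a‖ < r := by
        have : Tendsto (fun s : ℝ => s * ‖a‖) (𝓝[>] 0) (𝓝 (0 * ‖a‖)) :=
          (Continuous.tendsto (by fun_prop) 0).mono_left nhdsWithin_le_nhds
        rw [zero_mul] at this
        exact this.eventually_lt_const hr
      refine tendsto_const_nhds.congr' ?_
      filter_upwards [hev] with s hs
      rw [indicator_of_notMem]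
      intro hmem
      simp only [hW, mem_iUnion, mem_ofPred_eq] at hmem
      obtain ⟨t, ht, h2, h3⟩ := hmem
      -- The aperture `|⟪a, η⟫| / (2 * ‖a‖)` is half the cosine of the angle between the line and
      -- the normal, so the outward half of the line is inside the outer cone.
      have hcone : ∀ τ : ℝ, |τ| ≤ s → 0 < τ * ⟪a, η⟫ → z + τ • a ∉ Ω := by
        intro τ hτ hpos
        refine (hr' (y := z + τ • a) ?_).2 ?_
        · rw [dist_eq_norm, add_sub_cancel_left, norm_smul, Real.norm_eq_abs]
          exact lt_of_le_of_lt (by gcongr) hs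
        · rw [add_sub_cancel_left, norm_smul, inner_smul_left, Real.norm_eq_abs]
          simp only [conj_trivial]
          rw [show |⟪a, η⟫| / (2 * ‖a‖) * (|τ| * ‖a‖) = |τ * ⟪a, η⟫| / 2 by
            rw [abs_mul]; field_simp, abs_of_pos hpos]
          linarith
      rcases lt_or_gt_of_ne hb with hneg | hpos
      · rcases ht.1.eq_or_lt with rfl | h0
        · exact hzΩ (by simpa using h2)
        · refine hcone (-t) (by rw [abs_neg, abs_of_pos h0]; exact ht.2) (by nlinarith) ?_
          rwa [neg_smul, ← sub_eq_add_neg]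
      · rcases ht.2.eq_or_lt with rfl | h0
        · exact hzΩ (by simpa using h3)
        · exact hcone (s - t) (by rw [abs_of_pos (by linarith)]; linarith [ht.1])
            (by nlinarith) h3
  · refine le_trans (measure_mono ?_) (hΩ.volume_shadow_le a
      ((hWo s).measurableSet.inter hfm) inter_subset_right s)
    rintro x ⟨⟨t, ht, hxt⟩, hx, hxs⟩
    refine ⟨t, ht, ?_, hxt⟩
    simp only [hW, mem_iUnion, mem_ofPred_eq]
    refine ⟨t, ht, by simpa using hx, ?_⟩
    rw [add_assoc, ← add_smul]
    simpa using hxs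

end ZeroFluxFV

namespace ZeroFluxFV

/-! ### The geometry of admissible meshes -/

theorem measure_of_eq_empty {α : Type*} [MeasurableSpace α] {μ : Measure α} {s : Set α}
    (h : s = ∅) : μ s = 0 := by rw [h, measure_empty]

/-- The component `a` of `n` orthogonal to `n'` is tangent to the second hyperplane and transversal
to the first. The shadow of the intersection along `a` stays in the second hyperplane, hence is
null, while its volume is a positive multiple of the area. If `a = 0`, the distinct hyperplanes are
parallel and disjoint. -/
theorem surfaceMeasure_hyperplane_inter {d : ℕ} {n n' : Space (d + 1)} (hn : ‖n‖ = 1)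
    (hn' : ‖n'‖ = 1) {c c' : ℝ} (h : {y | ⟪y, n⟫ = c} ≠ {y | ⟪y, n'⟫ = c'}) :
    surfaceMeasure (d + 1) ({y | ⟪y, n⟫ = c} ∩ {y | ⟪y, n'⟫ = c'}) = 0 := by
  set a := n - ⟪n, n'⟫ • n' with ha
  have h1 : ⟪a, n'⟫ = 0 := by
    rw [ha, inner_sub_left, inner_smul_left, real_inner_self_eq_norm_sq, hn']; simp
  have h2 : ⟪a, n⟫ = ‖a‖ ^ 2 := by
    rw [← real_inner_self_eq_norm_sq a]
    conv_rhs => rw [ha, inner_sub_right, inner_smul_right, ← ha, h1]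
    simp
  by_cases h0 : a = 0
  · have h3 : n = ⟪n, n'⟫ • n' := sub_eq_zero.1 h0
    have h4 : ⟪n, n'⟫ ≠ 0 := by
      intro h5
      rw [h5, zero_smul] at h3
      rw [h3] at hn
      simp at hn
    refine measure_of_eq_empty ?_
    · rw [← not_nonempty_iff_eq_empty]
      rintro ⟨z, hz, hz'⟩
      refine h ?_
      have hz : ⟪z, n⟫ = c := hz
      have hz' : ⟪z, n'⟫ = c' := hz'
      ext y
      simp only [mem_ofPred_eq, ← hz, ← hz']
      rw [h3, inner_smul_right, inner_smul_right, mul_right_inj' h4]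
  · have h3 : ⟪a, n⟫ ≠ 0 := by rw [h2]; positivity
    have h4 := volume_shadow_hyperplane (s := 1) hn
      (inter_subset_left (s := {y | ⟪y, n⟫ = c}) (t := {y | ⟪y, n'⟫ = c'})) h3
    have h5 : volume (shadow a 1 ({y | ⟪y, n⟫ = c} ∩ {y | ⟪y, n'⟫ = c'})) = 0 := by
      refine measure_mono_null ?_ (volume_hyperplane hn' c')
      rintro x ⟨t, -, -, hx⟩
      have hx : ⟪x + t • a, n'⟫ = c' := hx
      rw [inner_add_left, inner_smul_left, h1, mul_zero, add_zero] at hx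
      exact hx
    rw [h5, eq_comm, mul_eq_zero] at h4
    refine h4.resolve_left ?_
    simpa using h3

namespace AdmissibleMesh

section Basic

variable {ℓ : ℕ} {Ω : Set (Space ℓ)} (m : AdmissibleMesh Ω)

theorem interface_comm (i j : Fin m.card) : m.interface i j = m.interface j i := by
  simp only [interface, innerInterface, inter_comm (closure (m.cell i))]

theorem adj_comm {i j : Fin m.card} : m.Adj i j ↔ m.Adj j i := by
  simp only [Adj, m.interface_comm i j, ne_comm]

theorem area_comm (i j : Fin m.card) : m.area i j = m.area j i := by
  simp only [area, m.interface_comm i j]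

theorem centerDist_comm (i j : Fin m.card) : m.centerDist i j = m.centerDist j i :=
  norm_sub_rev _ _

theorem normal_comm (i j : Fin m.card) : m.normal i j = -m.normal j i := by
  simp only [normal, m.centerDist_comm i j, ← smul_neg, neg_sub]

theorem transmissivity_comm (i j : Fin m.card) : m.transmissivity i j = m.transmissivity j i := by
  simp only [transmissivity, m.area_comm i j, m.centerDist_comm i j]

theorem mem_neighbors {i j : Fin m.card} : j ∈ m.neighbors i ↔ m.Adj i j := by
  simp [neighbors]

theorem area_nonneg (i j : Fin m.card) : 0 ≤ m.area i j := measureReal_nonneg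

theorem centerDist_pos {i j : Fin m.card} (h : m.Adj i j) : 0 < m.centerDist i j :=
  norm_pos_iff.2 (sub_ne_zero.2 (m.center_ne i j h.1 h.2).symm)

theorem transmissivity_nonneg (i j : Fin m.card) : 0 ≤ m.transmissivity i j :=
  div_nonneg (m.area_nonneg i j) (norm_nonneg _)

theorem norm_normal {i j : Fin m.card} (h : m.Adj i j) : ‖m.normal i j‖ = 1 := by
  have := m.centerDist_pos h
  rw [normal, norm_smul, norm_inv, Real.norm_of_nonneg this.le]
  exact inv_mul_cancel₀ this.ne'

theorem center_sub {i j : Fin m.card} (h : m.Adj i j) :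
    m.center j - m.center i = m.centerDist i j • m.normal i j := by
  rw [normal, smul_smul, mul_inv_cancel₀ (m.centerDist_pos h).ne', one_smul]

/-- The value of `⟪·, n⟫` on the interface with normal `n`. -/
noncomputable def level (i j : Fin m.card) : ℝ :=
  open Classical in
  if h : (m.interface i j).Nonempty then ⟪h.some, m.normal i j⟫ else 0

theorem interface_subset {i j : Fin m.card} (h : m.Adj i j) :
    m.interface i j ⊆ {y | ⟪y, m.normal i j⟫ = m.level i j} := by
  intro y hy
  have hne : (m.interface i j).Nonempty := ⟨y, hy⟩
  have h1 := m.orthogonal i j h.1 h.2 y hy _ hne.some_mem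
  rw [m.center_sub h, inner_smul_left, real_inner_comm, inner_sub_left] at h1
  have h2 := (mul_eq_zero.1 h1).resolve_left (m.centerDist_pos h).ne'
  rw [mem_ofPred_eq, level, dif_pos hne]
  linarith

theorem nonempty_interface {i j : Fin m.card} (h : m.Adj i j) : (m.interface i j).Nonempty := by
  rw [nonempty_iff_ne_empty]
  intro h0
  exact h.2 (by rw [h0, measure_empty])

theorem level_comm {i j : Fin m.card} (h : m.Adj i j) : m.level i j = -m.level j i := by
  obtain ⟨z, hz⟩ := m.nonempty_interface h
  have h1 : ⟪z, m.normal i j⟫ = m.level i j := m.interface_subset h hz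
  have h2 : ⟪z, m.normal j i⟫ = m.level j i :=
    m.interface_subset (m.adj_comm.1 h) (m.interface_comm i j ▸ hz)
  rw [← h1, ← h2, m.normal_comm, inner_neg_right]

theorem disjoint_cell_closure {i j : Fin m.card} (h : i ≠ j) :
    Disjoint (m.cell i) (closure (m.cell j)) :=
  (m.cell_disjoint i j h).closure_right (m.cell_open i)

theorem eq_of_mem_cell_of_mem_closure {i j : Fin m.card} {x : Space ℓ} (hi : x ∈ m.cell i)
    (hj : x ∈ closure (m.cell j)) : i = j := by
  by_contra h
  exact (m.disjoint_cell_closure h).le_bot ⟨hi, hj⟩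

theorem ae_mem_cell : ∀ᵐ x, x ∈ Ω → ∃ i, x ∈ m.cell i := by
  refine measure_mono_null ?_ m.cell_cover
  intro x hx
  simp only [mem_compl_iff, mem_ofPred_eq, Classical.not_imp] at hx
  exact ⟨hx.1, by simpa using hx.2⟩

/-- The uncovered part is open, the union being finite, and null; a nonempty open set has positive
volume. -/
theorem subset_iUnion_closure (hΩ : IsOpen Ω) : Ω ⊆ ⋃ i, closure (m.cell i) := by
  intro x hx
  by_contra h
  have hcl : IsClosed (⋃ i, closure (m.cell i)) := isClosed_iUnion_of_finite fun i => isClosed_closure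
  have ho : IsOpen (Ω ∩ (⋃ i, closure (m.cell i))ᶜ) := hΩ.inter hcl.isOpen_compl
  have hpos := ho.measure_pos volume ⟨x, hx, h⟩
  refine hpos.ne' (measure_mono_null ?_ m.cell_cover)
  rintro y ⟨hy, hy'⟩
  exact ⟨hy, fun h' => hy' (iUnion_mono (fun i => subset_closure) h')⟩

theorem measurableSet_interface (hΩ : IsOpen Ω) (i j : Fin m.card) :
    MeasurableSet (m.interface i j) :=
  (isClosed_closure.inter isClosed_closure).measurableSet.inter hΩ.measurableSet

theorem interface_subset_domain (i j : Fin m.card) : m.interface i j ⊆ Ω := inter_subset_right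

/-- A segment in the domain that meets no interface stays in one control volume. -/
theorem eq_of_segment_subset (hΩ : IsOpen Ω) {i j : Fin m.card} {x y : Space ℓ}
    (hx : x ∈ m.cell i) (hy : y ∈ m.cell j) (hs : segment ℝ x y ⊆ Ω)
    (h : ∀ p q, p ≠ q → ∀ z ∈ segment ℝ x y, z ∉ m.interface p q) : i = j := by
  by_contra hij
  have hpre : IsPreconnected (segment ℝ x y) := (convex_segment x y).isPreconnected
  -- The segment is covered by two closed sets, the closure of `cell i` and the union of the other
  -- closures; by connectedness some point is in both, hence on an interface.
  rw [isPreconnected_closed_iff] at hpre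
  obtain ⟨z, hz, hz1, hz2⟩ := hpre (closure (m.cell i)) (⋃ q : {q // q ≠ i}, closure (m.cell q))
    isClosed_closure (isClosed_iUnion_of_finite fun q => isClosed_closure)
    (by
      intro z hz
      obtain ⟨q, hq⟩ := mem_iUnion.1 (m.subset_iUnion_closure hΩ (hs hz))
      by_cases hqi : q = i
      · exact Or.inl (hqi ▸ hq)
      · exact Or.inr (mem_iUnion.2 ⟨⟨q, hqi⟩, hq⟩))
    ⟨x, left_mem_segment ℝ x y, subset_closure hx⟩
    ⟨y, right_mem_segment ℝ x y, mem_iUnion.2 ⟨⟨j, fun h => hij h.symm⟩, subset_closure hy⟩⟩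
  obtain ⟨q, hq⟩ := mem_iUnion.1 hz2
  exact h i q q.2.symm z hz ⟨⟨hz1, hq⟩, hs hz⟩

theorem segment_subset_closure {i : Fin m.card} {z : Space ℓ} (hz : z ∈ closure (m.cell i)) :
    segment ℝ (m.center i) z ⊆ closure (m.cell i) := by
  rw [← insert_endpoints_openSegment]
  refine insert_subset (m.center_mem i) (insert_subset hz ?_)
  rintro w ⟨u, v, hu, hv, huv, rfl⟩
  exact map_mem_closure (f := fun y => u • m.center i + v • y) (by fun_prop) hz
    fun y hy => m.cell_star i y hy ⟨u, v, hu, hv, huv, rfl⟩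

/-- The centre of a control volume lies on the side of the interface that its neighbour does not
occupy. -/
theorem inner_center_sub_nonneg {i j : Fin m.card} (hij : i ≠ j) {z n : Space ℓ} {r : ℝ}
    (hr : 0 < r) (hz : z ∈ closure (m.cell i))
    (h : Metric.ball z r ∩ {y | ⟪y - z, n⟫ < 0} ⊆ closure (m.cell j)) :
    0 ≤ ⟪m.center i - z, n⟫ := by
  by_contra! hlt
  have ho : IsOpen (Metric.ball z r ∩ {y | ⟪y - z, n⟫ < 0}) :=
    Metric.isOpen_ball.inter (isOpen_lt (by fun_prop) (by fun_prop))
  obtain ⟨t, ht0, ht1, ht⟩ : ∃ t : ℝ, 0 < t ∧ t < 1 ∧ t * ‖m.center i - z‖ < r := by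
    have h1 : Tendsto (fun t : ℝ => t * ‖m.center i - z‖) (𝓝[>] 0) (𝓝 (0 * ‖m.center i - z‖)) :=
      (Continuous.tendsto (by fun_prop) 0).mono_left nhdsWithin_le_nhds
    rw [zero_mul] at h1
    have h2 : ∀ᶠ t : ℝ in 𝓝[>] 0, t < 1 :=
      (tendsto_id.mono_left nhdsWithin_le_nhds).eventually_lt_const one_pos
    obtain ⟨t, ⟨h3, h4⟩, h5⟩ :=
      (((h1.eventually_lt_const hr).and h2).and self_mem_nhdsWithin).exists
    exact ⟨t, h5, h4, h3⟩
  -- A point of `cell i` close to `z`, pulled slightly towards the centre, stays in `cell i` by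
  -- star-shapedness; but if the centre were on the wrong side it would enter the half ball held by
  -- `cell j`.
  have hcont : Continuous fun y => t • m.center i + (1 - t) • y := by fun_prop
  have hmem : z ∈ (fun y => t • m.center i + (1 - t) • y) ⁻¹'
      (Metric.ball z r ∩ {y | ⟪y - z, n⟫ < 0}) := by
    have h1 : t • m.center i + (1 - t) • z - z = t • (m.center i - z) := by module
    constructor
    · rw [Metric.mem_ball, dist_eq_norm, h1, norm_smul, Real.norm_of_nonneg ht0.le]
      exact ht
    · rw [mem_ofPred_eq, h1, inner_smul_left]
      exact mul_neg_of_pos_of_neg ht0 hlt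
  obtain ⟨y, hy1, hy2⟩ := mem_closure_iff.1 hz _ (ho.preimage hcont) hmem
  have h3 := m.cell_star i y hy2 ⟨t, 1 - t, ht0, by linarith, by ring, rfl⟩
  exact hij (m.eq_of_mem_cell_of_mem_closure h3 (h hy1))

/-- `z` is a regular point of the interface between `i` and `j`, at the scale `r`: the two control
volumes fill the two halves of the ball around `z`. -/
def RegularAt (i j : Fin m.card) (z : Space ℓ) (r : ℝ) : Prop :=
  Metric.ball z r ⊆ Ω ∧ Metric.ball z r ∩ {y | ⟪y - z, m.normal i j⟫ < 0} ⊆ closure (m.cell i) ∧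
    Metric.ball z r ∩ {y | 0 < ⟪y - z, m.normal i j⟫} ⊆ closure (m.cell j)

theorem RegularAt.mono {m : AdmissibleMesh Ω} {i j : Fin m.card} {z : Space ℓ} {r r' : ℝ}
    (h : m.RegularAt i j z r) (hr : r' ≤ r) : m.RegularAt i j z r' := by
  have := Metric.ball_subset_ball (x := z) hr
  exact ⟨this.trans h.1, (inter_subset_inter_left _ this).trans h.2.1,
    (inter_subset_inter_left _ this).trans h.2.2⟩

end Basic

section Geometry

variable {d : ℕ} {Ω : Set (Space (d + 1))} (m : AdmissibleMesh Ω)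

/-- A segment from `x` to `y` may be moved to a nearby parallel one. The interfaces inside `C` are
negligible, so their shadow along `y - x` is null, and almost every parallel segment misses them and
joins the two control volumes within one. -/
theorem eq_of_convex (hΩ : IsOpen Ω) {C : Set (Space (d + 1))} (hC : IsOpen C)
    (hconv : Convex ℝ C) (hCΩ : C ⊆ Ω)
    (hnull : ∀ p q, p ≠ q → surfaceMeasure (d + 1) (m.interface p q ∩ C) = 0)
    {i j : Fin m.card} (hi : (m.cell i ∩ C).Nonempty) (hj : (m.cell j ∩ C).Nonempty) : i = j := by
  obtain ⟨x, hx⟩ := hi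
  obtain ⟨y, hy⟩ := hj
  set Z := ⋃ p : {p : Fin m.card × Fin m.card // p.1 ≠ p.2}, m.interface p.1.1 p.1.2 ∩ C
  have hZ : surfaceMeasure (d + 1) Z = 0 := measure_iUnion_null fun p => hnull _ _ p.2
  have hZ2 := volume_shadow_null hZ (y - x) 1
  have hcont : Continuous fun w => w + (y - x) := by fun_prop
  have ho : IsOpen ((m.cell i ∩ C) ∩ (fun w => w + (y - x)) ⁻¹' (m.cell j ∩ C)) :=
    ((m.cell_open i).inter hC).inter (((m.cell_open j).inter hC).preimage hcont)
  have hpos := ho.measure_pos volume ⟨x, hx, by simpa using hy⟩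
  obtain ⟨w, hw, hw'⟩ : ∃ w ∈ (m.cell i ∩ C) ∩ (fun w => w + (y - x)) ⁻¹' (m.cell j ∩ C),
      w ∉ shadow (y - x) 1 Z := by
    by_contra! hcon
    exact hpos.ne' (measure_mono_null hcon hZ2)
  have hseg : segment ℝ w (w + (y - x)) ⊆ C := hconv.segment_subset hw.1.2 hw.2.2
  refine m.eq_of_segment_subset hΩ hw.1.1 hw.2.1 (hseg.trans hCΩ) fun p q hpq z hz hzI => ?_
  refine hw' ?_
  have hzC := hseg hz
  rw [segment_eq_image'] at hz
  obtain ⟨t, ht, rfl⟩ := hz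
  simp only [add_sub_cancel_left] at hzI hzC
  exact ⟨t, ht, mem_iUnion.2 ⟨⟨(p, q), hpq⟩, hzI, hzC⟩⟩

/-- A convex part of the domain whose intersection with the interfaces is negligible lies in the
closure of one control volume. -/
theorem exists_subset_closure (hΩ : IsOpen Ω) {C : Set (Space (d + 1))} (hC : IsOpen C)
    (hconv : Convex ℝ C) (hCΩ : C ⊆ Ω) (hne : C.Nonempty)
    (hnull : ∀ p q, p ≠ q → surfaceMeasure (d + 1) (m.interface p q ∩ C) = 0) :
    ∃ i, C ⊆ closure (m.cell i) := by
  have hmeet : ∀ z ∈ C, ∃ i, z ∈ closure (m.cell i) ∧ (m.cell i ∩ C).Nonempty := by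
    intro z hz
    obtain ⟨i, hi⟩ := mem_iUnion.1 (m.subset_iUnion_closure hΩ (hCΩ hz))
    obtain ⟨y, hy1, hy2⟩ := mem_closure_iff.1 hi C hC hz
    exact ⟨i, hi, y, hy2, hy1⟩
  obtain ⟨z, hz⟩ := hne
  obtain ⟨i, -, hi⟩ := hmeet z hz
  refine ⟨i, fun w hw => ?_⟩
  obtain ⟨j, hj1, hj2⟩ := hmeet w hw
  rwa [m.eq_of_convex hΩ hC hconv hCΩ hnull hi hj2]

/-- In a small ball around `z` the non-negligible interfaces lie in one hyperplane, so each open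
half ball is in the closure of a single control volume. A control volume touching `z` has positive
volume in the ball, hence is one of these two. The positions of the centres decide which is which.
-/
theorem exists_regularAt_of_notMem (hΩ : IsOpen Ω) {i j : Fin m.card} (hij : m.Adj i j)
    {z : Space (d + 1)} (hz : z ∈ m.interface i j)
    (hzn : ∀ p q, m.Adj p q → {y | ⟪y, m.normal p q⟫ = m.level p q} ≠
      {y | ⟪y, m.normal i j⟫ = m.level i j} → z ∉ m.interface p q) :
    ∃ r, 0 < r ∧ m.RegularAt i j z r := by
  set n := m.normal i j with hn
  have hn1 : ‖n‖ = 1 := m.norm_normal hij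
  have hzc : ⟪z, n⟫ = m.level i j := m.interface_subset hij hz
  have hev : ∀ᶠ y in 𝓝 z, y ∈ Ω ∧ ∀ p q, m.Adj p q → {y | ⟪y, m.normal p q⟫ = m.level p q} ≠
      {y | ⟪y, n⟫ = m.level i j} → y ∉ m.interface p q := by
    refine Filter.Eventually.and (hΩ.mem_nhds hz.2) ?_
    simp only [eventually_all]
    intro p q hpq hne
    have h1 := hzn p q hpq hne
    have h2 : z ∉ closure (m.cell p) ∩ closure (m.cell q) := fun h => h1 ⟨h, hz.2⟩
    filter_upwards [(isClosed_closure.inter isClosed_closure).isOpen_compl.mem_nhds h2] with y hy h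
    exact hy h.1
  obtain ⟨r, hr, hr'⟩ := Metric.eventually_nhds_iff_ball.1 hev
  have hball : Metric.ball z r ⊆ Ω := fun y hy => (hr' y hy).1
  -- both open half balls lie in the closure of one control volume
  have half : ∀ σ : ℝ, σ ≠ 0 → ∃ p, Metric.ball z r ∩ {y | 0 < σ * ⟪y - z, n⟫} ⊆
      closure (m.cell p) := by
    intro σ hσ
    have hlin : {y | 0 < σ * ⟪y - z, n⟫} = {y | σ * ⟪z, n⟫ < σ * ⟪y, n⟫} := by
      ext y
      simp only [mem_ofPred_eq, inner_sub_left, mul_sub, sub_pos]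
    refine m.exists_subset_closure hΩ (Metric.isOpen_ball.inter (isOpen_lt (by fun_prop)
      (by fun_prop))) ((convex_ball z r).inter ?_) (inter_subset_left.trans hball) ?_ ?_
    · rw [hlin]
      refine convex_halfSpace_gt ⟨fun x y => ?_, fun c x => ?_⟩ _
      · rw [inner_add_left]; ring
      · rw [inner_smul_left]; simp only [conj_trivial, smul_eq_mul]; ring
    · refine ⟨z + (r / 2 * (|σ|⁻¹ * σ)) • n, ?_, ?_⟩
      · rw [Metric.mem_ball, dist_eq_norm, add_sub_cancel_left, norm_smul, hn1, Real.norm_eq_abs,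
          abs_mul, abs_mul, abs_inv, abs_abs, inv_mul_cancel₀ (abs_ne_zero.2 hσ),
          abs_of_pos (by positivity)]
        linarith
      · simp only [mem_ofPred_eq, add_sub_cancel_left, inner_smul_left, conj_trivial,
          real_inner_self_eq_norm_sq, hn1]
        have : σ * (r / 2 * (|σ|⁻¹ * σ) * 1 ^ 2) = r / 2 * |σ|⁻¹ * (σ * σ) := by ring
        rw [this]
        have := mul_self_pos.2 hσ
        positivity
    · intro p q hpq
      by_cases hadj : m.Adj p q
      · by_cases hne : {y | ⟪y, m.normal p q⟫ = m.level p q} = {y | ⟪y, n⟫ = m.level i j}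
        · refine measure_of_eq_empty ?_
          rw [← Set.disjoint_iff_inter_eq_empty, Set.disjoint_left]
          rintro y hy ⟨-, hy2⟩
          have h1 : y ∈ {y | ⟪y, n⟫ = m.level i j} := hne ▸ m.interface_subset hadj hy
          have h1 : ⟪y, n⟫ = m.level i j := h1
          rw [mem_ofPred_eq, inner_sub_left, h1, hzc] at hy2
          simp at hy2
        · refine measure_of_eq_empty ?_
          rw [← Set.disjoint_iff_inter_eq_empty, Set.disjoint_left]
          rintro y hy ⟨hy1, -⟩
          exact (hr' y hy1).2 p q hadj hne hy
      · refine measure_mono_null inter_subset_left ?_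
        by_contra h
        exact hadj ⟨hpq, h⟩
  obtain ⟨p, hp⟩ := half (-1) (by norm_num)
  obtain ⟨q, hq⟩ := half 1 (by norm_num)
  simp only [neg_mul, one_mul, Left.neg_pos_iff] at hp hq
  -- a control volume that touches `z` is one of these two
  have touch : ∀ k, z ∈ closure (m.cell k) → k = p ∨ k = q := by
    intro k hk
    obtain ⟨y, hy1, hy2⟩ := mem_closure_iff.1 hk _ Metric.isOpen_ball (Metric.mem_ball_self hr)
    have hpos := (Metric.isOpen_ball.inter (m.cell_open k)).measure_pos volume ⟨y, hy1, hy2⟩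
    obtain ⟨w, ⟨hw1, hw2⟩, hw3⟩ : ∃ w ∈ Metric.ball z r ∩ m.cell k, ⟪w, n⟫ ≠ ⟪z, n⟫ := by
      by_contra! hcon
      exact hpos.ne' (measure_mono_null hcon (volume_hyperplane hn1 _))
    rcases lt_or_gt_of_ne hw3 with hlt | hgt
    · left
      refine m.eq_of_mem_cell_of_mem_closure hw2 (hp ⟨hw1, ?_⟩)
      rw [mem_ofPred_eq, inner_sub_left]
      linarith
    · right
      refine m.eq_of_mem_cell_of_mem_closure hw2 (hq ⟨hw1, ?_⟩)
      rw [mem_ofPred_eq, inner_sub_left]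
      linarith
  refine ⟨r, hr, hball, ?_⟩
  have hpn : ∀ k, k ≠ p → z ∈ closure (m.cell k) → 0 ≤ ⟪m.center k - z, n⟫ := fun k hk hzk =>
    m.inner_center_sub_nonneg hk hr hzk hp
  have hqn : ∀ k, k ≠ q → z ∈ closure (m.cell k) → ⟪m.center k - z, n⟫ ≤ 0 := by
    intro k hk hzk
    have := m.inner_center_sub_nonneg (n := -n) hk hr hzk (by simpa using hq)
    simpa using this
  -- The normal points from `i` to `j`: with the half balls exchanged, this positive number would be
  -- nonpositive by `hpn` and `hqn`.
  have hcc : ⟪m.center j - z, n⟫ - ⟪m.center i - z, n⟫ = m.centerDist i j := by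
    rw [← inner_sub_left, sub_sub_sub_cancel_right, m.center_sub hij, inner_smul_left,
      real_inner_self_eq_norm_sq, ← hn, hn1]
    simp
  have hdpos := m.centerDist_pos hij
  have hij' := hij.1
  rcases touch i hz.1.1 with rfl | rfl
  · rcases touch j hz.1.2 with rfl | rfl
    · exact absurd rfl hij'
    · exact ⟨hp, hq⟩
  · rcases touch j hz.1.2 with rfl | rfl
    · have h1 := hpn i hij' hz.1.1
      have h2 := hqn j hij'.symm hz.1.2
      linarith
    · exact absurd rfl hij'

/-- Almost every point of an interface is regular. -/
theorem ae_exists_regularAt (hΩ : IsOpen Ω) {i j : Fin m.card} (hij : m.Adj i j) :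
    surfaceMeasure (d + 1) {z ∈ m.interface i j | ¬ ∃ r, 0 < r ∧ m.RegularAt i j z r} = 0 := by
  set B : Fin m.card × Fin m.card → Set (Space (d + 1)) := fun p =>
    {z | m.Adj p.1 p.2 ∧ {y | ⟪y, m.normal p.1 p.2⟫ = m.level p.1 p.2} ≠
      {y | ⟪y, m.normal i j⟫ = m.level i j} ∧ z ∈ m.interface p.1 p.2 ∧ z ∈ m.interface i j}
  have hB : ∀ p, surfaceMeasure (d + 1) (B p) = 0 := by
    intro p
    by_cases h : m.Adj p.1 p.2 ∧ {y | ⟪y, m.normal p.1 p.2⟫ = m.level p.1 p.2} ≠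
      {y | ⟪y, m.normal i j⟫ = m.level i j}
    · refine measure_mono_null ?_ (surfaceMeasure_hyperplane_inter (m.norm_normal h.1)
        (m.norm_normal hij) h.2)
      rintro z ⟨-, -, h1, h2⟩
      exact ⟨m.interface_subset h.1 h1, m.interface_subset hij h2⟩
    · refine measure_of_eq_empty ?_
      ext z
      simp only [B, mem_ofPred_eq, mem_empty_iff_false, iff_false]
      exact fun h' => h ⟨h'.1, h'.2.1⟩
  refine measure_mono_null ?_ (measure_iUnion_null hB)
  rintro z ⟨hz, hz'⟩
  by_contra hcon
  refine hz' (m.exists_regularAt_of_notMem hΩ hij hz fun p q hpq hne hzpq => hcon ?_)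
  exact mem_iUnion.2 ⟨(p, q), hpq, hne, hzpq, hz⟩

/-- The signed distance of the centre of `i` to the interface between `i` and `j`. -/
noncomputable def height (i j : Fin m.card) : ℝ := m.level i j - ⟪m.center i, m.normal i j⟫

/-- The interface has positive measure, so it has a regular point; there `cell j` occupies the
positive side, and the centre of `i` cannot lie on that side. -/
theorem height_nonneg (hΩ : IsOpen Ω) {i j : Fin m.card} (hij : m.Adj i j) :
    0 ≤ m.height i j := by
  have h : ∃ z ∈ m.interface i j, ∃ r, 0 < r ∧ m.RegularAt i j z r := by
    by_contra! hcon
    refine hij.2 (measure_mono_null ?_ (m.ae_exists_regularAt hΩ hij))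
    intro z hz
    refine ⟨hz, ?_⟩
    rintro ⟨r, hr, h⟩
    exact hcon z hz r hr h
  obtain ⟨z, hz, r, hr, h⟩ := h
  have h1 := m.inner_center_sub_nonneg (n := -m.normal i j) hij.1 hr hz.1.1 (by simpa using h.2.2)
  have h2 : ⟪z, m.normal i j⟫ = m.level i j := m.interface_subset hij hz
  rw [inner_neg_right, inner_sub_left, h2] at h1
  rw [height]
  linarith

theorem height_add_height {i j : Fin m.card} (hij : m.Adj i j) :
    m.height i j + m.height j i = m.centerDist i j := by
  have h1 : ⟪m.center j - m.center i, m.normal i j⟫ = m.centerDist i j := by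
    rw [m.center_sub hij, inner_smul_left, real_inner_self_eq_norm_sq, m.norm_normal hij]
    simp
  rw [inner_sub_left] at h1
  rw [height, height, m.level_comm hij, m.normal_comm j i, inner_neg_right]
  linarith

/-- A boundary point of a control volume is either in `Ω` and in no control volume, or on `∂Ω`; both
sets are null. -/
theorem volume_frontier_cell (hΩ : IsRegularDomain Ω) (i : Fin m.card) :
    volume (closure (m.cell i) \ m.cell i) = 0 := by
  refine measure_mono_null (t := (Ω \ ⋃ i, m.cell i) ∪ frontier Ω) ?_
    (measure_union_null m.cell_cover (volume_eq_zero_of_surfaceMeasure hΩ.boundary_finite))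
  rintro x ⟨hx, hx'⟩
  by_cases hxΩ : x ∈ Ω
  · left
    refine ⟨hxΩ, fun h => ?_⟩
    obtain ⟨j, hj⟩ := mem_iUnion.1 h
    exact hx' (m.eq_of_mem_cell_of_mem_closure hj hx ▸ hj)
  · right
    rw [hΩ.isOpen.frontier_eq]
    exact ⟨closure_mono (m.cell_subset i) hx, hxΩ⟩

theorem area_lt_top (hΩ : IsRegularDomain Ω) {i j : Fin m.card} (hij : m.Adj i j) :
    surfaceMeasure (d + 1) (m.interface i j) < ⊤ :=
  isBounded_surfaceMeasure_lt_top (m.norm_normal hij) (m.interface_subset hij)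
    (hΩ.isBounded.subset (m.interface_subset_domain i j))

/-- The half of the diamond of an interface that is next to `i`. -/
def halfDiamond (i j : Fin m.card) : Set (Space (d + 1)) :=
  convexJoin ℝ {m.center i} (m.interface i j)

theorem halfDiamond_subset (i j : Fin m.card) : m.halfDiamond i j ⊆ closure (m.cell i) := by
  intro x hx
  obtain ⟨y, rfl, z, hz, hx⟩ := mem_convexJoin.1 hx
  exact m.segment_subset_closure hz.1.1 hx

theorem nullMeasurableSet_halfDiamond (hΩ : IsRegularDomain Ω) {i j : Fin m.card}
    (hij : m.Adj i j) : NullMeasurableSet (m.halfDiamond i j) :=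
  (nullMeasurableSet_convexJoin_singleton (m.norm_normal hij) (m.interface_subset hij)
    (m.height_nonneg hΩ.isOpen hij) (by rw [height]; ring)
    (m.measurableSet_interface hΩ.isOpen i j)).1

theorem volume_halfDiamond (hΩ : IsRegularDomain Ω) {i j : Fin m.card} (hij : m.Adj i j) :
    volume.real (m.halfDiamond i j) = m.height i j / (d + 1 : ℕ) * m.area i j := by
  have h := (nullMeasurableSet_convexJoin_singleton (m.norm_normal hij) (m.interface_subset hij)
    (m.height_nonneg hΩ.isOpen hij) (by rw [height]; ring)
    (m.measurableSet_interface hΩ.isOpen i j)).2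
  rw [Measure.real, halfDiamond, h, ENNReal.toReal_mul, ENNReal.toReal_ofReal]
  · rfl
  · exact div_nonneg (m.height_nonneg hΩ.isOpen hij) (by positivity)

theorem isBounded_cell (hΩ : IsRegularDomain Ω) (i : Fin m.card) :
    Bornology.IsBounded (m.cell i) := hΩ.isBounded.subset (m.cell_subset i)

theorem dist_le_diam (hΩ : IsRegularDomain Ω) {i : Fin m.card} {x y : Space (d + 1)}
    (hx : x ∈ closure (m.cell i)) (hy : y ∈ closure (m.cell i)) :
    dist x y ≤ Metric.diam (m.cell i) := by
  rw [← Metric.diam_closure]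
  exact Metric.dist_le_diam_of_mem (m.isBounded_cell hΩ i).closure hx hy

theorem diam_le_size (i : Fin m.card) : Metric.diam (m.cell i) ≤ m.size :=
  le_ciSup (f := fun i => Metric.diam (m.cell i)) (finite_range _).bddAbove i

theorem size_nonneg : 0 ≤ m.size := Real.iSup_nonneg fun _ => Metric.diam_nonneg

theorem centerDist_le (hΩ : IsRegularDomain Ω) {i j : Fin m.card} (hij : m.Adj i j) :
    m.centerDist i j ≤ Metric.diam (m.cell i) + Metric.diam (m.cell j) := by
  obtain ⟨z, hz⟩ := m.nonempty_interface hij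
  rw [centerDist, ← dist_eq_norm]
  have h1 := m.dist_le_diam hΩ (m.center_mem i) hz.1.1
  have h2 := m.dist_le_diam hΩ (m.center_mem j) hz.1.2
  have := dist_triangle_right (m.center j) (m.center i) z
  linarith

theorem height_le (hΩ : IsRegularDomain Ω) {i j : Fin m.card} (hij : m.Adj i j) :
    m.height i j ≤ Metric.diam (m.cell i) := by
  obtain ⟨z, hz⟩ := m.nonempty_interface hij
  have h1 : ⟪z, m.normal i j⟫ = m.level i j := m.interface_subset hij hz
  rw [height, ← h1, ← inner_sub_left]
  refine (real_inner_le_norm _ _).trans ?_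
  rw [m.norm_normal hij, mul_one, ← dist_eq_norm]
  exact m.dist_le_diam hΩ hz.1.1 (m.center_mem i)

theorem cell_nonempty (i : Fin m.card) : (m.cell i).Nonempty :=
  closure_nonempty_iff.1 ⟨_, m.center_mem i⟩

theorem volume_cell_pos (hΩ : IsRegularDomain Ω) (i : Fin m.card) :
    0 < volume.real (m.cell i) := by
  rw [Measure.real, ENNReal.toReal_pos_iff]
  exact ⟨(m.cell_open i).measure_pos volume (m.cell_nonempty i),
    (m.isBounded_cell hΩ i).measure_lt_top⟩

end Geometry

end AdmissibleMesh

end ZeroFluxFV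

namespace ZeroFluxFV

/-! ### Segments, interfaces and the boundary -/

/-- A segment that misses `∂Ω` is covered by the disjoint open sets `Ω` and the complement of its
closure, and it is connected. -/
theorem mem_of_notMem_shadow_frontier {ℓ : ℕ} {Ω : Set (Space ℓ)} (hΩ : IsOpen Ω) {a x : Space ℓ}
    {s : ℝ} (h : x ∉ shadow a s (frontier Ω)) {t₀ : ℝ} (ht₀ : t₀ ∈ Icc 0 s)
    (hx : x + t₀ • a ∈ Ω) {t : ℝ} (ht : t ∈ Icc 0 s) : x + t • a ∈ Ω := by
  have hpre : IsPreconnected ((fun t : ℝ => x + t • a) '' Icc 0 s) :=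
    isPreconnected_Icc.image _ (by fun_prop)
  have hsub := hpre.subset_left_of_subset_union hΩ isClosed_closure.isOpen_compl
    (disjoint_compl_right.mono_left subset_closure) (by
      rintro _ ⟨t, ht, rfl⟩
      by_contra hcon
      simp only [mem_union, mem_compl_iff, not_or, not_not] at hcon
      exact h ⟨t, ht, by rw [hΩ.frontier_eq]; exact ⟨hcon.2, hcon.1⟩⟩)
    ⟨x + t₀ • a, mem_image_of_mem (fun t : ℝ => x + t • a) ht₀, hx⟩
  exact hsub (mem_image_of_mem (fun t : ℝ => x + t • a) ht)

theorem isCompact_shadow {ℓ : ℕ} {K : Set (Space ℓ)} (hK : IsCompact K) (a : Space ℓ) (s : ℝ) :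
    IsCompact (shadow a s K) := by
  have : shadow a s K = (fun p : Space ℓ × ℝ => p.1 - p.2 • a) '' (K ×ˢ Icc 0 s) := by
    ext x
    constructor
    · rintro ⟨t, ht, hx⟩
      exact ⟨(_, t), ⟨hx, ht⟩, by simp⟩
    · rintro ⟨⟨z, t⟩, ⟨hz, ht⟩, rfl⟩
      exact ⟨t, ht, by simpa using hz⟩
  rw [this]
  exact (hK.prod isCompact_Icc).image (by fun_prop)

namespace AdmissibleMesh

section Crossing

variable {d : ℕ} {Ω : Set (Space (d + 1))} (m : AdmissibleMesh Ω)

/-- The points of an interface that are not regular at the scale `r`. -/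
def badSet (i j : Fin m.card) (r : ℝ) : Set (Space (d + 1)) :=
  m.interface i j \ {z | m.RegularAt i j z r}

/-- On the interface the value `⟪z, n⟫` is the constant `level`, so regularity says that every `y`
within `r` of `z` satisfies a condition free of `z`. This defines a closed set of `z`. -/
theorem measurableSet_badSet (hΩ : IsOpen Ω) {i j : Fin m.card} (hij : m.Adj i j) (r : ℝ) :
    MeasurableSet (m.badSet i j r) := by
  have hcl : IsClosed {z : Space (d + 1) | ∀ y, dist y z < r → y ∈ Ω ∧
      (⟪y, m.normal i j⟫ < m.level i j → y ∈ closure (m.cell i)) ∧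
      (m.level i j < ⟪y, m.normal i j⟫ → y ∈ closure (m.cell j))} := by
    simp only [ofPred_forall]
    refine isClosed_iInter fun y => ?_
    by_cases hy : y ∈ Ω ∧
      (⟪y, m.normal i j⟫ < m.level i j → y ∈ closure (m.cell i)) ∧
      (m.level i j < ⟪y, m.normal i j⟫ → y ∈ closure (m.cell j))
    · rw [show {z : Space (d + 1) | dist y z < r → y ∈ Ω ∧
        (⟪y, m.normal i j⟫ < m.level i j → y ∈ closure (m.cell i)) ∧
        (m.level i j < ⟪y, m.normal i j⟫ → y ∈ closure (m.cell j))} = univ from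
        eq_univ_of_forall fun z _ => hy]
      exact isClosed_univ
    · simp only [hy, imp_false, not_lt]
      exact isClosed_le (by fun_prop) (by fun_prop)
  have : m.badSet i j r = m.interface i j \ {z : Space (d + 1) | ∀ y, dist y z < r → y ∈ Ω ∧
      (⟪y, m.normal i j⟫ < m.level i j → y ∈ closure (m.cell i)) ∧
      (m.level i j < ⟪y, m.normal i j⟫ → y ∈ closure (m.cell j))} := by
    ext z
    simp only [badSet, Set.mem_sdiff, mem_ofPred_eq]
    refine and_congr_right fun hz => not_congr ?_
    have hz : ⟪z, m.normal i j⟫ = m.level i j := m.interface_subset hij hz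
    have e1 : ∀ y, ⟪y - z, m.normal i j⟫ < 0 ↔ ⟪y, m.normal i j⟫ < m.level i j := fun y => by
      rw [inner_sub_left, hz, sub_neg]
    have e2 : ∀ y, 0 < ⟪y - z, m.normal i j⟫ ↔ m.level i j < ⟪y, m.normal i j⟫ := fun y => by
      rw [inner_sub_left, hz, sub_pos]
    simp only [RegularAt, subset_def, mem_inter_iff, Metric.mem_ball, mem_ofPred_eq, e1, e2]
    grind
  rw [this]
  exact (m.measurableSet_interface hΩ i j).diff hcl.measurableSet

theorem badSet_mono (i j : Fin m.card) {r r' : ℝ} (h : r ≤ r') :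
    m.badSet i j r ⊆ m.badSet i j r' := fun _ hz => ⟨hz.1, fun h' => hz.2 (h'.mono h)⟩

/-- Continuity of measures from above: the bad sets decrease to the points that are regular at no
scale, which are negligible. -/
theorem tendsto_badSet (hΩ : IsRegularDomain Ω) {i j : Fin m.card} (hij : m.Adj i j) :
    Tendsto (fun r => surfaceMeasure (d + 1) (m.badSet i j r)) (𝓝[>] 0) (𝓝 0) := by
  have h := tendsto_measure_biInter_gt (μ := surfaceMeasure (d + 1)) (s := m.badSet i j)
    (a := (0 : ℝ)) (fun r _ => (m.measurableSet_badSet hΩ.isOpen hij r).nullMeasurableSet)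
    (fun _ _ _ h => m.badSet_mono i j h)
    ⟨1, one_pos, ((measure_mono sdiff_subset).trans_lt (m.area_lt_top hΩ hij)).ne⟩
  have h0 : surfaceMeasure (d + 1) (⋂ r > (0 : ℝ), m.badSet i j r) = 0 := by
    refine measure_mono_null ?_ (m.ae_exists_regularAt hΩ.isOpen hij)
    intro z hz
    simp only [mem_iInter] at hz
    refine ⟨(hz 1 one_pos).1, ?_⟩
    rintro ⟨r, hr, h⟩
    exact (hz r hr).2 h
  rw [h0] at h
  exact h

open Classical in
/-- The ordered pairs of neighbours whose interface is crossed in the direction `a`. -/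
noncomputable def crossed (a : Space (d + 1)) : Finset (Fin m.card × Fin m.card) :=
  Finset.univ.filter fun p => m.Adj p.1 p.2 ∧ 0 < ⟪a, m.normal p.1 p.2⟫

theorem mem_crossed {a : Space (d + 1)} {p : Fin m.card × Fin m.card} :
    p ∈ m.crossed a ↔ m.Adj p.1 p.2 ∧ 0 < ⟪a, m.normal p.1 p.2⟫ := by simp [crossed]

/-- A point is generic if it lies, together with its translate, in a control volume (unless it is
outside the domain), and if the segment between them avoids the interfaces that are negligible or
parallel to the direction. -/
def Generic (a : Space (d + 1)) (s : ℝ) (x : Space (d + 1)) : Prop :=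
  (x ∈ Ω → ∃ i, x ∈ m.cell i) ∧ (x + s • a ∈ Ω → ∃ i, x + s • a ∈ m.cell i) ∧
    ∀ p q, p ≠ q → x ∈ shadow a s (m.interface p q) → m.Adj p q ∧ ⟪a, m.normal p q⟫ ≠ 0

/-- Negligible interfaces have null shadows, and the shadow of an interface parallel to `a` stays in
its hyperplane. -/
theorem ae_generic (a : Space (d + 1)) (s : ℝ) : ∀ᵐ x, m.Generic a s x := by
  refine m.ae_mem_cell.and (Filter.Eventually.and ?_ ?_)
  · exact (measurePreserving_add_right volume (s • a)).quasiMeasurePreserving.ae m.ae_mem_cell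
  · simp only [eventually_all]
    intro p q hpq
    by_cases hadj : m.Adj p q
    · by_cases ha : ⟪a, m.normal p q⟫ = 0
      · refine measure_mono_null ?_ (volume_hyperplane (m.norm_normal hadj) (m.level p q))
        intro x hx
        simp only [mem_compl_iff, mem_ofPred_eq, Classical.not_imp] at hx
        obtain ⟨⟨t, -, hxt⟩, -⟩ := hx
        have : ⟪x + t • a, m.normal p q⟫ = m.level p q := m.interface_subset hadj hxt
        rw [inner_add_left, inner_smul_left, ha, mul_zero, add_zero] at this
        exact this
      · exact Eventually.of_forall fun x _ => ⟨hadj, ha⟩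
    · have h0 : surfaceMeasure (d + 1) (m.interface p q) = 0 := by
        by_contra h
        exact hadj ⟨hpq, h⟩
      refine measure_mono_null ?_ (volume_shadow_null h0 a s)
      intro x hx
      simp only [mem_compl_iff, mem_ofPred_eq, Classical.not_imp] at hx
      exact hx.1

-- The crossing point is regular at the scale `s * (‖a‖ + 1)`, larger than the length of the
-- segment, so both endpoints are in the ball, on opposite sides of the interface. Being generic,
-- each lies in a control volume, which must be the one that fills its half ball.
variable {m} in
theorem Generic.mem_cell_of_crossing {a x : Space (d + 1)} {s : ℝ} (hx : m.Generic a s x)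
    (hs : 0 < s) {p : Fin m.card × Fin m.card} (hp : p ∈ m.crossed a)
    (h1 : x ∈ shadow a s (m.interface p.1 p.2))
    (h2 : x ∉ shadow a s (m.badSet p.1 p.2 (s * (‖a‖ + 1)))) :
    x ∈ m.cell p.1 ∧ x + s • a ∈ m.cell p.2 := by
  obtain ⟨t, ht, hz⟩ := h1
  rw [mem_crossed] at hp
  have hreg : m.RegularAt p.1 p.2 (x + t • a) (s * (‖a‖ + 1)) := by
    by_contra hcon
    exact h2 ⟨t, ht, hz, hcon⟩
  have hzc : ∀ k, x + t • a ∉ m.cell k := by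
    intro k hk
    have e1 := m.eq_of_mem_cell_of_mem_closure hk hz.1.1
    have e2 := m.eq_of_mem_cell_of_mem_closure hk hz.1.2
    exact hp.1.1 (e1.symm.trans e2)
  have hb : ∀ τ : ℝ, |τ| ≤ s → x + t • a + τ • a ∈ Metric.ball (x + t • a) (s * (‖a‖ + 1)) := by
    intro τ hτ
    rw [Metric.mem_ball, dist_eq_norm, add_sub_cancel_left, norm_smul, Real.norm_eq_abs]
    have := mul_le_mul_of_nonneg_right hτ (norm_nonneg a)
    linarith
  have hin : ∀ τ : ℝ, ⟪x + t • a + τ • a - (x + t • a), m.normal p.1 p.2⟫ =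
      τ * ⟪a, m.normal p.1 p.2⟫ := by
    intro τ
    rw [add_sub_cancel_left, inner_smul_left]
    simp
  have hx0 : x = x + t • a + (-t) • a := by module
  have hx1 : x + s • a = x + t • a + (s - t) • a := by module
  have hb0 := hb (-t) (by rw [abs_neg, abs_of_nonneg ht.1]; exact ht.2)
  have hb1 := hb (s - t) (by rw [abs_of_nonneg (by linarith [ht.2])]; linarith [ht.1])
  have hi0 := hin (-t)
  have hi1 := hin (s - t)
  rw [← hx0] at hb0 hi0
  rw [← hx1] at hb1 hi1
  obtain ⟨k, hk⟩ := hx.1 (hreg.1 hb0)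
  obtain ⟨l, hl⟩ := hx.2.1 (hreg.1 hb1)
  have ht0 : 0 < t := by
    rcases ht.1.eq_or_lt with rfl | h
    · exact absurd hk (by simpa using hzc k)
    · exact h
  have ht1 : t < s := by
    rcases ht.2.eq_or_lt with rfl | h
    · exact absurd hl (hzc l)
    · exact h
  have e1 := m.eq_of_mem_cell_of_mem_closure hk (hreg.2.1 ⟨hb0, by
    rw [mem_ofPred_eq, hi0]; nlinarith [hp.2]⟩)
  have e2 := m.eq_of_mem_cell_of_mem_closure hl (hreg.2.2 ⟨hb1, by
    rw [mem_ofPred_eq, hi1]; nlinarith [hp.2]⟩)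
  exact ⟨e1 ▸ hk, e2 ▸ hl⟩

-- Every interface met by a generic segment is non-negligible and transversal to `a`; one of its two
-- orientations is then in `crossed a`. So the segment meets no interface at all.
variable {m} in
theorem Generic.eq_of_no_crossing (hΩ : IsOpen Ω) {a x : Space (d + 1)} {s : ℝ}
    (hx : m.Generic a s x) (hs : 0 < s) (h1 : x ∉ shadow a s (frontier Ω))
    (h2 : ∀ p ∈ m.crossed a, x ∉ shadow a s (m.interface p.1 p.2)) {i j : Fin m.card}
    (hi : x ∈ m.cell i) (hj : x + s • a ∈ m.cell j) : i = j := by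
  have hseg : ∀ z ∈ segment ℝ x (x + s • a), ∃ t ∈ Icc 0 s, z = x + t • a := by
    intro z hz
    rw [segment_eq_image'] at hz
    obtain ⟨r, hr, rfl⟩ := hz
    refine ⟨r * s, ⟨mul_nonneg hr.1 hs.le, mul_le_of_le_one_left hs.le hr.2⟩, ?_⟩
    simp only [add_sub_cancel_left, smul_smul]
  refine m.eq_of_segment_subset hΩ hi hj ?_ ?_
  · intro z hz
    obtain ⟨t, ht, rfl⟩ := hseg z hz
    exact mem_of_notMem_shadow_frontier hΩ h1 ⟨le_refl 0, hs.le⟩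
      (by simpa using m.cell_subset i hi) ht
  · intro p q hpq z hz hzI
    obtain ⟨t, ht, rfl⟩ := hseg z hz
    obtain ⟨hadj, ha⟩ := hx.2.2 p q hpq ⟨t, ht, hzI⟩
    rcases lt_or_gt_of_ne ha with hneg | hpos
    · refine h2 (q, p) (m.mem_crossed.2 ⟨m.adj_comm.1 hadj, ?_⟩) ⟨t, ht, ?_⟩
      · dsimp only
        rw [m.normal_comm, inner_neg_right]
        linarith
      · dsimp only
        rwa [m.interface_comm]
    · exact h2 (p, q) (m.mem_crossed.2 ⟨hadj, hpos⟩) ⟨t, ht, hzI⟩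

end Crossing

/-! ### Piecewise smooth functions and their translates -/

section Translate

variable {d : ℕ} {Ω : Set (Space (d + 1))} (m : AdmissibleMesh Ω)

/-- The function equal to `ψ i` on the control volume `i`, and to zero elsewhere. -/
noncomputable def piecewise (ψ : Fin m.card → Space (d + 1) → ℝ) (x : Space (d + 1)) : ℝ :=
  ∑ i, (m.cell i).indicator (ψ i) x

/-- The variation, between `x` and `x + s a`, that takes place inside the control volumes. -/
noncomputable def innerVariation (ψ : Fin m.card → Space (d + 1) → ℝ) (a : Space (d + 1)) (s : ℝ)
    (x : Space (d + 1)) : ℝ :=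
  ∑ i, (m.cell i ∩ (fun x => x + s • a) ⁻¹' m.cell i).indicator
    (fun x => ψ i (x + s • a) - ψ i x) x

/-- The variation, between `x` and `x + s a`, that comes from the jumps at the interfaces. -/
noncomputable def jumpVariation (ψ : Fin m.card → Space (d + 1) → ℝ) (a : Space (d + 1)) (s : ℝ)
    (x : Space (d + 1)) : ℝ :=
  ∑ p ∈ m.crossed a, (shadow a s (m.interface p.1 p.2)).indicator
    (fun x => ψ p.2 x - ψ p.1 x) x

variable {ψ : Fin m.card → Space (d + 1) → ℝ} {a x : Space (d + 1)} {s : ℝ}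

theorem piecewise_of_mem {i : Fin m.card} (hx : x ∈ m.cell i) : m.piecewise ψ x = ψ i x := by
  rw [piecewise, Finset.sum_eq_single i, indicator_of_mem hx]
  · intro j _ hj
    exact indicator_of_notMem
      (fun h => hj (m.eq_of_mem_cell_of_mem_closure h (subset_closure hx))) _
  · simp

theorem piecewise_of_notMem (hx : x ∉ Ω) : m.piecewise ψ x = 0 :=
  Finset.sum_eq_zero fun i _ => indicator_of_notMem (fun h => hx (m.cell_subset i h)) _

theorem innerVariation_of_mem {i : Fin m.card} (hx : x ∈ m.cell i) (hx' : x + s • a ∈ m.cell i) :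
    m.innerVariation ψ a s x = ψ i (x + s • a) - ψ i x := by
  rw [innerVariation, Finset.sum_eq_single i, indicator_of_mem (by exact ⟨hx, hx'⟩)]
  · intro j _ hj
    exact indicator_of_notMem
      (fun h => hj (m.eq_of_mem_cell_of_mem_closure h.1 (subset_closure hx))) _
  · simp

theorem innerVariation_eq_zero (h : ∀ i, x ∈ m.cell i → x + s • a ∉ m.cell i) :
    m.innerVariation ψ a s x = 0 :=
  Finset.sum_eq_zero fun i _ => indicator_of_notMem (fun h' => h i h'.1 h'.2) _

theorem jumpVariation_eq_zero
    (h : ∀ p ∈ m.crossed a, x ∉ shadow a s (m.interface p.1 p.2)) :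
    m.jumpVariation ψ a s x = 0 :=
  Finset.sum_eq_zero fun p hp => indicator_of_notMem (h p hp) _

theorem abs_piecewise_le {B : ℝ} (hB0 : 0 ≤ B) (hB : ∀ i x, |ψ i x| ≤ B) (x : Space (d + 1)) :
    |m.piecewise ψ x| ≤ B := by
  by_cases h : ∃ i, x ∈ m.cell i
  · obtain ⟨i, hi⟩ := h
    rw [m.piecewise_of_mem hi]
    exact hB i x
  · push Not at h
    rw [piecewise, Finset.sum_eq_zero fun i _ => indicator_of_notMem (h i) _, abs_zero]
    exact hB0

theorem abs_innerVariation_le {B : ℝ} (hB0 : 0 ≤ B) (hB : ∀ i x, |ψ i x| ≤ B)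
    (x : Space (d + 1)) : |m.innerVariation ψ a s x| ≤ 2 * B := by
  by_cases h : ∃ i, x ∈ m.cell i ∧ x + s • a ∈ m.cell i
  · obtain ⟨i, hi, hi'⟩ := h
    rw [m.innerVariation_of_mem hi hi']
    refine (abs_sub _ _).trans ?_
    linarith [hB i x, hB i (x + s • a)]
  · push Not at h
    rw [m.innerVariation_eq_zero h, abs_zero]
    positivity

theorem abs_jumpVariation_le {B : ℝ} (hB0 : 0 ≤ B) (hB : ∀ i x, |ψ i x| ≤ B)
    (x : Space (d + 1)) : |m.jumpVariation ψ a s x| ≤ (m.crossed a).card * (2 * B) := by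
  rw [jumpVariation, ← nsmul_eq_mul]
  refine (Finset.abs_sum_le_sum_abs _ _).trans (Finset.sum_le_card_nsmul _ _ _ fun p _ => ?_)
  by_cases h : x ∈ shadow a s (m.interface p.1 p.2)
  · rw [indicator_of_mem h]
    refine (abs_sub _ _).trans ?_
    linarith [hB p.1 x, hB p.2 x]
  · rw [indicator_of_notMem h, abs_zero]
    positivity

/-- The part of the variation between `x` and `x + s a` that is not accounted for. -/
noncomputable def remainder (ψ : Fin m.card → Space (d + 1) → ℝ) (a : Space (d + 1)) (s : ℝ)
    (x : Space (d + 1)) : ℝ :=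
  m.piecewise ψ (x + s • a) - m.piecewise ψ x - m.innerVariation ψ a s x -
    m.jumpVariation ψ a s x

theorem abs_remainder_le {B : ℝ} (hB0 : 0 ≤ B) (hB : ∀ i x, |ψ i x| ≤ B) (x : Space (d + 1)) :
    |m.remainder ψ a s x| ≤ (4 + 2 * (m.crossed a).card) * B := by
  have h1 := m.abs_piecewise_le hB0 hB x
  have h2 := m.abs_piecewise_le hB0 hB (x + s • a)
  have h3 := m.abs_innerVariation_le (a := a) (s := s) hB0 hB x
  have h4 := m.abs_jumpVariation_le (a := a) (s := s) hB0 hB x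
  rw [abs_le] at *
  constructor <;> · rw [remainder]; linarith [h1.1, h1.2, h2.1, h2.2, h3.1, h3.2, h4.1, h4.2]

variable {m} in
/-- The remainder at a crossing of an interface. -/
theorem Generic.abs_remainder_le_of_crossing (hx : m.Generic a s x) (hs : 0 < s) {C : NNReal}
    (hC : ∀ i, LipschitzWith C (ψ i))
    (hbad : ∀ p ∈ m.crossed a, x ∉ shadow a s (m.badSet p.1 p.2 (s * (‖a‖ + 1))))
    {p : Fin m.card × Fin m.card} (hp : p ∈ m.crossed a)
    (hxp : x ∈ shadow a s (m.interface p.1 p.2)) :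
    |m.remainder ψ a s x| ≤ C * (s * ‖a‖) := by
  obtain ⟨h1, h2⟩ := hx.mem_cell_of_crossing hs hp hxp (hbad p hp)
  have hne : p.1 ≠ p.2 := (m.mem_crossed.1 hp).1.1
  have hI : m.innerVariation ψ a s x = 0 := by
    refine m.innerVariation_eq_zero fun i hi hi' => hne ?_
    have e1 := m.eq_of_mem_cell_of_mem_closure h1 (subset_closure hi)
    have e2 := m.eq_of_mem_cell_of_mem_closure h2 (subset_closure hi')
    exact e1.trans e2.symm
  have hJ : m.jumpVariation ψ a s x = ψ p.2 x - ψ p.1 x := by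
    rw [jumpVariation, Finset.sum_eq_single p, indicator_of_mem hxp]
    · intro q hq hqp
      refine indicator_of_notMem (fun hxq => hqp ?_) _
      obtain ⟨h3, h4⟩ := hx.mem_cell_of_crossing hs hq hxq (hbad q hq)
      have e1 := m.eq_of_mem_cell_of_mem_closure h3 (subset_closure h1)
      have e2 := m.eq_of_mem_cell_of_mem_closure h4 (subset_closure h2)
      exact Prod.ext e1 e2
    · exact fun h => absurd hp h
  rw [remainder, m.piecewise_of_mem h1, m.piecewise_of_mem h2, hI, hJ]
  have h5 := (hC p.2).dist_le_mul (x + s • a) x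
  rw [Real.dist_eq, dist_eq_norm, add_sub_cancel_left, norm_smul, Real.norm_of_nonneg hs.le] at h5
  calc _ = |ψ p.2 (x + s • a) - ψ p.2 x| := by congr 1; ring
    _ ≤ _ := h5

variable {m} in
/-- The remainder away from the interfaces and from the boundary. -/
theorem Generic.remainder_eq_zero (hΩ : IsOpen Ω) (hx : m.Generic a s x) (hs : 0 < s)
    (h1 : x ∉ shadow a s (frontier Ω))
    (h2 : ∀ p ∈ m.crossed a, x ∉ shadow a s (m.interface p.1 p.2)) :
    m.remainder ψ a s x = 0 := by
  rw [remainder, m.jumpVariation_eq_zero h2]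
  have h0 : (0 : ℝ) ∈ Icc 0 s := ⟨le_refl 0, hs.le⟩
  have hs' : s ∈ Icc 0 s := ⟨hs.le, le_refl s⟩
  by_cases hxΩ : x ∈ Ω
  · have hxs := mem_of_notMem_shadow_frontier hΩ h1 h0 (by simpa using hxΩ) hs'
    obtain ⟨i, hi⟩ := hx.1 hxΩ
    obtain ⟨j, hj⟩ := hx.2.1 hxs
    obtain rfl := hx.eq_of_no_crossing hΩ hs h1 h2 hi hj
    rw [m.piecewise_of_mem hi, m.piecewise_of_mem hj, m.innerVariation_of_mem hi hj]
    ring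
  · have hxs : x + s • a ∉ Ω := fun h => hxΩ (by
      simpa using mem_of_notMem_shadow_frontier hΩ h1 hs' h h0)
    rw [m.piecewise_of_notMem hxΩ, m.piecewise_of_notMem hxs,
      m.innerVariation_eq_zero fun i hi => absurd (m.cell_subset i hi) hxΩ]
    ring

/-- The variation of the piecewise smooth function at the points whose translate is not in the
domain, or that are not in the domain themselves. -/
noncomputable def boundaryVariation (ψ : Fin m.card → Space (d + 1) → ℝ) (a : Space (d + 1))
    (s : ℝ) (x : Space (d + 1)) : ℝ :=
  (Ω ∩ (fun x => x + s • a) ⁻¹' Ω)ᶜ.indicator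
    (fun x => |m.piecewise ψ (x + s • a) - m.piecewise ψ x|) x

theorem boundaryVariation_nonneg : 0 ≤ m.boundaryVariation ψ a s x :=
  indicator_nonneg (fun _ _ => abs_nonneg _) _

theorem abs_piecewise_le_of_cell {g : Space (d + 1) → ℝ} (hg0 : ∀ x, 0 ≤ g x)
    (hg : ∀ i, ∀ x ∈ m.cell i, |ψ i x| ≤ g x) (x : Space (d + 1)) : |m.piecewise ψ x| ≤ g x := by
  by_cases h : ∃ i, x ∈ m.cell i
  · obtain ⟨i, hi⟩ := h
    rw [m.piecewise_of_mem hi]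
    exact hg i x hi
  · push Not at h
    rw [piecewise, Finset.sum_eq_zero fun i _ => indicator_of_notMem (h i) _, abs_zero]
    exact hg0 x

/-- At most one endpoint contributes, and moving the evaluation of `g` to any other point of the
segment costs the Lipschitz term. The point used later is the one on `∂Ω`, as
`IsRegularDomain.lintegral_shadow_le` requires. -/
theorem boundaryVariation_le {g : Space (d + 1) → ℝ} (hg0 : ∀ x, 0 ≤ g x)
    (hg : ∀ i, ∀ x ∈ m.cell i, |ψ i x| ≤ g x) {C : NNReal} (hC : LipschitzWith C g) {t : ℝ}
    (ht : t ∈ Icc 0 s) :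
    m.boundaryVariation ψ a s x ≤ g (x + t • a) + C * (s * ‖a‖) := by
  have hs : 0 ≤ s := ht.1.trans ht.2
  have hd : ∀ τ ∈ Icc 0 s, g (x + τ • a) ≤ g (x + t • a) + C * (s * ‖a‖) := by
    intro τ hτ
    have h := hC.dist_le_mul (x + τ • a) (x + t • a)
    rw [Real.dist_eq, dist_eq_norm, add_sub_add_left_eq_sub, ← sub_smul, norm_smul,
      Real.norm_eq_abs] at h
    have h2 : |τ - t| ≤ s := by
      rw [abs_le]
      constructor <;> linarith [hτ.1, hτ.2, ht.1, ht.2]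
    have h3 : (C : ℝ) * (|τ - t| * ‖a‖) ≤ C * (s * ‖a‖) := by gcongr
    linarith [le_abs_self (g (x + τ • a) - g (x + t • a))]
  have hpos : 0 ≤ g (x + t • a) + C * (s * ‖a‖) := by
    have := hg0 (x + t • a)
    positivity
  rw [boundaryVariation]
  by_cases hmem : x ∈ (Ω ∩ (fun x => x + s • a) ⁻¹' Ω)ᶜ
  · rw [indicator_of_mem hmem]
    by_cases hxΩ : x ∈ Ω
    · have : x + s • a ∉ Ω := fun h => hmem ⟨hxΩ, h⟩
      rw [m.piecewise_of_notMem this, zero_sub, abs_neg]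
      refine (m.abs_piecewise_le_of_cell hg0 hg x).trans ?_
      simpa using hd 0 ⟨le_refl 0, hs⟩
    · rw [m.piecewise_of_notMem hxΩ, sub_zero]
      exact (m.abs_piecewise_le_of_cell hg0 hg _).trans (hd s ⟨hs, le_refl s⟩)
  · rw [indicator_of_notMem hmem]
    exact hpos

theorem abs_remainder_eq_of_leaving (hx : ¬(x ∈ Ω ∧ x + s • a ∈ Ω))
    (h2 : ∀ p ∈ m.crossed a, x ∉ shadow a s (m.interface p.1 p.2)) :
    |m.remainder ψ a s x| = m.boundaryVariation ψ a s x := by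
  rw [remainder, m.jumpVariation_eq_zero h2,
    m.innerVariation_eq_zero fun i hi hi' => hx ⟨m.cell_subset i hi, m.cell_subset i hi'⟩,
    boundaryVariation, indicator_of_mem (by exact hx), sub_zero, sub_zero]

end Translate

end AdmissibleMesh

end ZeroFluxFV

namespace ZeroFluxFV

namespace AdmissibleMesh

/-! ### The Gauss-Green inequality on a mesh -/

section GaussGreen

variable {d : ℕ} {Ω : Set (Space (d + 1))} (m : AdmissibleMesh Ω)
  {ψ : Fin m.card → Space (d + 1) → ℝ} {a : Space (d + 1)} {s : ℝ}

theorem measurableSet_shadow_interface (hΩ : IsOpen Ω) {p : Fin m.card × Fin m.card}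
    (hp : p ∈ m.crossed a) : MeasurableSet (shadow a s (m.interface p.1 p.2)) := by
  rw [mem_crossed] at hp
  exact measurableSet_shadow_hyperplane (m.norm_normal hp.1) (m.interface_subset hp.1) hp.2.ne'
    (m.measurableSet_interface hΩ _ _)

theorem measurableSet_shadow_badSet (hΩ : IsOpen Ω) {p : Fin m.card × Fin m.card}
    (hp : p ∈ m.crossed a) (r : ℝ) : MeasurableSet (shadow a s (m.badSet p.1 p.2 r)) := by
  rw [mem_crossed] at hp
  exact measurableSet_shadow_hyperplane (m.norm_normal hp.1)
    (sdiff_subset.trans (m.interface_subset hp.1)) hp.2.ne' (m.measurableSet_badSet hΩ hp.1 r)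

theorem measurable_piecewise (hψ : ∀ i, Continuous (ψ i)) : Measurable (m.piecewise ψ) :=
  Finset.measurable_fun_sum _ fun i _ => (hψ i).measurable.indicator (m.cell_open i).measurableSet

theorem integrable_piecewise (hψ : ∀ i, Continuous (ψ i)) (hc : ∀ i, HasCompactSupport (ψ i)) :
    Integrable (m.piecewise ψ) :=
  integrable_finsetSum _ fun i _ =>
    ((hψ i).integrable_of_hasCompactSupport (hc i)).indicator (m.cell_open i).measurableSet

theorem measurableSet_cell_inter (i : Fin m.card) :
    MeasurableSet (m.cell i ∩ (fun x => x + s • a) ⁻¹' m.cell i) :=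
  (m.cell_open i).measurableSet.inter
    ((m.cell_open i).preimage (by fun_prop : Continuous fun x => x + s • a)).measurableSet

theorem integrable_innerVariation (hψ : ∀ i, Continuous (ψ i))
    (hc : ∀ i, HasCompactSupport (ψ i)) : Integrable (m.innerVariation ψ a s) := by
  refine integrable_finsetSum _ fun i _ => Integrable.indicator ?_ (m.measurableSet_cell_inter i)
  have h := (hψ i).integrable_of_hasCompactSupport (μ := volume) (hc i)
  exact (h.comp_add_right (s • a)).sub h

theorem integrable_jumpVariation (hΩ : IsOpen Ω) (hψ : ∀ i, Continuous (ψ i))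
    (hc : ∀ i, HasCompactSupport (ψ i)) : Integrable (m.jumpVariation ψ a s) := by
  refine integrable_finsetSum _ fun p hp =>
    Integrable.indicator ?_ (m.measurableSet_shadow_interface hΩ hp)
  exact ((hψ p.2).integrable_of_hasCompactSupport (hc p.2)).sub
    ((hψ p.1).integrable_of_hasCompactSupport (hc p.1))

/-- By translation invariance the whole variation has integral zero. This is the source of the
Gauss-Green inequality. -/
theorem integral_remainder (hΩ : IsOpen Ω) (hψ : ∀ i, Continuous (ψ i))
    (hc : ∀ i, HasCompactSupport (ψ i)) :
    ∫ x, m.remainder ψ a s x =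
      -((∫ x, m.innerVariation ψ a s x) + ∫ x, m.jumpVariation ψ a s x) := by
  have h1 := m.integrable_piecewise hψ hc
  have h2 := h1.comp_add_right (s • a)
  have h3 := m.integrable_innerVariation (a := a) (s := s) hψ hc
  have h4 := m.integrable_jumpVariation (a := a) (s := s) hΩ hψ hc
  have h5 : Integrable (fun x => m.piecewise ψ (x + s • a) - m.piecewise ψ x) := h2.sub h1
  have h6 : Integrable (fun x => m.piecewise ψ (x + s • a) - m.piecewise ψ x -
      m.innerVariation ψ a s x) := h5.sub h3
  simp only [remainder]
  rw [integral_sub h6 h4, integral_sub h5 h3, integral_sub h2 h1,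
    integral_add_right_eq_self (m.piecewise ψ)]
  ring

theorem measurable_boundaryVariation (hΩ : IsOpen Ω) (hψ : ∀ i, Continuous (ψ i)) :
    Measurable (m.boundaryVariation ψ a s) := by
  have h1 := m.measurable_piecewise hψ
  refine Measurable.indicator ?_ ?_
  · exact ((h1.comp (measurable_add_const _)).sub h1).norm
  · exact (hΩ.measurableSet.inter (hΩ.preimage
      (by fun_prop : Continuous fun x => x + s • a)).measurableSet).compl

/-- The remainder is controlled by the volume of a few shadows. -/
theorem ae_enorm_remainder_le (hΩ : IsRegularDomain Ω) (hs : 0 < s) {B : ℝ} (hB0 : 0 ≤ B)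
    (hB : ∀ i x, |ψ i x| ≤ B) {C : NNReal} (hC : ∀ i, LipschitzWith C (ψ i)) :
    ∀ᵐ x, ‖m.remainder ψ a s x‖ₑ ≤
      (∑ p ∈ m.crossed a, (shadow a s (m.badSet p.1 p.2 (s * (‖a‖ + 1)))).indicator
        (fun _ => ENNReal.ofReal ((4 + 2 * (m.crossed a).card) * B)) x) +
      (returnSet Ω a s).indicator
        (fun _ => ENNReal.ofReal ((4 + 2 * (m.crossed a).card) * B)) x +
      (shadow a s (frontier Ω)).indicator
        (fun x => ENNReal.ofReal (m.boundaryVariation ψ a s x)) x +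
      ∑ p ∈ m.crossed a, (shadow a s (m.interface p.1 p.2)).indicator
        (fun _ => ENNReal.ofReal (C * (s * ‖a‖))) x := by
  filter_upwards [m.ae_generic a s] with x hx
  rw [Real.enorm_eq_ofReal_abs]
  have hK := ENNReal.ofReal_le_ofReal (m.abs_remainder_le (a := a) (s := s) hB0 hB x)
  -- The cases match the four terms: a crude bound near non-regular points and for returning
  -- segments, a Lipschitz error at a clean crossing, the boundary variation when an endpoint is
  -- outside `Ω`. Otherwise the remainder is zero.
  by_cases h1 : ∃ p ∈ m.crossed a, x ∈ shadow a s (m.badSet p.1 p.2 (s * (‖a‖ + 1)))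
  · obtain ⟨p, hp, hxp⟩ := h1
    refine hK.trans ?_
    refine le_trans ?_ (le_add_right (le_add_right (le_add_right
      (Finset.single_le_sum (fun _ _ => zero_le) hp))))
    rw [indicator_of_mem hxp]
  push Not at h1
  by_cases h2 : ∃ p ∈ m.crossed a, x ∈ shadow a s (m.interface p.1 p.2)
  · obtain ⟨p, hp, hxp⟩ := h2
    refine (ENNReal.ofReal_le_ofReal (hx.abs_remainder_le_of_crossing hs hC h1 hp hxp)).trans ?_
    refine le_trans ?_ (le_add_left (Finset.single_le_sum (fun _ _ => zero_le) hp))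
    rw [indicator_of_mem hxp]
  push Not at h2
  by_cases h3 : x ∈ shadow a s (frontier Ω)
  · by_cases h4 : x ∈ Ω ∧ x + s • a ∈ Ω
    · refine hK.trans ?_
      refine le_trans ?_ (le_add_right (le_add_right (le_add_left le_rfl)))
      rw [indicator_of_mem (show x ∈ returnSet Ω a s from ⟨h3, h4⟩)]
    · refine le_trans ?_ (le_add_right (le_add_left le_rfl))
      rw [indicator_of_mem h3, m.abs_remainder_eq_of_leaving h4 h2]
  · rw [hx.remainder_eq_zero hΩ.isOpen hs h3 h2]
    simp

/-- Each of the four contributions carries a factor `s`; after division by it, all but the boundary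
integral tend to zero with `s`. -/
theorem lintegral_remainder_le (hΩ : IsRegularDomain Ω) (hs : 0 < s) (hψ : ∀ i, Continuous (ψ i))
    {B : ℝ} (hB0 : 0 ≤ B) (hB : ∀ i x, |ψ i x| ≤ B) {C : NNReal}
    (hC : ∀ i, LipschitzWith C (ψ i)) {g : Space (d + 1) → ℝ} (hg0 : ∀ x, 0 ≤ g x)
    (hg : ∀ i, ∀ x ∈ m.cell i, |ψ i x| ≤ g x) {C' : NNReal} (hC' : LipschitzWith C' g)
    {ρ : ℝ → ENNReal} (hρ : ∀ s, volume (returnSet Ω a s) ≤ ENNReal.ofReal s * ρ s) :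
    ∫⁻ x, ‖m.remainder ψ a s x‖ₑ ≤ ENNReal.ofReal s *
      ((∑ p ∈ m.crossed a, ENNReal.ofReal ((4 + 2 * (m.crossed a).card) * B) *
        (ENNReal.ofReal ⟪a, m.normal p.1 p.2⟫ *
          surfaceMeasure (d + 1) (m.badSet p.1 p.2 (s * (‖a‖ + 1))))) +
      ENNReal.ofReal ((4 + 2 * (m.crossed a).card) * B) * ρ s +
      (∫⁻ x in frontier Ω, ‖⟪a, exteriorNormal Ω x⟫‖ₑ *
        ENNReal.ofReal (g x + C' * (s * ‖a‖)) ∂surfaceMeasure (d + 1)) +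
      ∑ p ∈ m.crossed a, ENNReal.ofReal (C * (s * ‖a‖)) *
        (ENNReal.ofReal ⟪a, m.normal p.1 p.2⟫ *
          surfaceMeasure (d + 1) (m.interface p.1 p.2))) := by
  have hfr : MeasurableSet (shadow a s (frontier Ω)) :=
    (isCompact_shadow (Metric.isCompact_of_isClosed_isBounded isClosed_frontier
      (hΩ.isBounded.closure.subset frontier_subset_closure)) a s).measurableSet
  have hret : MeasurableSet (returnSet Ω a s) :=
    hfr.inter (hΩ.isOpen.measurableSet.inter (hΩ.isOpen.preimage
      (by fun_prop : Continuous fun x => x + s • a)).measurableSet)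
  have hbv := m.measurable_boundaryVariation (a := a) (s := s) hΩ.isOpen hψ
  set K := ENNReal.ofReal ((4 + 2 * (m.crossed a).card) * B)
  have hle := m.ae_enorm_remainder_le (a := a) hΩ hs hB0 hB hC
  generalize s * (‖a‖ + 1) = r at hle ⊢
  have hm1 : ∀ p ∈ m.crossed a, Measurable fun x =>
      (shadow a s (m.badSet p.1 p.2 r)).indicator (fun _ => K) x := fun p hp =>
    measurable_const.indicator (m.measurableSet_shadow_badSet hΩ.isOpen hp _)
  have hm4 : ∀ p ∈ m.crossed a, Measurable fun x =>
      (shadow a s (m.interface p.1 p.2)).indicator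
        (fun _ => ENNReal.ofReal (C * (s * ‖a‖))) x := fun p hp =>
    measurable_const.indicator (m.measurableSet_shadow_interface hΩ.isOpen hp)
  refine (lintegral_mono_ae hle).trans ?_
  rw [lintegral_add_right _ (Finset.measurable_fun_sum _ hm4),
    lintegral_add_right _ (hbv.ennreal_ofReal.indicator hfr),
    lintegral_add_right _ (measurable_const.indicator hret),
    lintegral_finsetSum _ hm1, lintegral_finsetSum _ hm4, lintegral_indicator hfr,
    lintegral_indicator_const hret, mul_add, mul_add, mul_add, Finset.mul_sum, Finset.mul_sum]
  gcongr ?_ + ?_ + ?_ + ?_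
  · refine Finset.sum_le_sum fun p hp => ?_
    have hp' := m.mem_crossed.1 hp
    rw [lintegral_indicator_const (m.measurableSet_shadow_badSet hΩ.isOpen hp _),
      volume_shadow_hyperplane (S := m.badSet p.1 p.2 r) (m.norm_normal hp'.1)
      (sdiff_subset.trans (m.interface_subset hp'.1)) hp'.2.ne', abs_of_pos hp'.2,
      ENNReal.ofReal_mul hs.le]
    apply le_of_eq
    ring
  · calc K * volume (returnSet Ω a s) ≤ K * (ENNReal.ofReal s * ρ s) := by gcongr; exact hρ s
      _ = _ := by ring
  · refine hΩ.lintegral_shadow_le a hbv (fun x => m.boundaryVariation_nonneg)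
      (g := fun x => g x + C' * (s * ‖a‖)) ?_ ?_ ?_
    · exact hC'.continuous.measurable.add_const _
    · exact fun x => add_nonneg (hg0 x) (by positivity)
    · exact fun x t ht _ => m.boundaryVariation_le hg0 hg hC' ht
  · refine Finset.sum_le_sum fun p hp => ?_
    have hp' := m.mem_crossed.1 hp
    rw [lintegral_indicator_const (m.measurableSet_shadow_interface hΩ.isOpen hp),
      volume_shadow_hyperplane (m.norm_normal hp'.1) (m.interface_subset hp'.1) hp'.2.ne',
      abs_of_pos hp'.2, ENNReal.ofReal_mul hs.le]
    apply le_of_eq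
    ring

/-- Difference quotients, dominated by the Lipschitz constant; since control volumes are open, `x +
s • a` is eventually in the one that contains `x`. -/
theorem tendsto_innerVariation (hΩ : IsRegularDomain Ω) (hψ : ∀ i, ContDiff ℝ 1 (ψ i))
    {C : NNReal} (hC : ∀ i, LipschitzWith C (ψ i)) (hc : ∀ i, HasCompactSupport (ψ i)) :
    Tendsto (fun s : ℝ => s⁻¹ * ∫ x, m.innerVariation ψ a s x) (𝓝[>] 0)
      (𝓝 (∑ i, ∫ x in m.cell i, fderiv ℝ (ψ i) x a)) := by
  have hsum : ∀ s : ℝ, s⁻¹ * ∫ x, m.innerVariation ψ a s x =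
      ∑ i, ∫ x, (m.cell i ∩ (fun x => x + s • a) ⁻¹' m.cell i).indicator
        (fun x => s⁻¹ * (ψ i (x + s • a) - ψ i x)) x := by
    intro s
    simp only [innerVariation]
    rw [integral_finsetSum, Finset.mul_sum]
    · refine Finset.sum_congr rfl fun i _ => ?_
      rw [← integral_const_mul]
      congr 1
      funext x
      by_cases hx : x ∈ m.cell i ∩ (fun x => x + s • a) ⁻¹' m.cell i
      · rw [indicator_of_mem hx, indicator_of_mem hx]
      · rw [indicator_of_notMem hx, indicator_of_notMem hx, mul_zero]
    · intro i _
      have h := (hψ i).continuous.integrable_of_hasCompactSupport (μ := volume) (hc i)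
      exact ((h.comp_add_right (s • a)).sub h).indicator (m.measurableSet_cell_inter i)
  simp_rw [hsum]
  refine tendsto_finsetSum _ fun i _ => ?_
  rw [← integral_indicator (m.cell_open i).measurableSet]
  refine tendsto_integral_filter_of_dominated_convergence
    ((m.cell i).indicator fun _ => (C : ℝ) * ‖a‖) ?_ ?_ ?_ ?_
  · refine Eventually.of_forall fun s => ?_
    have h1 := (hψ i).continuous
    exact (Continuous.aestronglyMeasurable (by fun_prop)).indicator (m.measurableSet_cell_inter i)
  · filter_upwards [self_mem_nhdsWithin] with s hs
    have hs : 0 < s := hs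
    refine Eventually.of_forall fun x => ?_
    by_cases hx : x ∈ m.cell i ∩ (fun x => x + s • a) ⁻¹' m.cell i
    · rw [indicator_of_mem hx, indicator_of_mem hx.1, norm_mul, norm_inv,
        Real.norm_of_nonneg hs.le, ← dist_eq_norm]
      have h := (hC i).dist_le_mul (x + s • a) x
      rw [dist_eq_norm (x + s • a), add_sub_cancel_left, norm_smul, Real.norm_of_nonneg hs.le] at h
      rw [inv_mul_le_iff₀ hs]
      linarith
    · rw [indicator_of_notMem hx, norm_zero]
      exact indicator_nonneg (fun _ _ => by positivity) _
  · exact (integrable_indicator_iff (m.cell_open i).measurableSet).2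
      (integrableOn_const (m.isBounded_cell hΩ i).measure_lt_top.ne)
  · refine Eventually.of_forall fun x => ?_
    by_cases hx : x ∈ m.cell i
    · rw [indicator_of_mem hx]
      have hlim : Tendsto (fun s : ℝ => x + s • a) (𝓝[>] 0) (𝓝 x) := by
        have : Tendsto (fun s : ℝ => x + s • a) (𝓝 0) (𝓝 (x + (0 : ℝ) • a)) :=
          Continuous.tendsto (by fun_prop) 0
        rw [zero_smul, add_zero] at this
        exact this.mono_left nhdsWithin_le_nhds
      have h1 : HasLineDerivAt ℝ (ψ i) (fderiv ℝ (ψ i) x a) x a :=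
        (((hψ i).differentiable one_ne_zero) x).hasFDerivAt.hasLineDerivAt a
      refine (h1.tendsto_slope_zero_right).congr' ?_
      filter_upwards [hlim.eventually ((m.cell_open i).mem_nhds hx)] with s hs
      rw [indicator_of_mem (by exact ⟨hx, hs⟩), smul_eq_mul]
    · rw [indicator_of_notMem hx]
      refine tendsto_const_nhds.congr fun s => ?_
      rw [indicator_of_notMem fun h => hx h.1]

/-- The shadow is a prism over the interface. Evaluating the jump at `x` rather than at the crossing
point is part of the O(s²) error of `abs_integral_shadow_sub_le`. -/
theorem tendsto_jumpVariation (hΩ : IsRegularDomain Ω) (hψ : ∀ i, Continuous (ψ i))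
    {B : ℝ} (hB : ∀ i x, |ψ i x| ≤ B) {C : NNReal} (hC : ∀ i, LipschitzWith C (ψ i))
    (hc : ∀ i, HasCompactSupport (ψ i)) :
    Tendsto (fun s : ℝ => s⁻¹ * ∫ x, m.jumpVariation ψ a s x) (𝓝[>] 0)
      (𝓝 (∑ p ∈ m.crossed a, ⟪a, m.normal p.1 p.2⟫ *
        ((∫ x in m.interface p.1 p.2, ψ p.2 x ∂surfaceMeasure (d + 1)) -
          ∫ x in m.interface p.1 p.2, ψ p.1 x ∂surfaceMeasure (d + 1)))) := by
  have hint : ∀ i, Integrable (ψ i) := fun i =>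
    (hψ i).integrable_of_hasCompactSupport (hc i)
  have hsum : ∀ s : ℝ, s⁻¹ * ∫ x, m.jumpVariation ψ a s x =
      ∑ p ∈ m.crossed a, (s⁻¹ * (∫ x in shadow a s (m.interface p.1 p.2), ψ p.2 x) -
        s⁻¹ * ∫ x in shadow a s (m.interface p.1 p.2), ψ p.1 x) := by
    intro s
    simp only [jumpVariation]
    rw [integral_finsetSum, Finset.mul_sum]
    · refine Finset.sum_congr rfl fun p hp => ?_
      rw [integral_indicator (m.measurableSet_shadow_interface hΩ.isOpen hp),
        integral_sub (hint _).integrableOn (hint _).integrableOn, mul_sub]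
    · exact fun p hp => ((hint _).sub (hint _)).indicator
        (m.measurableSet_shadow_interface hΩ.isOpen hp)
  simp_rw [hsum]
  refine tendsto_finsetSum _ fun p hp => ?_
  have hp' := m.mem_crossed.1 hp
  have key : ∀ i, Tendsto (fun s : ℝ => s⁻¹ * ∫ x in shadow a s (m.interface p.1 p.2), ψ i x)
      (𝓝[>] 0) (𝓝 (⟪a, m.normal p.1 p.2⟫ *
        ∫ x in m.interface p.1 p.2, ψ i x ∂surfaceMeasure (d + 1))) := by
    intro i
    rw [tendsto_iff_norm_sub_tendsto_zero]
    set K := C * ‖a‖ * |⟪a, m.normal p.1 p.2⟫| *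
      (surfaceMeasure (d + 1)).real (m.interface p.1 p.2)
    have h0 : Tendsto (fun s : ℝ => K * s) (𝓝[>] 0) (𝓝 0) := by
      have : Tendsto (fun s : ℝ => K * s) (𝓝 0) (𝓝 (K * 0)) :=
        Continuous.tendsto (by fun_prop) 0
      rw [mul_zero] at this
      exact this.mono_left nhdsWithin_le_nhds
    refine squeeze_zero' (Eventually.of_forall fun _ => norm_nonneg _) ?_ h0
    filter_upwards [self_mem_nhdsWithin] with s hs
    have hs : 0 < s := hs
    have h1 := abs_integral_shadow_sub_le (m.norm_normal hp'.1) (m.interface_subset hp'.1)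
      hp'.2.ne' hs.le (m.measurableSet_interface hΩ.isOpen _ _) (m.area_lt_top hΩ hp'.1)
      (hC i) (hB i)
    rw [abs_of_pos hp'.2] at h1
    have h2 : s⁻¹ * (∫ x in shadow a s (m.interface p.1 p.2), ψ i x) -
        ⟪a, m.normal p.1 p.2⟫ * ∫ x in m.interface p.1 p.2, ψ i x ∂surfaceMeasure (d + 1) =
        s⁻¹ * ((∫ x in shadow a s (m.interface p.1 p.2), ψ i x) - s * ⟪a, m.normal p.1 p.2⟫ *
        ∫ x in m.interface p.1 p.2, ψ i x ∂surfaceMeasure (d + 1)) := by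
      field_simp
    rw [h2, norm_mul, norm_inv, Real.norm_of_nonneg hs.le, inv_mul_le_iff₀ hs, Real.norm_eq_abs]
    refine h1.trans (le_of_eq ?_)
    simp only [K]
    rw [abs_of_pos hp'.2]
    ring
  rw [mul_sub]
  exact (key _).sub (key _)

/-- The Gauss-Green inequality for piecewise smooth functions, with the contribution of the
interfaces that are crossed in the direction `a`. -/
theorem abs_sum_crossed_le (hΩ : IsRegularDomain Ω) (hψ : ∀ i, ContDiff ℝ 1 (ψ i))
    (hc : ∀ i, HasCompactSupport (ψ i)) {g : Space (d + 1) → ℝ} (hg0 : ∀ x, 0 ≤ g x)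
    (hg : ∀ i, ∀ x ∈ m.cell i, |ψ i x| ≤ g x) {C' : NNReal} (hC' : LipschitzWith C' g)
    (hgb : BddAbove (range g)) :
    |(∑ i, ∫ x in m.cell i, fderiv ℝ (ψ i) x a) +
      ∑ p ∈ m.crossed a, ⟪a, m.normal p.1 p.2⟫ *
        ((∫ x in m.interface p.1 p.2, ψ p.2 x ∂surfaceMeasure (d + 1)) -
          ∫ x in m.interface p.1 p.2, ψ p.1 x ∂surfaceMeasure (d + 1))| ≤
      ∫ x in frontier Ω, |⟪a, exteriorNormal Ω x⟫| * g x ∂surfaceMeasure (d + 1) := by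
  have hcont : ∀ i, Continuous (ψ i) := fun i => (hψ i).continuous
  obtain ⟨B, hB0, hB⟩ : ∃ B : ℝ, 0 ≤ B ∧ ∀ i x, |ψ i x| ≤ B := by
    have h : ∀ i, ∃ B, ∀ x, ‖ψ i x‖ ≤ B := fun i => (hcont i).bounded_above_of_compact_support (hc i)
    choose b hb using h
    have hb0 : ∀ i, 0 ≤ b i := fun i => (norm_nonneg _).trans (hb i 0)
    exact ⟨∑ i, b i, Finset.sum_nonneg fun i _ => hb0 i, fun i x =>
      (hb i x).trans (Finset.single_le_sum (fun i _ => hb0 i) (Finset.mem_univ i))⟩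
  obtain ⟨C, hC⟩ : ∃ C : NNReal, ∀ i, LipschitzWith C (ψ i) := by
    have h : ∀ i, ∃ C, LipschitzWith C (ψ i) := fun i =>
      ContDiff.lipschitzWith_of_hasCompactSupport (hc i) (hψ i) one_ne_zero
    choose b hb using h
    exact ⟨∑ i, b i, fun i => (hb i).weaken
      (Finset.single_le_sum (fun _ _ => zero_le) (Finset.mem_univ i))⟩
  obtain ⟨ρ, hρ0, hρ⟩ := hΩ.exists_volume_returnSet_le a
  have hlim := (m.tendsto_innerVariation (a := a) hΩ hψ hC hc).add
    (m.tendsto_jumpVariation (a := a) hΩ hcont hB hC hc)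
  have hlim2 := (continuous_enorm.tendsto _).comp hlim
  have haem : AEMeasurable (fun x => ‖⟪a, exteriorNormal Ω x⟫‖ₑ)
      ((surfaceMeasure (d + 1)).restrict (frontier Ω)) :=
    ((aemeasurable_const.inner hΩ.aemeasurable_exteriorNormal)).enorm
  have hflux : ∫⁻ x in frontier Ω, ‖⟪a, exteriorNormal Ω x⟫‖ₑ ∂surfaceMeasure (d + 1) < ⊤ := by
    have : ∫⁻ x in frontier Ω, ‖⟪a, exteriorNormal Ω x⟫‖ₑ ∂surfaceMeasure (d + 1) ≤
        ∫⁻ x in frontier Ω, ‖a‖ₑ ∂surfaceMeasure (d + 1) := by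
      refine lintegral_mono fun x => ?_
      rw [← enorm_norm a, Real.enorm_eq_ofReal_abs, Real.enorm_eq_ofReal_abs]
      refine ENNReal.ofReal_le_ofReal ((abs_real_inner_le_norm _ _).trans ?_)
      rw [abs_norm]
      exact mul_le_of_le_one_right (norm_nonneg _) (norm_exteriorNormal_le _ _)
    refine this.trans_lt ?_
    rw [setLIntegral_const]
    exact ENNReal.mul_lt_top enorm_lt_top hΩ.boundary_finite
  have hid : Tendsto (fun s : ℝ => s) (𝓝[>] 0) (𝓝 0) := tendsto_id.mono_left nhdsWithin_le_nhds
  have hlin : ∀ c : NNReal, Tendsto (fun s : ℝ => ENNReal.ofReal (c * (s * ‖a‖))) (𝓝[>] 0)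
      (𝓝 0) := by
    intro c
    have : Tendsto (fun s : ℝ => ENNReal.ofReal (c * (s * ‖a‖))) (𝓝[>] 0)
        (𝓝 (ENNReal.ofReal (c * (0 * ‖a‖)))) :=
      ENNReal.tendsto_ofReal (Tendsto.const_mul _ (hid.mul_const _))
    simpa using this
  have hbd : Tendsto (fun s : ℝ => ∫⁻ x in frontier Ω, ‖⟪a, exteriorNormal Ω x⟫‖ₑ *
        ENNReal.ofReal (g x + C' * (s * ‖a‖)) ∂surfaceMeasure (d + 1)) (𝓝[>] 0)
      (𝓝 (∫⁻ x in frontier Ω, ‖⟪a, exteriorNormal Ω x⟫‖ₑ *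
        ENNReal.ofReal (g x) ∂surfaceMeasure (d + 1))) := by
    have h1 : Tendsto (fun s : ℝ => (∫⁻ x in frontier Ω, ‖⟪a, exteriorNormal Ω x⟫‖ₑ *
        ENNReal.ofReal (g x) ∂surfaceMeasure (d + 1)) +
        (∫⁻ x in frontier Ω, ‖⟪a, exteriorNormal Ω x⟫‖ₑ ∂surfaceMeasure (d + 1)) *
        ENNReal.ofReal (C' * (s * ‖a‖))) (𝓝[>] 0)
      (𝓝 ((∫⁻ x in frontier Ω, ‖⟪a, exteriorNormal Ω x⟫‖ₑ *
        ENNReal.ofReal (g x) ∂surfaceMeasure (d + 1)) +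
        (∫⁻ x in frontier Ω, ‖⟪a, exteriorNormal Ω x⟫‖ₑ ∂surfaceMeasure (d + 1)) * 0)) :=
      tendsto_const_nhds.add (ENNReal.Tendsto.const_mul (hlin C') (Or.inr hflux.ne))
    rw [mul_zero, add_zero] at h1
    refine h1.congr' ?_
    filter_upwards [self_mem_nhdsWithin] with s hs
    have hs : 0 < s := hs
    have hgm : Measurable fun x => ENNReal.ofReal (g x) :=
      hC'.continuous.measurable.ennreal_ofReal
    have hprod : AEMeasurable (fun x => ‖⟪a, exteriorNormal Ω x⟫‖ₑ * ENNReal.ofReal (g x))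
        ((surfaceMeasure (d + 1)).restrict (frontier Ω)) := haem.mul hgm.aemeasurable
    rw [← lintegral_mul_const'' _ haem, ← lintegral_add_left' hprod]
    refine lintegral_congr fun x => ?_
    rw [ENNReal.ofReal_add (hg0 x) (by positivity), mul_add]
  have hsc : Tendsto (fun s : ℝ => s * (‖a‖ + 1)) (𝓝[>] 0) (𝓝[>] 0) := by
    refine tendsto_nhdsWithin_iff.2 ⟨?_, ?_⟩
    · simpa using hid.mul_const (‖a‖ + 1)
    · filter_upwards [self_mem_nhdsWithin] with s hs
      have hs : 0 < s := hs
      exact mul_pos hs (by positivity)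
  have hR : Tendsto (fun s : ℝ =>
      ((∑ p ∈ m.crossed a, ENNReal.ofReal ((4 + 2 * (m.crossed a).card) * B) *
        (ENNReal.ofReal ⟪a, m.normal p.1 p.2⟫ *
          surfaceMeasure (d + 1) (m.badSet p.1 p.2 (s * (‖a‖ + 1))))) +
      ENNReal.ofReal ((4 + 2 * (m.crossed a).card) * B) * ρ s +
      (∫⁻ x in frontier Ω, ‖⟪a, exteriorNormal Ω x⟫‖ₑ *
        ENNReal.ofReal (g x + C' * (s * ‖a‖)) ∂surfaceMeasure (d + 1)) +
      ∑ p ∈ m.crossed a, ENNReal.ofReal (C * (s * ‖a‖)) *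
        (ENNReal.ofReal ⟪a, m.normal p.1 p.2⟫ *
          surfaceMeasure (d + 1) (m.interface p.1 p.2)))) (𝓝[>] 0)
      (𝓝 ((∑ p ∈ m.crossed a, ENNReal.ofReal ((4 + 2 * (m.crossed a).card) * B) *
        (ENNReal.ofReal ⟪a, m.normal p.1 p.2⟫ * 0)) +
      ENNReal.ofReal ((4 + 2 * (m.crossed a).card) * B) * 0 +
      (∫⁻ x in frontier Ω, ‖⟪a, exteriorNormal Ω x⟫‖ₑ *
        ENNReal.ofReal (g x) ∂surfaceMeasure (d + 1)) +
      ∑ p ∈ m.crossed a, 0 * (ENNReal.ofReal ⟪a, m.normal p.1 p.2⟫ *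
          surfaceMeasure (d + 1) (m.interface p.1 p.2)))) := by
    refine Tendsto.add (Tendsto.add (Tendsto.add ?_ ?_) hbd) ?_
    · refine tendsto_finsetSum _ fun p hp => ?_
      refine ENNReal.Tendsto.const_mul (ENNReal.Tendsto.const_mul ?_
        (Or.inr ENNReal.ofReal_ne_top)) (Or.inr ENNReal.ofReal_ne_top)
      exact (m.tendsto_badSet hΩ (m.mem_crossed.1 hp).1).comp hsc
    · exact ENNReal.Tendsto.const_mul hρ0 (Or.inr ENNReal.ofReal_ne_top)
    · refine tendsto_finsetSum _ fun p hp => ?_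
      refine ENNReal.Tendsto.mul_const (hlin C) (Or.inr ?_)
      exact (ENNReal.mul_lt_top ENNReal.ofReal_lt_top
        (m.area_lt_top hΩ (m.mem_crossed.1 hp).1)).ne
  -- For each `s`, the integral of the remainder is minus the accounted variation; after division by
  -- `s` the bound of `lintegral_remainder_le` passes to the limit.
  have hfin := le_of_tendsto_of_tendsto hlim2 hR (by
    filter_upwards [self_mem_nhdsWithin] with s hs
    have hs : 0 < s := hs
    have h1 := m.lintegral_remainder_le (a := a) hΩ hs hcont hB0 hB hC hg0 hg hC' hρ
    have h2 := (enorm_integral_le_lintegral_enorm (μ := volume) (m.remainder ψ a s)).trans h1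
    rw [m.integral_remainder hΩ.isOpen hcont hc, enorm_neg] at h2
    simp only [Function.comp]
    rw [← mul_add, enorm_mul]
    have h3 : ‖s⁻¹‖ₑ * ENNReal.ofReal s = 1 := by
      rw [Real.enorm_of_nonneg (by positivity), ← ENNReal.ofReal_mul (by positivity),
        inv_mul_cancel₀ hs.ne', ENNReal.ofReal_one]
    calc _ ≤ _ := mul_le_mul_right h2 ‖s⁻¹‖ₑ
      _ = _ := by rw [← mul_assoc, h3, one_mul])
  simp only [mul_zero, zero_mul, Finset.sum_const_zero, add_zero, zero_add] at hfin
  have hRint : ∫⁻ x in frontier Ω, ‖⟪a, exteriorNormal Ω x⟫‖ₑ *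
        ENNReal.ofReal (g x) ∂surfaceMeasure (d + 1) =
      ∫⁻ x in frontier Ω, ENNReal.ofReal (|⟪a, exteriorNormal Ω x⟫| * g x)
        ∂surfaceMeasure (d + 1) := by
    refine lintegral_congr fun x => ?_
    rw [Real.enorm_eq_ofReal_abs, ENNReal.ofReal_mul (abs_nonneg _)]
  have hgmeas := hC'.continuous.aestronglyMeasurable
    (μ := (surfaceMeasure (d + 1)).restrict (frontier Ω))
  have hmeas : AEStronglyMeasurable (fun x => |⟪a, exteriorNormal Ω x⟫| * g x)
      ((surfaceMeasure (d + 1)).restrict (frontier Ω)) :=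
    (show AEStronglyMeasurable (fun x => |⟪a, exteriorNormal Ω x⟫|) _ from
      (((aemeasurable_const (b := a)).inner (𝕜 := ℝ) hΩ.aemeasurable_exteriorNormal).norm
        ).aestronglyMeasurable).mul hgmeas
  have hnn : ∀ x, 0 ≤ |⟪a, exteriorNormal Ω x⟫| * g x := fun x =>
    mul_nonneg (abs_nonneg _) (hg0 x)
  obtain ⟨Bg, hBg⟩ := hgb
  have hne : ∫⁻ x in frontier Ω, ENNReal.ofReal (|⟪a, exteriorNormal Ω x⟫| * g x)
        ∂surfaceMeasure (d + 1) ≠ ⊤ := by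
    rw [← hRint]
    refine ne_top_of_le_ne_top ?_ (lintegral_mono (g := fun x => ‖⟪a, exteriorNormal Ω x⟫‖ₑ *
      ENNReal.ofReal Bg) fun x => ?_)
    · rw [lintegral_mul_const'' _ haem]
      exact (ENNReal.mul_lt_top hflux ENNReal.ofReal_lt_top).ne
    · exact mul_le_mul_right (ENNReal.ofReal_le_ofReal (hBg ⟨x, rfl⟩)) _
  rw [integral_eq_lintegral_of_nonneg_ae (Eventually.of_forall hnn) hmeas,
    ← ENNReal.ofReal_le_iff_le_toReal hne, ← hRint, ← Real.enorm_eq_ofReal_abs]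
  exact hfin

/-- Each interface is visited from both sides with opposite normals. The orientation with `0 < ⟪a,
n⟫` is kept and the other folded onto it; interfaces parallel to `a` contribute nothing. -/
theorem sum_neighbors_eq_sum_crossed :
    ∑ i, ∑ j ∈ m.neighbors i, ⟪a, m.normal i j⟫ *
      ∫ x in m.interface i j, ψ i x ∂surfaceMeasure (d + 1) =
    -∑ p ∈ m.crossed a, ⟪a, m.normal p.1 p.2⟫ *
        ((∫ x in m.interface p.1 p.2, ψ p.2 x ∂surfaceMeasure (d + 1)) -
          ∫ x in m.interface p.1 p.2, ψ p.1 x ∂surfaceMeasure (d + 1)) := by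
  classical
  set h : Fin m.card × Fin m.card → ℝ := fun p => ⟪a, m.normal p.1 p.2⟫ *
      ∫ x in m.interface p.1 p.2, ψ p.1 x ∂surfaceMeasure (d + 1) with hh
  have h1 : ∑ i, ∑ j ∈ m.neighbors i, ⟪a, m.normal i j⟫ *
      ∫ x in m.interface i j, ψ i x ∂surfaceMeasure (d + 1) =
      ∑ p : Fin m.card × Fin m.card, if m.Adj p.1 p.2 then h p else 0 := by
    rw [Fintype.sum_prod_type]
    refine Finset.sum_congr rfl fun i _ => ?_
    rw [neighbors, Finset.sum_filter]
  have h2 : ∀ p : Fin m.card × Fin m.card, (if m.Adj p.1 p.2 then h p else 0) =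
      (if m.Adj p.1 p.2 ∧ 0 < ⟪a, m.normal p.1 p.2⟫ then h p else 0) +
      (if m.Adj p.swap.1 p.swap.2 ∧ 0 < ⟪a, m.normal p.swap.1 p.swap.2⟫ then h p else 0) := by
    intro p
    have e1 : m.Adj p.swap.1 p.swap.2 ↔ m.Adj p.1 p.2 := m.adj_comm
    have e2 : ⟪a, m.normal p.swap.1 p.swap.2⟫ = -⟪a, m.normal p.1 p.2⟫ := by
      rw [← inner_neg_right, ← m.normal_comm]; rfl
    rw [e1, e2]
    by_cases hadj : m.Adj p.1 p.2
    · rcases lt_trichotomy ⟪a, m.normal p.1 p.2⟫ 0 with hlt | heq | hgt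
      · simp [hadj, hlt, hlt.le]
      · simp [hadj, heq, hh]
      · simp [hadj, hgt, hgt.le]
    · simp [hadj]
  rw [h1, Finset.sum_congr rfl fun p _ => h2 p, Finset.sum_add_distrib,
    ← (Equiv.prodComm (Fin m.card) (Fin m.card)).sum_comp (fun p : Fin m.card × Fin m.card =>
      if m.Adj p.swap.1 p.swap.2 ∧ 0 < ⟪a, m.normal p.swap.1 p.swap.2⟫ then h p else 0)]
  simp only [Equiv.prodComm_apply, Prod.swap_swap]
  rw [← Finset.sum_filter, ← Finset.sum_filter, ← Finset.sum_neg_distrib,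
    ← Finset.sum_add_distrib]
  refine Finset.sum_congr (by ext p; simp [crossed]) fun p _ => ?_
  simp only [hh, Prod.fst_swap, Prod.snd_swap]
  rw [m.normal_comm p.2 p.1, m.interface_comm p.2 p.1, inner_neg_right]
  ring

/-- The Gauss-Green inequality on a mesh, for functions of compact support. -/
theorem abs_gaussGreen_le_of_hasCompactSupport (hΩ : IsRegularDomain Ω)
    (hψ : ∀ i, ContDiff ℝ 1 (ψ i)) (hc : ∀ i, HasCompactSupport (ψ i))
    {g : Space (d + 1) → ℝ} (hg0 : ∀ x, 0 ≤ g x)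
    (hg : ∀ i, ∀ x ∈ m.cell i, |ψ i x| ≤ g x) {C' : NNReal} (hC' : LipschitzWith C' g)
    (hgb : BddAbove (range g)) :
    |∑ i, ((∫ x in m.cell i, fderiv ℝ (ψ i) x a) - ∑ j ∈ m.neighbors i,
      ⟪a, m.normal i j⟫ * ∫ x in m.interface i j, ψ i x ∂surfaceMeasure (d + 1))| ≤
      ∫ x in frontier Ω, |⟪a, exteriorNormal Ω x⟫| * g x ∂surfaceMeasure (d + 1) := by
  rw [Finset.sum_sub_distrib, m.sum_neighbors_eq_sum_crossed, sub_neg_eq_add]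
  exact m.abs_sum_crossed_le hΩ hψ hc hg0 hg hC' hgb

end GaussGreen

end AdmissibleMesh

end ZeroFluxFV

namespace ZeroFluxFV

namespace AdmissibleMesh

/-! ### The Gauss-Green inequality without compact support, and for cellwise constant directions -/

section GaussGreen

variable {d : ℕ} {Ω : Set (Space (d + 1))} (m : AdmissibleMesh Ω)
  {ψ : Fin m.card → Space (d + 1) → ℝ} {a : Space (d + 1)}

/-- The Gauss-Green inequality on a mesh. -/
theorem abs_gaussGreen_le (hΩ : IsRegularDomain Ω) (hψ : ∀ i, ContDiff ℝ 1 (ψ i))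
    {g : Space (d + 1) → ℝ} (hgc : ContDiff ℝ 1 g) (hg0 : ∀ x, 0 ≤ g x)
    (hg : ∀ i, ∀ x ∈ m.cell i, |ψ i x| ≤ g x) :
    |∑ i, ((∫ x in m.cell i, fderiv ℝ (ψ i) x a) - ∑ j ∈ m.neighbors i,
      ⟪a, m.normal i j⟫ * ∫ x in m.interface i j, ψ i x ∂surfaceMeasure (d + 1))| ≤
      ∫ x in frontier Ω, |⟪a, exteriorNormal Ω x⟫| * g x ∂surfaceMeasure (d + 1) := by
  obtain ⟨R, hR0, hR⟩ := hΩ.isBounded.closure.subset_ball_lt 0 (0 : Space (d + 1))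
  -- The cutoff equals 1 on the closure of `Ω`, so it makes the supports compact without changing
  -- any integral.
  let χ : ContDiffBump (0 : Space (d + 1)) := ⟨R, R + 1, hR0, by linarith⟩
  have h1 : ∀ x ∈ closure Ω, χ x = 1 := fun x hx =>
    χ.one_of_mem_closedBall (Metric.ball_subset_closedBall (hR hx))
  have hχc : ContDiff ℝ 1 χ := χ.contDiff
  have hψc : ∀ i, HasCompactSupport fun x => χ x * ψ i x := fun i =>
    χ.hasCompactSupport.mul_right
  have hgs : HasCompactSupport fun x => χ x * g x := χ.hasCompactSupport.mul_right
  have hgc' : ContDiff ℝ 1 fun x => χ x * g x := hχc.mul hgc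
  obtain ⟨C', hC'⟩ := ContDiff.lipschitzWith_of_hasCompactSupport hgs hgc' one_ne_zero
  obtain ⟨b, hb⟩ := hgc'.continuous.bounded_above_of_compact_support hgs
  have h := m.abs_gaussGreen_le_of_hasCompactSupport (a := a)
    (ψ := fun i x => χ x * ψ i x) hΩ (fun i => hχc.mul (hψ i)) hψc
    (fun x => mul_nonneg χ.nonneg (hg0 x)) (fun i x hx => by
      rw [abs_mul, abs_of_nonneg χ.nonneg]
      exact mul_le_mul_of_nonneg_left (hg i x hx) χ.nonneg) hC'
    ⟨b, by rintro _ ⟨x, rfl⟩; exact (le_abs_self _).trans (hb x)⟩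
  have h2 : ∀ i, ∫ x in m.cell i, fderiv ℝ (fun x => χ x * ψ i x) x a =
      ∫ x in m.cell i, fderiv ℝ (ψ i) x a := by
    intro i
    refine setIntegral_congr_fun (m.cell_open i).measurableSet fun x hx => ?_
    have he : (fun x => χ x * ψ i x) =ᶠ[𝓝 x] ψ i := by
      filter_upwards [(m.cell_open i).mem_nhds hx] with y hy
      rw [h1 y (subset_closure (m.cell_subset i hy)), one_mul]
    simp only [he.fderiv_eq]
  have h3 : ∀ i j, ∫ x in m.interface i j, χ x * ψ i x ∂surfaceMeasure (d + 1) =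
      ∫ x in m.interface i j, ψ i x ∂surfaceMeasure (d + 1) := by
    intro i j
    refine setIntegral_congr_fun (m.measurableSet_interface hΩ.isOpen _ _) fun x hx => ?_
    simp only [h1 x (subset_closure hx.2), one_mul]
  have h4 : ∫ x in frontier Ω, |⟪a, exteriorNormal Ω x⟫| * (χ x * g x)
      ∂surfaceMeasure (d + 1) =
      ∫ x in frontier Ω, |⟪a, exteriorNormal Ω x⟫| * g x ∂surfaceMeasure (d + 1) := by
    refine setIntegral_congr_fun isClosed_frontier.measurableSet fun x hx => ?_
    simp only [h1 x (frontier_subset_closure hx), one_mul]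
  simp only [h2, h3, h4] at h
  exact h

theorem integrableOn_frontier (hΩ : IsRegularDomain Ω) (a : Space (d + 1))
    {g : Space (d + 1) → ℝ} (hgc : Continuous g) :
    IntegrableOn (fun x => |⟪a, exteriorNormal Ω x⟫| * g x) (frontier Ω)
      (surfaceMeasure (d + 1)) := by
  have hK : IsCompact (frontier Ω) := Metric.isCompact_of_isClosed_isBounded isClosed_frontier
      (hΩ.isBounded.closure.subset frontier_subset_closure)
  obtain ⟨b, hb⟩ := hK.exists_bound_of_continuousOn hgc.continuousOn
  have : IsFiniteMeasure ((surfaceMeasure (d + 1)).restrict (frontier Ω)) :=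
    ⟨by rw [Measure.restrict_apply_univ]; exact hΩ.boundary_finite⟩
  refine Integrable.of_bound (C := ‖a‖ * b)
    ((show AEStronglyMeasurable (fun x => |⟪a, exteriorNormal Ω x⟫|) _ from
      (((aemeasurable_const (b := a)).inner (𝕜 := ℝ) hΩ.aemeasurable_exteriorNormal).norm
        ).aestronglyMeasurable).mul hgc.aestronglyMeasurable) ?_
  filter_upwards [ae_restrict_mem isClosed_frontier.measurableSet] with x hx
  rw [norm_mul, Real.norm_eq_abs, abs_abs]
  refine mul_le_mul ((abs_real_inner_le_norm _ _).trans ?_) (hb x hx) (norm_nonneg _)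
    (norm_nonneg _)
  exact mul_le_of_le_one_right (norm_nonneg _) (norm_exteriorNormal_le _ _)

theorem setIntegral_frontier_le (hΩ : IsRegularDomain Ω) (a : Space (d + 1)) :
    ∫ x in frontier Ω, |⟪a, exteriorNormal Ω x⟫| ∂surfaceMeasure (d + 1) ≤
      ‖a‖ * (surfaceMeasure (d + 1)).real (frontier Ω) := by
  have h := norm_setIntegral_le_of_norm_le_const (μ := surfaceMeasure (d + 1)) (s := frontier Ω)
    (f := fun x => |⟪a, exteriorNormal Ω x⟫|) (C := ‖a‖) hΩ.boundary_finite (fun x _ => by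
      rw [Real.norm_eq_abs, abs_abs]
      refine (abs_real_inner_le_norm _ _).trans ?_
      exact mul_le_of_le_one_right (norm_nonneg _) (norm_exteriorNormal_le _ _))
  exact (le_abs_self _).trans h

/-- The Gauss-Green inequality on a mesh for a vector field whose direction is constant in each
control volume. -/
theorem abs_sum_gaussGreen_le (hΩ : IsRegularDomain Ω) (hψ : ∀ i, ContDiff ℝ 1 (ψ i))
    {w : Fin m.card → Space (d + 1)} {W G : ℝ} (hG0 : 0 ≤ G) (hW0 : 0 ≤ W)
    (hG : ∀ i, ∀ x ∈ m.cell i, |ψ i x| ≤ G) (hW : ∀ i, ‖w i‖ ≤ W) :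
    |∑ i, ((∫ x in m.cell i, fderiv ℝ (ψ i) x (w i)) - ∑ j ∈ m.neighbors i,
      ⟪w i, m.normal i j⟫ * ∫ x in m.interface i j, ψ i x ∂surfaceMeasure (d + 1))| ≤
      (d + 1 : ℕ) * (W * G * (surfaceMeasure (d + 1)).real (frontier Ω)) := by
  set e : Fin (d + 1) → Space (d + 1) := fun l => EuclideanSpace.single l 1
  have he : ∀ l, ‖e l‖ = 1 := fun l => by simp [e]
  -- The inequality above needs one direction for the whole mesh. Coordinate by coordinate, the
  -- varying coefficient `w i l` is absorbed into the function on `cell i`; the price is the factor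
  -- `d + 1`.
  have hdec : ∀ i, w i = ∑ l, w i l • e l := by
    intro i
    ext l
    simp [e, Finset.sum_apply, Pi.single_apply]
  have hbd : ∀ i, Bornology.IsBounded (m.cell i) := fun i => m.isBounded_cell hΩ i
  have hint : ∀ i (b : Space (d + 1)), IntegrableOn (fun x => fderiv ℝ (ψ i) x b) (m.cell i) := by
    intro i b
    have hc : Continuous fun x => fderiv ℝ (ψ i) x b :=
      ((hψ i).continuous_fderiv one_ne_zero).clm_apply continuous_const
    exact (hc.continuousOn.integrableOn_compact (hbd i).isCompact_closure).mono_set subset_closure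
  have hl : ∀ l, |∑ i, ((∫ x in m.cell i, fderiv ℝ (fun x => w i l * ψ i x) x (e l)) -
      ∑ j ∈ m.neighbors i, ⟪e l, m.normal i j⟫ *
        ∫ x in m.interface i j, w i l * ψ i x ∂surfaceMeasure (d + 1))| ≤
      W * G * (surfaceMeasure (d + 1)).real (frontier Ω) := by
    intro l
    refine (m.abs_gaussGreen_le (ψ := fun i x => w i l * ψ i x) (g := fun _ => W * G) hΩ
      (fun i => contDiff_const.mul (hψ i)) contDiff_const (fun _ => by positivity)
      (fun i x hx => ?_)).trans ?_
    · rw [abs_mul]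
      refine mul_le_mul ?_ (hG i x hx) (abs_nonneg _) hW0
      rw [← Real.norm_eq_abs]
      exact (PiLp.norm_apply_le (w i) l).trans (hW i)
    · rw [integral_mul_const]
      have h := setIntegral_frontier_le hΩ (e l)
      rw [he, one_mul] at h
      rw [mul_comm]
      exact mul_le_mul_of_nonneg_left h (by positivity)
  have hsum : ∑ i, ((∫ x in m.cell i, fderiv ℝ (ψ i) x (w i)) - ∑ j ∈ m.neighbors i,
      ⟪w i, m.normal i j⟫ * ∫ x in m.interface i j, ψ i x ∂surfaceMeasure (d + 1)) =
      ∑ l, ∑ i, ((∫ x in m.cell i, fderiv ℝ (fun x => w i l * ψ i x) x (e l)) -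
      ∑ j ∈ m.neighbors i, ⟪e l, m.normal i j⟫ *
        ∫ x in m.interface i j, w i l * ψ i x ∂surfaceMeasure (d + 1)) := by
    rw [Finset.sum_comm]
    refine Finset.sum_congr rfl fun i _ => ?_
    rw [Finset.sum_sub_distrib]
    congr 1
    · have h1 : ∀ x, fderiv ℝ (ψ i) x (w i) =
          ∑ l, fderiv ℝ (fun x => w i l * ψ i x) x (e l) := by
        intro x
        conv_lhs => rw [hdec i]
        rw [map_sum]
        refine Finset.sum_congr rfl fun l _ => ?_
        rw [fderiv_const_mul (((hψ i).differentiable one_ne_zero) x)]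
        simp
      simp_rw [h1]
      refine integral_finsetSum _ fun l _ => ?_
      have h2 : ∀ x, fderiv ℝ (fun x => w i l * ψ i x) x (e l) =
          w i l * fderiv ℝ (ψ i) x (e l) := by
        intro x
        rw [fderiv_const_mul (((hψ i).differentiable one_ne_zero) x)]
        simp
      simp_rw [h2]
      exact (hint i _).const_mul _
    · rw [Finset.sum_comm]
      refine Finset.sum_congr rfl fun j _ => ?_
      conv_lhs => rw [hdec i]
      rw [sum_inner, Finset.sum_mul]
      refine Finset.sum_congr rfl fun l _ => ?_
      rw [integral_const_mul, real_inner_smul_left]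
      ring
  rw [hsum]
  refine (Finset.abs_sum_le_sum_abs _ _).trans ?_
  refine (Finset.sum_le_sum fun l _ => hl l).trans ?_
  simp

end GaussGreen

/-! ### Sums over the inner interfaces -/

section Sums

variable {ℓ : ℕ} {Ω : Set (Space ℓ)} (m : AdmissibleMesh Ω)

/-- The sum over the inner interfaces, each one counted once from each side. -/
noncomputable def interfaceSum (h : Fin m.card → Fin m.card → ℝ) : ℝ := ∑ i, ∑ j ∈ m.neighbors i, h i j

variable {m} {h h' : Fin m.card → Fin m.card → ℝ}

theorem interfaceSum_congr (hh : ∀ i j, m.Adj i j → h i j = h' i j) :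
    m.interfaceSum h = m.interfaceSum h' :=
  Finset.sum_congr rfl fun i _ => Finset.sum_congr rfl fun j hj => hh i j (m.mem_neighbors.1 hj)

theorem interfaceSum_mono (hh : ∀ i j, m.Adj i j → h i j ≤ h' i j) :
    m.interfaceSum h ≤ m.interfaceSum h' :=
  Finset.sum_le_sum fun i _ => Finset.sum_le_sum fun j hj => hh i j (m.mem_neighbors.1 hj)

theorem interfaceSum_nonneg (hh : ∀ i j, m.Adj i j → 0 ≤ h i j) : 0 ≤ m.interfaceSum h :=
  Finset.sum_nonneg fun i _ => Finset.sum_nonneg fun j hj => hh i j (m.mem_neighbors.1 hj)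

theorem interfaceSum_add : m.interfaceSum (fun i j => h i j + h' i j) =
    m.interfaceSum h + m.interfaceSum h' := by
  simp only [interfaceSum, Finset.sum_add_distrib]

theorem interfaceSum_sub : m.interfaceSum (fun i j => h i j - h' i j) =
    m.interfaceSum h - m.interfaceSum h' := by
  simp only [interfaceSum, Finset.sum_sub_distrib]

theorem interfaceSum_const_mul (c : ℝ) : m.interfaceSum (fun i j => c * h i j) =
    c * m.interfaceSum h := by
  simp only [interfaceSum, Finset.mul_sum]

theorem interfaceSum_swap : m.interfaceSum (fun i j => h j i) = m.interfaceSum h := by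
  classical
  simp only [interfaceSum, neighbors, Finset.sum_filter]
  rw [Finset.sum_comm]
  simp only [m.adj_comm]

/-- Summation by parts: only the antisymmetric part of the weights matters for an antisymmetric
flux. -/
theorem interfaceSum_eq_zero (hh : ∀ i j, m.Adj i j → h i j = -h j i) :
    m.interfaceSum h = 0 := by
  have h1 : m.interfaceSum h = m.interfaceSum fun i j => (-1) * h j i :=
    interfaceSum_congr fun i j hij => by rw [hh i j hij]; ring
  have h2 : m.interfaceSum (fun i j => h j i) = m.interfaceSum h := interfaceSum_swap
  rw [interfaceSum_const_mul, h2] at h1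
  linarith

theorem abs_interfaceSum_le : |m.interfaceSum h| ≤ m.interfaceSum fun i j => |h i j| :=
  (Finset.abs_sum_le_sum_abs _ _).trans
    (Finset.sum_le_sum fun _ _ => Finset.abs_sum_le_sum_abs _ _)

theorem sum_mul_sum_neighbors (c : Fin m.card → ℝ) :
    ∑ i, c i * ∑ j ∈ m.neighbors i, h i j = m.interfaceSum fun i j => c i * h i j := by
  simp only [interfaceSum, Finset.mul_sum]

end Sums

end AdmissibleMesh

end ZeroFluxFV

namespace ZeroFluxFV

/-! ### Monotone numerical fluxes -/

section NumericalFlux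

variable {F : ℝ → ℝ → ℝ} {L a b p q k : ℝ}

/-- The dissipation of a numerical flux between two states. -/
noncomputable def fluxDissipation (F : ℝ → ℝ → ℝ) (a b : ℝ) : ℝ := ∫ s in a..b, (F s s - F a b)

/-- The numerical flux of the Kruzhkov entropy `|· - k|`. -/
def entropyFlux (F : ℝ → ℝ → ℝ) (k a b : ℝ) : ℝ :=
  F (max a k) (max b k) - F (min a k) (min b k)

theorem continuous_diagonal (hL : ∀ a b a' b', |F a b - F a' b'| ≤ L * (|a - a'| + |b - b'|)) :
    Continuous fun s => F s s := by
  have hL0 : 0 ≤ L := by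
    have := (abs_nonneg _).trans (hL 1 0 0 0)
    simpa using this
  refine (LipschitzWith.of_dist_le_mul (K := ⟨2 * L, by positivity⟩) fun s t => ?_).continuous
  have h := hL s s t t
  rw [Real.dist_eq, Real.dist_eq]
  refine h.trans (le_of_eq ?_)
  change _ = 2 * L * _
  ring

/-- The reflection that sends `F` to `-F(-·, -·)` preserves the monotonicity of the flux and
reverses the order of the states, which leaves only `a ≤ b` to be treated. -/
theorem fluxDissipation_neg (F : ℝ → ℝ → ℝ) (a b : ℝ) :
    fluxDissipation (fun x y => -F (-x) (-y)) (-a) (-b) = fluxDissipation F a b := by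
  have h := intervalIntegral.integral_comp_neg (a := -a) (b := -b) (fun s => F a b - F s s)
  simp only [fluxDissipation, neg_neg] at *
  have h1 : ∀ x, -F (-x) (-x) - -F a b = F a b - F (-x) (-x) := fun x => by ring
  simp_rw [h1]
  rw [h, intervalIntegral.integral_symm, ← intervalIntegral.integral_neg]
  simp

/-- For `a ≤ s ≤ b`, monotonicity gives `F a b ≤ F a s ≤ F s s`. -/
theorem fluxDissipation_nonneg_of_le (hl : ∀ b, Monotone fun a => F a b)
    (hr : ∀ a, Antitone fun b => F a b) (hab : a ≤ b) : 0 ≤ fluxDissipation F a b := by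
  refine intervalIntegral.integral_nonneg hab fun s hs => ?_
  have h1 := hl s hs.1
  have h2 := hr a hs.2
  simp only at h1 h2
  linarith

theorem monotone_reflect (hl : ∀ b, Monotone fun a => F a b) (b : ℝ) :
    Monotone fun a => -F (-a) (-b) := fun _ _ h => neg_le_neg (hl (-b) (neg_le_neg h))

theorem antitone_reflect (hr : ∀ a, Antitone fun b => F a b) (a : ℝ) :
    Antitone fun b => -F (-a) (-b) := fun _ _ h => neg_le_neg (hr (-a) (neg_le_neg h))

theorem fluxDissipation_nonneg (hl : ∀ b, Monotone fun a => F a b)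
    (hr : ∀ a, Antitone fun b => F a b) (a b : ℝ) : 0 ≤ fluxDissipation F a b := by
  rcases le_total a b with h | h
  · exact fluxDissipation_nonneg_of_le hl hr h
  · rw [← fluxDissipation_neg]
    exact fluxDissipation_nonneg_of_le (monotone_reflect hl) (antitone_reflect hr)
      (neg_le_neg h)

/-- On `[p, p + r]` the integrand satisfies `F s s - F a b ≥ F p s - F p q ≥ D - L * (s - p)`. With
`r = D / (2 * L)` this is at least `D / 2`, so the dissipation is at least `D ^ 2 / (4 * L)`. The
interval is within `[p, q]` because `D ≤ L * (q - p)`. -/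
theorem sq_flux_sub_le_of_le (hl : ∀ b, Monotone fun a => F a b)
    (hr : ∀ a, Antitone fun b => F a b)
    (hL : ∀ a b a' b', |F a b - F a' b'| ≤ L * (|a - a'| + |b - b'|))
    (hap : a ≤ p) (hpq : p ≤ q) (hqb : q ≤ b) :
    (F p p - F p q) ^ 2 ≤ 4 * L * fluxDissipation F a b := by
  set D := F p p - F p q with hD
  have hD0 : 0 ≤ D := sub_nonneg.2 (hr p hpq)
  have hDL : D ≤ L * (q - p) := by
    have h := hL p p p q
    rw [sub_self, abs_zero, zero_add, abs_sub_comm p q, abs_of_nonneg (sub_nonneg.2 hpq)] at h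
    exact (le_abs_self _).trans h
  rcases hD0.eq_or_lt with h0 | h0
  · rw [← h0]
    have hL0 : 0 ≤ L := by
      have := (abs_nonneg _).trans (hL 1 0 0 0)
      simpa using this
    have := fluxDissipation_nonneg_of_le hl hr (hap.trans (hpq.trans hqb))
    simp only [ne_eq, OfNat.ofNat_ne_zero, not_false_eq_true, zero_pow]
    positivity
  have hL0 : 0 < L := by
    by_contra hneg
    push Not at hneg
    nlinarith [mul_nonneg (neg_nonneg.2 hneg) (sub_nonneg.2 hpq)]
  set r := D / (2 * L) with hr'
  have hr0 : 0 < r := by positivity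
  have hLr : L * r = D / 2 := by rw [hr']; field_simp
  have hrq : p + r ≤ q := by
    have : L * r ≤ L * (q - p) := by linarith
    have := le_of_mul_le_mul_left this hL0
    linarith
  have hab : a ≤ b := hap.trans (hpq.trans hqb)
  have hcont : Continuous fun s => F s s - F a b := (continuous_diagonal hL).sub continuous_const
  have h1 : ∫ s in p..(p + r), (F s s - F a b) ≤ fluxDissipation F a b := by
    refine intervalIntegral.integral_mono_interval hap (by linarith) (by linarith) ?_
      (hcont.intervalIntegrable _ _)
    filter_upwards [ae_restrict_mem measurableSet_Ioc] with s hs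
    have h1 := hl s hs.1.le
    have h2 := hr a hs.2
    simp only [Pi.zero_apply] at h1 h2 ⊢
    linarith
  have h2 : ∫ s in p..(p + r), (D / 2) ≤ ∫ s in p..(p + r), (F s s - F a b) := by
    refine intervalIntegral.integral_mono_on (by linarith) (by simp)
      (hcont.intervalIntegrable _ _) fun s hs => ?_
    have e1 : F p s ≤ F s s := hl s hs.1
    have e2 : F a b ≤ F p b := hl b hap
    have e3 : F p b ≤ F p q := hr p hqb
    have e4 := (le_abs_self _).trans (hL p p p s)
    rw [sub_self, abs_zero, zero_add, abs_sub_comm p s, abs_of_nonneg (sub_nonneg.2 hs.1)] at e4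
    have e5 : L * (s - p) ≤ L * r := mul_le_mul_of_nonneg_left (by linarith [hs.2]) hL0.le
    linarith
  rw [intervalIntegral.integral_const, add_sub_cancel_left, smul_eq_mul] at h2
  have h3 : r * (D / 2) ≤ fluxDissipation F a b := h2.trans h1
  have h4 : D ^ 2 = 4 * L * (r * (D / 2)) := by
    rw [show 4 * L * (r * (D / 2)) = 2 * (L * r) * D by ring, hLr]; ring
  rw [h4]
  exact mul_le_mul_of_nonneg_left h3 (by positivity)

/-- The weak `BV` inequality: the dissipation controls the variation of a monotone flux. -/
theorem sq_flux_sub_le (hl : ∀ b, Monotone fun a => F a b) (hr : ∀ a, Antitone fun b => F a b)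
    (hL : ∀ a b a' b', |F a b - F a' b'| ≤ L * (|a - a'| + |b - b'|))
    (h : a ≤ p ∧ p ≤ q ∧ q ≤ b ∨ b ≤ q ∧ q ≤ p ∧ p ≤ a) :
    (F p p - F p q) ^ 2 ≤ 4 * L * fluxDissipation F a b := by
  rcases h with ⟨h1, h2, h3⟩ | ⟨h1, h2, h3⟩
  · exact sq_flux_sub_le_of_le hl hr hL h1 h2 h3
  · rw [← fluxDissipation_neg]
    have h := sq_flux_sub_le_of_le (L := L) (monotone_reflect hl) (antitone_reflect hr)
      (fun a b a' b' => ?_) (neg_le_neg h3) (neg_le_neg h2) (neg_le_neg h1)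
    · simp only [neg_neg] at h
      refine le_trans (le_of_eq ?_) h
      ring
    · have h := hL (-a) (-b) (-a') (-b')
      rw [← abs_neg]
      refine le_trans (le_of_eq (by congr 1; ring)) (h.trans (le_of_eq ?_))
      rw [← abs_neg (-a - -a'), ← abs_neg (-b - -b')]
      congr 3 <;> ring_nf

theorem entropyFlux_self (F : ℝ → ℝ → ℝ) (k a : ℝ) :
    entropyFlux F k a a = Real.sign (a - k) * (F a a - F k k) := by
  rcases lt_trichotomy a k with h | h | h
  · rw [entropyFlux, max_eq_right h.le, min_eq_left h.le, Real.sign_of_neg (sub_neg.2 h)]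
    ring
  · simp [entropyFlux, h]
  · rw [entropyFlux, max_eq_left h.le, min_eq_right h.le, Real.sign_of_pos (sub_pos.2 h)]
    ring

/-- Replacing `max b k` and `min b k` by `b` or `k` in the second argument moves the flux in a known
direction. For `a = k` the signs vanish and the entropy flux is itself nonpositive. -/
theorem entropyFlux_le (hr : ∀ a, Antitone fun b => F a b)
    (k a b : ℝ) :
    entropyFlux F k a b + Real.sign (a - k) * F k k ≤ Real.sign (a - k) * F a b := by
  have h1 : F a (max b k) ≤ F a b := hr a (le_max_left _ _)
  have h2 : F a b ≤ F a (min b k) := hr a (min_le_left _ _)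
  have h3 : F k (max b k) ≤ F k k := hr k (le_max_right _ _)
  have h4 : F k k ≤ F k (min b k) := hr k (min_le_right _ _)
  rcases lt_trichotomy a k with h | h | h
  · rw [entropyFlux, max_eq_right h.le, min_eq_left h.le, Real.sign_of_neg (sub_neg.2 h)]
    linarith
  · subst h
    simp only [entropyFlux, max_self, min_self, sub_self, Real.sign_zero, zero_mul, add_zero]
    linarith
  · rw [entropyFlux, max_eq_left h.le, min_eq_right h.le, Real.sign_of_pos (sub_pos.2 h)]
    linarith

/-- The difference splits into the flux increments from `max a k` to `max b k` and from `min a k` to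
`min b k`. Each pair either coincides or lies between `a` and `b` in the same order, so
`sq_flux_sub_le` applies; `(x - y) ^ 2 ≤ 2 * x ^ 2 + 2 * y ^ 2` turns 4 into 16. -/
theorem sq_entropyFlux_sub_le (hl : ∀ b, Monotone fun a => F a b)
    (hr : ∀ a, Antitone fun b => F a b)
    (hL : ∀ a b a' b', |F a b - F a' b'| ≤ L * (|a - a'| + |b - b'|)) (k a b : ℝ) :
    (entropyFlux F k a a - entropyFlux F k a b) ^ 2 ≤ 16 * L * fluxDissipation F a b := by
  have h1 := sq_flux_sub_le (p := max a k) (q := max b k) (a := a) (b := b) hl hr hL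
  have h2 := sq_flux_sub_le (p := min a k) (q := min b k) (a := a) (b := b) hl hr hL
  have hL0 : 0 ≤ L := by
    have := (abs_nonneg _).trans (hL 1 0 0 0)
    simpa using this
  have hE := fluxDissipation_nonneg hl hr a b
  have key : (F (max a k) (max a k) - F (max a k) (max b k)) ^ 2 ≤
        4 * L * fluxDissipation F a b ∧
      (F (min a k) (min a k) - F (min a k) (min b k)) ^ 2 ≤ 4 * L * fluxDissipation F a b := by
    have h0 : 0 ≤ 4 * L * fluxDissipation F a b := by positivity
    rcases le_total a k with ha | ha <;> rcases le_total b k with hb | hb <;>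
      rcases le_total a b with hab | hab <;>
      simp only [max_eq_left, max_eq_right, min_eq_left, min_eq_right, ha, hb, hab, le_refl,
        true_and, and_true, true_or, or_true, forall_const, sub_self, ne_eq, OfNat.ofNat_ne_zero,
        not_false_eq_true, zero_pow] at h1 h2 ⊢ <;>
      first
        | exact ⟨h0, h2⟩
        | exact ⟨h1, h0⟩
        | exact ⟨h1, h2⟩
  obtain ⟨k1, k2⟩ := key
  have e : entropyFlux F k a a - entropyFlux F k a b =
      (F (max a k) (max a k) - F (max a k) (max b k)) -
      (F (min a k) (min a k) - F (min a k) (min b k)) := by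
    simp only [entropyFlux]; ring
  rw [e]
  nlinarith [sq_nonneg ((F (max a k) (max a k) - F (max a k) (max b k)) +
      (F (min a k) (min a k) - F (min a k) (min b k)))]

end NumericalFlux

end ZeroFluxFV

/-! ### One time step of the scheme: maximum principle, entropy and energy inequalities -/

namespace ZeroFluxFV

namespace AdmissibleMesh

variable {ℓ : ℕ} {Ω : Set (Space ℓ)} {m : AdmissibleMesh Ω} {h : Fin m.card → Fin m.card → ℝ}

theorem interfaceSum_mul_eq (hh : ∀ i j, m.Adj i j → h i j = -h j i) (c : Fin m.card → ℝ) :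
    m.interfaceSum (fun i j => c i * h i j) =
      1 / 2 * m.interfaceSum fun i j => (c i - c j) * h i j := by
  have h1 : m.interfaceSum (fun i j => (c i - c j) * h i j) =
      m.interfaceSum (fun i j => c i * h i j + c j * h j i) :=
    interfaceSum_congr fun i j hij => by rw [hh i j hij]; ring
  have h2 : m.interfaceSum (fun i j => c j * h j i) = m.interfaceSum fun i j => c i * h i j :=
    interfaceSum_swap (h := fun i j => c i * h i j)
  rw [h1, interfaceSum_add, h2]
  ring

end AdmissibleMesh

namespace Discretization

open AdmissibleMesh

section Step

variable {ℓ : ℕ} {Ω : Set (Space ℓ)} {f : ℝ → Space ℓ} (D : Discretization Ω f)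
  {φ : ℝ → ℝ} {U V : Fin D.mesh.card → ℝ}

/-- The total flux through an inner interface. -/
noncomputable def totalFlux (φ : ℝ → ℝ) (U : Fin D.mesh.card → ℝ) (i j : Fin D.mesh.card) : ℝ :=
  D.flux i j (U i) (U j) - D.mesh.transmissivity i j * (φ (U j) - φ (U i))

/-- One time step of the scheme, from `V` to `U`. -/
def IsStep (φ : ℝ → ℝ) (V U : Fin D.mesh.card → ℝ) : Prop :=
  ∀ i, volume.real (D.mesh.cell i) * ((U i - V i) / D.dt) +
    ∑ j ∈ D.mesh.neighbors i, D.totalFlux φ U i j = 0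

/-- The dissipation of the scheme. -/
noncomputable def dissipation (φ : ℝ → ℝ) (U : Fin D.mesh.card → ℝ) : ℝ :=
  1 / 2 * D.mesh.interfaceSum fun i j => fluxDissipation (D.flux i j) (U i) (U j) +
    D.mesh.transmissivity i j * (φ (U j) - φ (U i)) * (U j - U i)

theorem totalFlux_antisymm {i j : Fin D.mesh.card} (hij : D.mesh.Adj i j) :
    D.totalFlux φ U i j = -D.totalFlux φ U j i := by
  rw [totalFlux, totalFlux, D.conservative i j hij, D.mesh.transmissivity_comm i j]
  ring

/-- At a zero of `f` the flux vanishes on the diagonal, so `0 = F b b ≤ F (U i) b ≤ F (U i) (U j)`;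
the diffusive flux also goes from the larger to the smaller value. -/
theorem totalFlux_nonneg (hφ : Monotone φ) {b : ℝ} (hb : f b = 0) {i j : Fin D.mesh.card}
    (hij : D.mesh.Adj i j) (hi : b ≤ U i) (hj : U j ≤ b) : 0 ≤ D.totalFlux φ U i j := by
  have h1 := D.consistent i j hij b
  rw [hb, inner_zero_left, mul_zero] at h1
  have h2 : D.flux i j b b ≤ D.flux i j (U i) b := D.monotone_left i j hij b hi
  have h3 : D.flux i j (U i) b ≤ D.flux i j (U i) (U j) := D.antitone_right i j hij _ hj
  have h4 := mul_nonneg (D.mesh.transmissivity_nonneg i j) (sub_nonneg.2 (hφ (hj.trans hi)))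
  rw [totalFlux]
  linarith

variable {D} in
theorem IsStep.sum_mul_eq (hs : D.IsStep φ V U) (c : Fin D.mesh.card → ℝ) :
    ∑ i, c i * (volume.real (D.mesh.cell i) * ((U i - V i) / D.dt)) =
      -D.mesh.interfaceSum fun i j => c i * D.totalFlux φ U i j := by
  rw [← sum_mul_sum_neighbors, ← Finset.sum_neg_distrib]
  refine Finset.sum_congr rfl fun i _ => ?_
  have h := hs i
  rw [eq_neg_of_add_eq_zero_left h]
  ring

variable {D} in
theorem IsStep.sum_mul_nonpos (hs : D.IsStep φ V U) (c : Fin D.mesh.card → ℝ)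
    (hc : ∀ i j, D.mesh.Adj i j → 0 ≤ (c i - c j) * D.totalFlux φ U i j) :
    ∑ i, c i * (volume.real (D.mesh.cell i) * ((U i - V i) / D.dt)) ≤ 0 := by
  rw [hs.sum_mul_eq, interfaceSum_mul_eq (fun i j hij => D.totalFlux_antisymm hij)]
  have := interfaceSum_nonneg hc
  linarith

variable {D} in
/-- The maximum principle for the scheme. -/
theorem IsStep.mem_Icc (hvol : ∀ i, 0 < volume.real (D.mesh.cell i)) (hs : D.IsStep φ V U)
    (hφ : Monotone φ) {a b : ℝ} (ha : f a = 0) (hb : f b = 0) (hV : ∀ i, V i ∈ Icc a b) (i) :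
    U i ∈ Icc a b := by
  have hpos : ∀ i, 0 < volume.real (D.mesh.cell i) / D.dt := fun i => div_pos (hvol i) D.dt_pos
  constructor
  · by_contra hi
    -- Test with minus the indicator of the violating control volumes: the flux between them and the
    -- others has a sign by `totalFlux_nonneg`, so the sum is nonpositive, whereas its time part
    -- would be positive.
    have hsum := hs.sum_mul_nonpos (c := fun i => if U i < a then -1 else 0) ?_
    · refine absurd hsum (not_le.2 (Finset.sum_pos' (fun p _ => ?_) ⟨i, Finset.mem_univ i, ?_⟩))
      · split_ifs with hp
        · have := mul_pos (hpos p) (sub_pos.2 (hp.trans_le (hV p).1))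
          have e : -1 * (volume.real (D.mesh.cell p) * ((U p - V p) / D.dt)) =
            volume.real (D.mesh.cell p) / D.dt * (V p - U p) := by ring
          rw [e]
          exact this.le
        · simp
      · rw [if_pos (not_le.1 hi)]
        have := mul_pos (hpos i) (sub_pos.2 ((not_le.1 hi).trans_le (hV i).1))
        have e : -1 * (volume.real (D.mesh.cell i) * ((U i - V i) / D.dt)) =
          volume.real (D.mesh.cell i) / D.dt * (V i - U i) := by ring
        rwa [e]
    · intro p q hpq
      split_ifs with hp hq hq
      · simp
      · have := D.totalFlux_nonneg (U := U) hφ ha (D.mesh.adj_comm.1 hpq) (not_lt.1 hq) hp.le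
        rw [D.totalFlux_antisymm hpq]
        linarith
      · have := D.totalFlux_nonneg (U := U) hφ ha hpq (not_lt.1 hp) hq.le
        linarith
      · simp
  · by_contra hi
    have hsum := hs.sum_mul_nonpos (c := fun i => if b < U i then 1 else 0) ?_
    · refine absurd hsum (not_le.2 (Finset.sum_pos' (fun p _ => ?_) ⟨i, Finset.mem_univ i, ?_⟩))
      · split_ifs with hp
        · have := mul_pos (hpos p) (sub_pos.2 ((hV p).2.trans_lt hp))
          have e : 1 * (volume.real (D.mesh.cell p) * ((U p - V p) / D.dt)) =
            volume.real (D.mesh.cell p) / D.dt * (U p - V p) := by ring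
          rw [e]
          exact this.le
        · simp
      · rw [if_pos (not_le.1 hi)]
        have := mul_pos (hpos i) (sub_pos.2 ((hV i).2.trans_lt (not_le.1 hi)))
        have e : 1 * (volume.real (D.mesh.cell i) * ((U i - V i) / D.dt)) =
          volume.real (D.mesh.cell i) / D.dt * (U i - V i) := by ring
        rwa [e]
    · intro p q hpq
      split_ifs with hp hq hq
      · simp
      · have := D.totalFlux_nonneg (U := U) hφ hb hpq hp.le (not_lt.1 hq)
        linarith
      · have := D.totalFlux_nonneg (U := U) hφ hb (D.mesh.adj_comm.1 hpq) hq.le (not_lt.1 hp)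
        rw [D.totalFlux_antisymm hpq]
        linarith
      · simp

theorem fluxDissipation_nonneg (U : Fin D.mesh.card → ℝ) {i j : Fin D.mesh.card}
    (hij : D.mesh.Adj i j) : 0 ≤ fluxDissipation (D.flux i j) (U i) (U j) :=
  ZeroFluxFV.fluxDissipation_nonneg (D.monotone_left i j hij) (D.antitone_right i j hij) _ _

theorem diffusion_nonneg (hφ : Monotone φ) (U : Fin D.mesh.card → ℝ) (i j : Fin D.mesh.card) :
    0 ≤ D.mesh.transmissivity i j * (φ (U j) - φ (U i)) * (U j - U i) := by
  rw [mul_assoc]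
  refine mul_nonneg (D.mesh.transmissivity_nonneg i j) ?_
  rcases le_total (U i) (U j) with h | h
  · exact mul_nonneg (sub_nonneg.2 (hφ h)) (sub_nonneg.2 h)
  · exact mul_nonneg_of_nonpos_of_nonpos (sub_nonpos.2 (hφ h)) (sub_nonpos.2 h)

theorem dissipation_nonneg (hφ : Monotone φ) (U : Fin D.mesh.card → ℝ) :
    0 ≤ D.dissipation φ U :=
  mul_nonneg (by norm_num) (interfaceSum_nonneg fun i j hij =>
    add_nonneg (D.fluxDissipation_nonneg U hij) (D.diffusion_nonneg hφ U i j))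

theorem interfaceSum_fluxDissipation_le (hφ : Monotone φ) (U : Fin D.mesh.card → ℝ) :
    (D.mesh.interfaceSum fun i j => fluxDissipation (D.flux i j) (U i) (U j)) ≤
      2 * D.dissipation φ U := by
  rw [dissipation, ← mul_assoc, mul_one_div_cancel two_ne_zero, one_mul]
  exact interfaceSum_mono fun i j _ => le_add_of_nonneg_right (D.diffusion_nonneg hφ U i j)

theorem interfaceSum_diffusion_le (φ : ℝ → ℝ) (U : Fin D.mesh.card → ℝ) :
    (D.mesh.interfaceSum fun i j =>
      D.mesh.transmissivity i j * (φ (U j) - φ (U i)) * (U j - U i)) ≤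
      2 * D.dissipation φ U := by
  rw [dissipation, ← mul_assoc, mul_one_div_cancel two_ne_zero, one_mul]
  exact interfaceSum_mono fun i j hij => le_add_of_nonneg_left (D.fluxDissipation_nonneg U hij)

variable {D} in
/-- The discrete entropy inequality, tested with nonnegative weights. -/
theorem IsStep.entropy_le (hs : D.IsStep φ V U) (k : ℝ) {c : Fin D.mesh.card → ℝ}
    (hc : ∀ i, 0 ≤ c i) :
    ∑ i, c i * (volume.real (D.mesh.cell i) * ((|U i - k| - |V i - k|) / D.dt)) ≤
      -D.mesh.interfaceSum fun i j => c i * (Real.sign (U i - k) * D.totalFlux φ U i j) := by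
  have h := hs.sum_mul_eq (c := fun i => c i * Real.sign (U i - k))
  have e : (D.mesh.interfaceSum fun i j => c i * (Real.sign (U i - k) * D.totalFlux φ U i j)) =
      D.mesh.interfaceSum fun i j => c i * Real.sign (U i - k) * D.totalFlux φ U i j :=
    interfaceSum_congr fun i j _ => by ring
  rw [e, ← h]
  refine Finset.sum_le_sum fun i _ => ?_
  rw [mul_assoc]
  refine mul_le_mul_of_nonneg_left ?_ (hc i)
  rw [← mul_assoc, mul_comm (Real.sign _), mul_assoc]
  refine mul_le_mul_of_nonneg_left ?_ measureReal_nonneg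
  rw [← mul_div_assoc]
  refine div_le_div_of_nonneg_right ?_ D.dt_pos.le
  -- Convexity of `|· - k|`: this quantity is at least `|U i - k| - |V i - k|`, also for `U i = k`,
  -- where the sign is zero.
  have h1 : Real.sign (U i - k) * (U i - V i) =
      Real.sign (U i - k) * (U i - k) - Real.sign (U i - k) * (V i - k) := by ring
  rw [h1]
  have h2 : Real.sign (U i - k) * (U i - k) = |U i - k| := by
    rcases lt_trichotomy (U i - k) 0 with h | h | h
    · rw [Real.sign_of_neg h, abs_of_neg h]; ring
    · simp [h]
    · rw [Real.sign_of_pos h, abs_of_pos h]; ring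
  have h3 : Real.sign (U i - k) * (V i - k) ≤ |V i - k| := by
    rcases lt_trichotomy (U i - k) 0 with h | h | h
    · rw [Real.sign_of_neg h]
      linarith [neg_abs_le (V i - k)]
    · simp [h]
    · rw [Real.sign_of_pos h]
      linarith [le_abs_self (V i - k)]
  linarith

end Step

section Energy

variable {d : ℕ} {Ω : Set (Space (d + 1))} {f : ℝ → Space (d + 1)} (D : Discretization Ω f)
  {φ : ℝ → ℝ} {U V : Fin D.mesh.card → ℝ}

/-- Gauss-Green with the constant function 1: the volume integrals vanish, and only `∂Ω` limits the
sum, however fine the mesh. -/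
theorem _root_.ZeroFluxFV.AdmissibleMesh.abs_interfaceSum_inner_le (hΩ : IsRegularDomain Ω)
    (m : AdmissibleMesh Ω) {w : Fin m.card → Space (d + 1)} {W : ℝ} (hW0 : 0 ≤ W)
    (hW : ∀ i, ‖w i‖ ≤ W) :
    |m.interfaceSum fun i j => m.area i j * ⟪w i, m.normal i j⟫| ≤
      (d + 1 : ℕ) * (W * (surfaceMeasure (d + 1)).real (frontier Ω)) := by
  have h := m.abs_sum_gaussGreen_le (ψ := fun _ _ => 1) (w := w) (W := W) (G := 1) hΩ
    (fun _ => contDiff_const) zero_le_one hW0 (by simp) hW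
  simp only [fderiv_fun_const, Pi.zero_apply, _root_.zero_apply, integral_zero,
    zero_sub, Finset.sum_neg_distrib, abs_neg, mul_one, integral_const, smul_eq_mul,
    measureReal_restrict_apply_univ] at h
  refine le_trans (le_of_eq ?_) h
  congr 1
  exact interfaceSum_congr fun i j _ => mul_comm _ _

variable {D} in
/-- The energy inequality for one time step. -/
theorem IsStep.energy_le (hΩ : IsRegularDomain Ω) (hs : D.IsStep φ V U) (hf : Continuous f)
    {W : ℝ} (hW0 : 0 ≤ W) (hW : ∀ i, ‖∫ s in (0 : ℝ)..U i, f s‖ ≤ W) :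
    ∑ i, volume.real (D.mesh.cell i) * ((U i ^ 2 - V i ^ 2) / D.dt) + 2 * D.dissipation φ U ≤
      2 * ((d + 1 : ℕ) * (W * (surfaceMeasure (d + 1)).real (frontier Ω))) := by
  set Ψ : Fin D.mesh.card → Space (d + 1) := fun i => ∫ s in (0 : ℝ)..U i, f s
  have h1 := hs.sum_mul_eq (c := U)
  have h2 : (D.mesh.interfaceSum fun i j => U i * D.totalFlux φ U i j) =
      D.dissipation φ U + D.mesh.interfaceSum fun i j =>
        D.mesh.area i j * ⟪Ψ i, D.mesh.normal i j⟫ := by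
    rw [interfaceSum_mul_eq (fun i j hij => D.totalFlux_antisymm hij), dissipation]
    -- By consistency the diagonal flux integrates to the increment of the primitive `Ψ` of `f`.
    -- Hence flux times jump is minus the dissipation plus a difference of normal components of `Ψ`,
    -- whose sum is a boundary effect.
    have e1 : ∀ i j, D.mesh.Adj i j → fluxDissipation (D.flux i j) (U i) (U j) =
        D.mesh.area i j * ⟪Ψ j, D.mesh.normal i j⟫ - D.mesh.area i j * ⟪Ψ i, D.mesh.normal i j⟫ -
        D.flux i j (U i) (U j) * (U j - U i) := by
      intro i j hij
      have hi : ∀ a b, IntervalIntegrable f volume a b := fun a b => hf.intervalIntegrable a b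
      have hc : Continuous fun s => D.mesh.area i j * ⟪f s, D.mesh.normal i j⟫ := by fun_prop
      simp only [fluxDissipation, D.consistent i j hij]
      rw [intervalIntegral.integral_sub (hc.intervalIntegrable _ _) (by simp),
        intervalIntegral.integral_const, intervalIntegral.integral_const_mul, ← mul_sub,
        ← inner_sub_left]
      have e3 : ∫ s in U i..U j, ⟪f s, D.mesh.normal i j⟫ = ⟪Ψ j - Ψ i, D.mesh.normal i j⟫ := by
        have e4 : Ψ j - Ψ i = ∫ s in U i..U j, f s := by
          exact intervalIntegral.integral_interval_sub_left (hi _ _) (hi _ _)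
        have e5 := (innerSL ℝ (D.mesh.normal i j)).intervalIntegral_comp_comm
          (hi (U i) (U j))
        simp only [innerSL_apply_apply] at e5
        rw [e4, real_inner_comm, ← e5]
        simp only [real_inner_comm]
      rw [e3, smul_eq_mul]
      ring
    have e2 : (D.mesh.interfaceSum fun i j => D.mesh.area i j * ⟪Ψ j, D.mesh.normal i j⟫) =
        -D.mesh.interfaceSum fun i j => D.mesh.area i j * ⟪Ψ i, D.mesh.normal i j⟫ := by
      rw [← interfaceSum_swap (h := fun i j => D.mesh.area i j * ⟪Ψ i, D.mesh.normal i j⟫),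
        neg_eq_neg_one_mul, ← interfaceSum_const_mul]
      refine interfaceSum_congr fun i j _ => ?_
      rw [D.mesh.area_comm j i, D.mesh.normal_comm j i, inner_neg_right]
      ring
    have e3 : (D.mesh.interfaceSum fun i j => (U i - U j) * D.totalFlux φ U i j) =
        D.mesh.interfaceSum fun i j => fluxDissipation (D.flux i j) (U i) (U j) +
          D.mesh.transmissivity i j * (φ (U j) - φ (U i)) * (U j - U i) -
          (D.mesh.area i j * ⟪Ψ j, D.mesh.normal i j⟫ -
            D.mesh.area i j * ⟪Ψ i, D.mesh.normal i j⟫) :=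
      interfaceSum_congr fun i j hij => by rw [e1 i j hij, totalFlux]; ring
    rw [e3, interfaceSum_sub, interfaceSum_sub, e2]
    ring
  have h3 := (abs_le.1 (D.mesh.abs_interfaceSum_inner_le hΩ hW0 hW)).1
  -- The implicit time step is favourable: `2 * U * (U - V) = U ^ 2 - V ^ 2 + (U - V) ^ 2`.
  have h4 : ∑ i, volume.real (D.mesh.cell i) * ((U i ^ 2 - V i ^ 2) / D.dt) ≤
      2 * ∑ i, U i * (volume.real (D.mesh.cell i) * ((U i - V i) / D.dt)) := by
    rw [Finset.mul_sum]
    refine Finset.sum_le_sum fun i _ => ?_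
    have : 0 ≤ volume.real (D.mesh.cell i) / D.dt * (U i - V i) ^ 2 :=
      mul_nonneg (div_nonneg measureReal_nonneg D.dt_pos.le) (sq_nonneg _)
    have e : 2 * (U i * (volume.real (D.mesh.cell i) * ((U i - V i) / D.dt))) =
      volume.real (D.mesh.cell i) * ((U i ^ 2 - V i ^ 2) / D.dt) +
        volume.real (D.mesh.cell i) / D.dt * (U i - V i) ^ 2 := by ring
    linarith
  rw [h1, h2] at h4
  linarith

end Energy

end Discretization

end ZeroFluxFV

/-! ### Consistency of the discrete convection and diffusion operators on test functions -/

namespace ZeroFluxFV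

/-- A nonnegative `C¹` function that is, together with its gradient, Lipschitz on `B` with
constant `K`. -/
structure IsControlled {ℓ : ℕ} (B : Set (Space ℓ)) (K : ℝ) (θ : Space ℓ → ℝ) : Prop where
  contDiff : ContDiff ℝ 1 θ
  nonneg : ∀ x, 0 ≤ θ x
  abs_sub_le : ∀ x ∈ B, ∀ y ∈ B, |θ y - θ x| ≤ K * ‖y - x‖
  gradient_sub_le : ∀ x ∈ B, ∀ y ∈ B, ‖gradient θ y - gradient θ x‖ ≤ K * ‖y - x‖
  taylor_le : ∀ x ∈ B, ∀ y ∈ B, |θ y - θ x - ⟪gradient θ x, y - x⟫| ≤ K * ‖y - x‖ ^ 2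

theorem fderiv_eq_inner_gradient {ℓ : ℕ} (θ : Space ℓ → ℝ) (x w : Space ℓ) :
    fderiv ℝ θ x w = ⟪gradient θ x, w⟫ := by
  rw [gradient, InnerProductSpace.toDual_symm_apply]

theorem continuous_gradient {ℓ : ℕ} {θ : Space ℓ → ℝ} (h : ContDiff ℝ 1 θ) :
    Continuous (gradient θ) :=
  (InnerProductSpace.toDual ℝ (Space ℓ)).symm.continuous.comp (h.continuous_fderiv one_ne_zero)

namespace AdmissibleMesh

section Consistency

variable {d : ℕ} {Ω : Set (Space (d + 1))} (m : AdmissibleMesh Ω)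
  {B : Set (Space (d + 1))} {K : ℝ} {θ : Space (d + 1) → ℝ}

theorem area_pos (hΩ : IsRegularDomain Ω) {i j : Fin m.card} (hij : m.Adj i j) :
    0 < m.area i j := ENNReal.toReal_pos hij.2 (m.area_lt_top hΩ hij).ne

theorem integrableOn_cell (hΩ : IsRegularDomain Ω) {g : Space (d + 1) → ℝ} (hg : Continuous g)
    (i : Fin m.card) : IntegrableOn g (m.cell i) :=
  (hg.continuousOn.integrableOn_compact (m.isBounded_cell hΩ i).isCompact_closure).mono_set
    subset_closure

theorem integrableOn_interface (hΩ : IsRegularDomain Ω) {g : Space (d + 1) → ℝ}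
    (hg : Continuous g) {i j : Fin m.card} (hij : m.Adj i j) :
    IntegrableOn g (m.interface i j) (surfaceMeasure (d + 1)) := by
  obtain ⟨b, hb⟩ := (hΩ.isBounded.isCompact_closure).exists_bound_of_continuousOn hg.continuousOn
  have : IsFiniteMeasure ((surfaceMeasure (d + 1)).restrict (m.interface i j)) :=
    ⟨by rw [Measure.restrict_apply_univ]; exact m.area_lt_top hΩ hij⟩
  refine Integrable.of_bound (C := b) hg.aestronglyMeasurable ?_
  filter_upwards [ae_restrict_mem (m.measurableSet_interface hΩ.isOpen i j)] with x hx
  exact hb x (subset_closure hx.2)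

/-- The mean value of a function on an interface. -/
noncomputable def interfaceMean (θ : Space (d + 1) → ℝ) (i j : Fin m.card) : ℝ :=
  (m.area i j)⁻¹ * ∫ x in m.interface i j, θ x ∂surfaceMeasure (d + 1)

theorem interfaceMean_comm (θ : Space (d + 1) → ℝ) (i j : Fin m.card) :
    m.interfaceMean θ i j = m.interfaceMean θ j i := by
  rw [interfaceMean, interfaceMean, m.area_comm, m.interface_comm]

theorem integral_interface_sub (hΩ : IsRegularDomain Ω) (hθ : Continuous θ) {i j : Fin m.card}
    (hij : m.Adj i j) (c : ℝ) :
    ∫ x in m.interface i j, (θ x - c) ∂surfaceMeasure (d + 1) =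
      m.area i j * (m.interfaceMean θ i j - c) := by
  have hA := m.area_pos hΩ hij
  rw [integral_sub (m.integrableOn_interface hΩ hθ hij)
    (m.integrableOn_interface hΩ continuous_const hij), integral_const, interfaceMean, mul_sub,
    mul_inv_cancel_left₀ hA.ne', measureReal_restrict_apply_univ, smul_eq_mul]
  rfl

theorem abs_interfaceMean_sub_le (hΩ : IsRegularDomain Ω) (hB : closure Ω ⊆ B)
    (hθ : IsControlled B K θ) (hK : 0 ≤ K) {i j : Fin m.card} (hij : m.Adj i j) :
    |m.interfaceMean θ i j - θ (m.center i)| ≤ K * Metric.diam (m.cell i) := by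
  have hA := m.area_pos hΩ hij
  have hcell : closure (m.cell i) ⊆ B := (closure_mono (m.cell_subset i)).trans hB
  have h := norm_setIntegral_le_of_norm_le_const (μ := surfaceMeasure (d + 1))
    (s := m.interface i j) (f := fun x => θ x - θ (m.center i))
    (C := K * Metric.diam (m.cell i)) (m.area_lt_top hΩ hij) (fun x hx => by
      refine (hθ.abs_sub_le _ (hcell (m.center_mem i)) x (hcell hx.1.1)).trans ?_
      rw [← dist_eq_norm]
      exact mul_le_mul_of_nonneg_left (m.dist_le_diam hΩ hx.1.1 (m.center_mem i)) hK)
  rw [m.integral_interface_sub hΩ hθ.contDiff.continuous hij, norm_mul,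
    Real.norm_of_nonneg hA.le, mul_comm] at h
  exact le_of_mul_le_mul_right h hA

/-- Gauss-Green for `θ - θ (center i)`: this function is small with the mesh size on `cell i`, so
the uncontrolled boundary contribution is small too. -/
theorem abs_convection_consistency_le (hΩ : IsRegularDomain Ω) (hB : closure Ω ⊆ B)
    (hθ : IsControlled B K θ) (hK : 0 ≤ K) {w : Fin m.card → Space (d + 1)} {W : ℝ}
    (hW0 : 0 ≤ W) (hW : ∀ i, ‖w i‖ ≤ W) :
    |(∑ i, ∫ x in m.cell i, ⟪w i, gradient θ x⟫) - m.interfaceSum fun i j =>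
      m.area i j * ⟪w i, m.normal i j⟫ * (m.interfaceMean θ i j - θ (m.center i))| ≤
      (d + 1 : ℕ) * (W * (K * m.size) * (surfaceMeasure (d + 1)).real (frontier Ω)) := by
  have h := m.abs_sum_gaussGreen_le (ψ := fun i x => θ x - θ (m.center i)) (w := w) (W := W)
    (G := K * m.size) hΩ (fun i => hθ.contDiff.sub contDiff_const)
    (mul_nonneg hK m.size_nonneg) hW0 (fun i x hx => ?_) hW
  · rw [Finset.sum_sub_distrib] at h
    refine le_trans (le_of_eq ?_) h
    congr 2
    · refine Finset.sum_congr rfl fun i _ => ?_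
      refine integral_congr_ae (Eventually.of_forall fun x => ?_)
      simp only
      rw [fderiv_sub_const, fderiv_eq_inner_gradient, real_inner_comm]
    · refine interfaceSum_congr fun i j hij => ?_
      rw [m.integral_interface_sub hΩ hθ.contDiff.continuous hij]
      ring
  · have hcell : closure (m.cell i) ⊆ B := (closure_mono (m.cell_subset i)).trans hB
    refine (hθ.abs_sub_le _ (hcell (m.center_mem i)) x (hcell (subset_closure hx))).trans ?_
    rw [← dist_eq_norm]
    exact mul_le_mul_of_nonneg_left ((m.dist_le_diam hΩ (subset_closure hx)
      (m.center_mem i)).trans (m.diam_le_size i)) hK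

/-- Gauss-Green for the constants `s i * θ (center i)`, dominated on `cell i` by `θ + K * size`.
With `a = f k` and signs `s i`, this produces the boundary term of the entropy inequality. -/
theorem abs_boundary_consistency_le (hΩ : IsRegularDomain Ω) (hB : closure Ω ⊆ B)
    (hθ : IsControlled B K θ) (hK : 0 ≤ K) (a : Space (d + 1)) {s : Fin m.card → ℝ}
    (hs : ∀ i, |s i| ≤ 1) :
    |m.interfaceSum fun i j => θ (m.center i) * (s i * (m.area i j * ⟪a, m.normal i j⟫))| ≤
      (∫ x in frontier Ω, |⟪a, exteriorNormal Ω x⟫| * θ x ∂surfaceMeasure (d + 1)) +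
        K * m.size * ‖a‖ * (surfaceMeasure (d + 1)).real (frontier Ω) := by
  have hKs : 0 ≤ K * m.size := mul_nonneg hK m.size_nonneg
  have h := m.abs_gaussGreen_le (ψ := fun i _ => s i * θ (m.center i)) (a := a)
    (g := fun x => θ x + K * m.size) hΩ (fun i => contDiff_const)
    (hθ.contDiff.add contDiff_const) (fun x => add_nonneg (hθ.nonneg x) hKs)
    (fun i x hx => ?_)
  · simp only [fderiv_fun_const, Pi.zero_apply, _root_.zero_apply, integral_zero,
      zero_sub, Finset.sum_neg_distrib, abs_neg, integral_const, smul_eq_mul,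
      measureReal_restrict_apply_univ] at h
    have h1 : ∫ x in frontier Ω, |⟪a, exteriorNormal Ω x⟫| * (θ x + K * m.size)
        ∂surfaceMeasure (d + 1) =
        (∫ x in frontier Ω, |⟪a, exteriorNormal Ω x⟫| * θ x ∂surfaceMeasure (d + 1)) +
        (∫ x in frontier Ω, |⟪a, exteriorNormal Ω x⟫| ∂surfaceMeasure (d + 1)) *
          (K * m.size) := by
      simp_rw [mul_add]
      rw [integral_add (integrableOn_frontier hΩ a hθ.contDiff.continuous)
        (integrableOn_frontier hΩ a continuous_const), integral_mul_const]
    rw [h1] at h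
    have h2 := mul_le_mul_of_nonneg_right (setIntegral_frontier_le hΩ a) hKs
    refine le_trans (le_of_eq ?_) (h.trans (le_trans (add_le_add_right h2 _) (le_of_eq (by ring))))
    congr 1
    refine interfaceSum_congr fun i j _ => ?_
    rw [area]
    ring
  · have hcell : closure (m.cell i) ⊆ B := (closure_mono (m.cell_subset i)).trans hB
    have h1 := hθ.abs_sub_le x (hcell (subset_closure hx)) _ (hcell (m.center_mem i))
    rw [← dist_eq_norm] at h1
    have h2 := mul_le_mul_of_nonneg_left ((m.dist_le_diam hΩ (m.center_mem i)
      (subset_closure hx)).trans (m.diam_le_size i)) hK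
    rw [abs_mul, abs_of_nonneg (hθ.nonneg _)]
    refine (mul_le_of_le_one_left (hθ.nonneg _) (hs i)).trans ?_
    linarith [le_abs_self (θ (m.center i) - θ x)]

/-- The orthogonal projection of the centres onto the hyperplane of an interface. -/
noncomputable def foot (i j : Fin m.card) : Space (d + 1) :=
  m.center i + m.height i j • m.normal i j

theorem foot_comm {i j : Fin m.card} (hij : m.Adj i j) : m.foot i j = m.foot j i := by
  rw [foot, foot, m.normal_comm j i, smul_neg, ← sub_eq_zero]
  have h1 := m.center_sub hij
  rw [← m.height_add_height hij, add_smul] at h1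
  have h2 : m.center i + m.height i j • m.normal i j -
      (m.center j + -(m.height j i • m.normal i j)) =
      (m.height i j • m.normal i j + m.height j i • m.normal i j) -
        (m.center j - m.center i) := by abel
  rw [h2, h1, sub_self]

/-- The foot divides the segment between the centres in the ratio of the heights. That segment need
not stay in `Ω`, which is why test functions are controlled on a convex set containing its closure.
-/
theorem foot_mem (hΩ : IsOpen Ω) (hB : closure Ω ⊆ B) (hBc : Convex ℝ B) {i j : Fin m.card}
    (hij : m.Adj i j) : m.foot i j ∈ B := by
  have hcell : ∀ i, m.center i ∈ B := fun i =>
    hB (closure_mono (m.cell_subset i) (m.center_mem i))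
  have hd := m.centerDist_pos hij
  have h1 := m.height_nonneg hΩ hij
  have h2 := m.height_nonneg hΩ (m.adj_comm.1 hij)
  have h3 := m.height_add_height hij
  have h := hBc.add_smul_sub_mem (hcell i) (hcell j) (t := m.height i j / m.centerDist i j)
    ⟨by positivity, (div_le_one hd).2 (by linarith)⟩
  rwa [m.center_sub hij, smul_smul, div_mul_cancel₀ _ hd.ne'] at h

theorem height_le_centerDist (hΩ : IsOpen Ω) {i j : Fin m.card} (hij : m.Adj i j) :
    m.height i j ≤ m.centerDist i j := by
  have h2 := m.height_nonneg hΩ (m.adj_comm.1 hij)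
  have h3 := m.height_add_height hij
  linarith

/-- The consistency of the diamond gradient on half a diamond. -/
theorem abs_halfDiamond_consistency_le (hΩ : IsRegularDomain Ω) (hB : closure Ω ⊆ B)
    (hBc : Convex ℝ B) (hθ : IsControlled B K θ) (hK : 0 ≤ K) {i j : Fin m.card}
    (hij : m.Adj i j) :
    |((d + 1 : ℕ) : ℝ) / m.centerDist i j *
        (∫ x in m.halfDiamond i j, ⟪m.normal i j, gradient θ x⟫) -
      m.transmissivity i j * (θ (m.foot i j) - θ (m.center i))| ≤
      2 * K * m.size * m.area i j := by
  have hcell : closure (m.cell i) ⊆ B := (closure_mono (m.cell_subset i)).trans hB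
  have hd := m.centerDist_pos hij
  have hA := m.area_pos hΩ hij
  have hh0 := m.height_nonneg hΩ.isOpen hij
  have hhd := m.height_le_centerDist hΩ.isOpen hij
  have hhs := (m.height_le hΩ hij).trans (m.diam_le_size i)
  set p := ⟪m.normal i j, gradient θ (m.center i)⟫ with hp
  have hvol := m.volume_halfDiamond hΩ hij
  have hbd : volume (m.halfDiamond i j) < ⊤ :=
    ((m.isBounded_cell hΩ i).closure.subset (m.halfDiamond_subset i j)).measure_lt_top
  have hcont : Continuous fun x => ⟪m.normal i j, gradient θ x⟫ :=
    continuous_const.inner (continuous_gradient hθ.contDiff)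
  have hint : IntegrableOn (fun x => ⟪m.normal i j, gradient θ x⟫) (m.halfDiamond i j) :=
    (hcont.continuousOn.integrableOn_compact
      (m.isBounded_cell hΩ i).isCompact_closure).mono_set (m.halfDiamond_subset i j)
  have h1 : |(∫ x in m.halfDiamond i j, ⟪m.normal i j, gradient θ x⟫) -
      volume.real (m.halfDiamond i j) * p| ≤
      K * m.size * volume.real (m.halfDiamond i j) := by
    have h := norm_setIntegral_le_of_norm_le_const (μ := volume)
      (s := m.halfDiamond i j) (f := fun x => ⟪m.normal i j, gradient θ x⟫ - p)
      (C := K * m.size) hbd (fun x hx => by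
        have hx' := m.halfDiamond_subset i j hx
        rw [hp, ← inner_sub_right]
        refine (norm_inner_le_norm _ _).trans ?_
        rw [m.norm_normal hij, one_mul]
        refine (hθ.gradient_sub_le _ (hcell (m.center_mem i)) x (hcell hx')).trans ?_
        rw [← dist_eq_norm]
        exact mul_le_mul_of_nonneg_left ((m.dist_le_diam hΩ hx' (m.center_mem i)).trans
          (m.diam_le_size i)) hK)
    rw [integral_sub hint (integrableOn_const hbd.ne), integral_const,
      measureReal_restrict_apply_univ, smul_eq_mul] at h
    exact h
  have h2 : |θ (m.foot i j) - θ (m.center i) - m.height i j * p| ≤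
      K * m.size * m.height i j := by
    have h := hθ.taylor_le _ (hcell (m.center_mem i)) _ (m.foot_mem hΩ.isOpen hB hBc hij)
    rw [foot, add_sub_cancel_left, norm_smul, m.norm_normal hij, mul_one,
      Real.norm_of_nonneg hh0, inner_smul_right, real_inner_comm, ← hp] at h
    refine h.trans ?_
    have : K * m.height i j * m.height i j ≤ K * m.size * m.height i j := by gcongr
    calc _ = K * m.height i j * m.height i j := by ring
      _ ≤ _ := this
  have hτ : m.transmissivity i j = m.area i j / m.centerDist i j := rfl
  -- The half diamond has volume height times area over `d + 1`, so both leading terms equal the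
  -- transmissivity times the height times `p` and cancel. This is where the dimension factor of the
  -- discrete gradient is used.
  have e : ((d + 1 : ℕ) : ℝ) / m.centerDist i j *
        (∫ x in m.halfDiamond i j, ⟪m.normal i j, gradient θ x⟫) -
      m.transmissivity i j * (θ (m.foot i j) - θ (m.center i)) =
      ((d + 1 : ℕ) : ℝ) / m.centerDist i j *
        ((∫ x in m.halfDiamond i j, ⟪m.normal i j, gradient θ x⟫) -
          volume.real (m.halfDiamond i j) * p) -
      m.transmissivity i j * (θ (m.foot i j) - θ (m.center i) - m.height i j * p) := by
    have hd1 : ((d + 1 : ℕ) : ℝ) ≠ 0 := by positivity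
    rw [hvol, hτ]
    field_simp
    ring
  rw [e]
  refine (abs_sub _ _).trans ?_
  rw [abs_mul, abs_mul, abs_of_nonneg (m.transmissivity_nonneg i j),
    abs_of_nonneg (by positivity : 0 ≤ ((d + 1 : ℕ) : ℝ) / m.centerDist i j)]
  have h3 := mul_le_mul_of_nonneg_left h1
    (by positivity : 0 ≤ ((d + 1 : ℕ) : ℝ) / m.centerDist i j)
  have h4 := mul_le_mul_of_nonneg_left h2 (m.transmissivity_nonneg i j)
  have e3 : ((d + 1 : ℕ) : ℝ) / m.centerDist i j *
      (K * m.size * volume.real (m.halfDiamond i j)) =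
      K * m.size * m.area i j * (m.height i j / m.centerDist i j) := by
    have hd1 : ((d + 1 : ℕ) : ℝ) ≠ 0 := by positivity
    rw [hvol]
    field_simp
  have e4 : m.transmissivity i j * (K * m.size * m.height i j) =
      K * m.size * m.area i j * (m.height i j / m.centerDist i j) := by
    rw [hτ]
    field_simp
  have h5 : K * m.size * m.area i j * (m.height i j / m.centerDist i j) ≤
      K * m.size * m.area i j * 1 := by
    refine mul_le_mul_of_nonneg_left ((div_le_one hd).2 hhd) ?_
    have := m.size_nonneg
    positivity
  linarith

end Consistency

/-! ### Integrals of piecewise constant functions -/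

section Integrals

variable {d : ℕ} {Ω : Set (Space (d + 1))} (m : AdmissibleMesh Ω)

theorem piecewiseConst_of_mem {ℓ : ℕ} {Ω : Set (Space ℓ)} (m : AdmissibleMesh Ω)
    (w : Fin m.card → ℝ) {i : Fin m.card} {x : Space ℓ} (hx : x ∈ m.cell i) :
    m.piecewiseConst w x = w i := by
  rw [piecewiseConst, Finset.sum_eq_single i]
  · rw [indicator_of_mem hx]
  · intro j _ hj
    rw [indicator_of_notMem]
    exact fun hxj => hj (m.eq_of_mem_cell_of_mem_closure hx (subset_closure hxj)).symm
  · simp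

theorem setIntegral_eq_sum_cell {ℓ : ℕ} {Ω : Set (Space ℓ)} (m : AdmissibleMesh Ω)
    {g : Space ℓ → ℝ} (hg : ∀ i, IntegrableOn g (m.cell i)) :
    ∫ x in Ω, g x = ∑ i, ∫ x in m.cell i, g x := by
  have h1 : (Ω : Set (Space ℓ)) =ᵐ[volume] ⋃ i, m.cell i := by
    refine (ae_le_set.2 m.cell_cover).antisymm (Eventually.of_forall ?_)
    exact fun x hx => iUnion_subset m.cell_subset hx
  rw [setIntegral_congr_set h1, integral_iUnion_fintype (fun i => (m.cell_open i).measurableSet)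
    (fun i j hij => m.cell_disjoint i j hij) hg]

/-- A half diamond with apex `center p` lies in the closure of `cell p`, so inside `cell i` only
those with apex `center i` matter. The gradient vector is symmetric in the pair, and the sum over `i
< j` becomes a sum over neighbours. -/
theorem discreteGradient_of_mem (w : Fin m.card → ℝ) {i : Fin m.card} {x : Space (d + 1)}
    (hx : x ∈ m.cell i) :
    m.discreteGradient w x = ∑ j ∈ m.neighbors i, (m.halfDiamond i j).indicator
      (fun _ => (((d + 1 : ℕ) : ℝ) * (w j - w i) / m.centerDist i j) • m.normal i j) x := by
  classical
  set v : Fin m.card → Fin m.card → Space (d + 1) := fun p q =>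
    (((d + 1 : ℕ) : ℝ) * (w q - w p) / m.centerDist p q) • m.normal p q with hv
  have hvc : ∀ p q, v p q = v q p := by
    intro p q
    simp only [hv]
    rw [m.normal_comm p q, m.centerDist_comm p q, smul_neg, ← neg_smul]
    congr 1
    ring
  have hnot : ∀ p q, p ≠ i → x ∉ m.halfDiamond p q := fun p q hp hxp =>
    hp (m.eq_of_mem_cell_of_mem_closure hx (m.halfDiamond_subset p q hxp)).symm
  set T : Fin m.card → Fin m.card → Space (d + 1) := fun p q =>
    (m.halfDiamond p q).indicator (fun _ => v p q) x with hT
  have hT0 : ∀ p q, p ≠ i → T p q = 0 := fun p q hp => by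
    simp only [hT]
    rw [indicator_of_notMem (hnot p q hp)]
  have h1 : ∀ p q, p < q → (m.diamond p q).indicator (fun _ => v p q) x = T p q + T q p := by
    intro p q hpq
    have hd : m.diamond p q = m.halfDiamond p q ∪ m.halfDiamond q p := by
      rw [diamond, halfDiamond, halfDiamond, m.interface_comm q p]
    simp only [hT]
    rw [hd, hvc q p]
    by_cases hp : p = i
    · have hq : q ≠ i := fun h => hpq.ne (hp.trans h.symm)
      rw [indicator_of_notMem (hnot q p hq), add_zero]
      simp only [indicator, mem_union, hnot q p hq, or_false]
    · rw [indicator_of_notMem (hnot p q hp), zero_add]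
      simp only [indicator, mem_union, hnot p q hp, false_or]
  have h2 : m.discreteGradient w x =
      ∑ p, ∑ q, if m.Adj p q ∧ p < q then T p q + T q p else 0 := by
    rw [discreteGradient]
    refine Finset.sum_congr rfl fun p _ => ?_
    rw [neighbors, Finset.filter_filter, Finset.sum_filter]
    refine Finset.sum_congr rfl fun q _ => ?_
    split_ifs with h
    · exact h1 p q h.2
    · rfl
  have h3 : ∀ p q, (if m.Adj p q ∧ p < q then T p q + T q p else 0) =
      (if m.Adj p q ∧ p < q then T p q else 0) + if m.Adj p q ∧ p < q then T q p else 0 := by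
    intro p q
    split_ifs <;> simp
  rw [h2]
  simp_rw [h3, Finset.sum_add_distrib]
  have h4 : ∑ p, ∑ q, (if m.Adj p q ∧ p < q then T q p else 0) =
      ∑ p, ∑ q, (if m.Adj p q ∧ q < p then T p q else 0) := by
    rw [Finset.sum_comm]
    simp only [m.adj_comm]
  rw [h4, ← Finset.sum_add_distrib, Finset.sum_eq_single i]
  · rw [neighbors, Finset.sum_filter, ← Finset.sum_add_distrib]
    refine Finset.sum_congr rfl fun q _ => ?_
    by_cases hadj : m.Adj i q
    · rcases lt_or_gt_of_ne hadj.1 with h | h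
      · simp [hadj, h, not_lt.2 h.le, hT, hv]
      · simp [hadj, h, not_lt.2 h.le, hT, hv]
    · simp [hadj]
  · intro p _ hp
    simp [hT0 p _ hp]
  · simp

/-- The half diamond is in the closure of `cell i`, and the boundary of `cell i` is null. -/
theorem setIntegral_halfDiamond (hΩ : IsRegularDomain Ω) {i j : Fin m.card} (hij : m.Adj i j)
    (g : Space (d + 1) → ℝ) :
    ∫ x in m.cell i, (m.halfDiamond i j).indicator g x = ∫ x in m.halfDiamond i j, g x := by
  have hn : NullMeasurableSet (m.halfDiamond i j) (volume.restrict (m.cell i)) :=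
    (m.nullMeasurableSet_halfDiamond hΩ hij).mono_ac Measure.restrict_le_self.absolutelyContinuous
  rw [integral_indicator₀ hn, Measure.restrict_restrict₀ hn]
  refine setIntegral_congr_set ?_
  have hnull : volume (m.halfDiamond i j \ (m.halfDiamond i j ∩ m.cell i)) = 0 := by
    refine measure_mono_null ?_ (m.volume_frontier_cell hΩ i)
    rintro x ⟨hx, hx'⟩
    exact ⟨m.halfDiamond_subset i j hx, fun h => hx' ⟨hx, h⟩⟩
  exact inter_subset_left.eventuallyLE.antisymm (ae_le_set.2 hnull)

end Integrals

end AdmissibleMesh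

end ZeroFluxFV

/-! ### The entropy inequality for one time step, against a test function -/

namespace ZeroFluxFV

theorem abs_sign_le (x : ℝ) : |Real.sign x| ≤ 1 := by
  rcases Real.sign_apply_eq x with h | h | h <;> rw [h] <;> norm_num

theorem sign_monotone {x y : ℝ} (h : x ≤ y) : Real.sign x ≤ Real.sign y := by
  rcases lt_trichotomy x 0 with hx | hx | hx
  · rw [Real.sign_of_neg hx]
    exact (abs_le.1 (abs_sign_le y)).1
  · subst hx
    rw [Real.sign_zero]
    rcases h.eq_or_lt with h | h
    · rw [← h, Real.sign_zero]
    · rw [Real.sign_of_pos h]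
      exact zero_le_one
  · rw [Real.sign_of_pos hx, Real.sign_of_pos (hx.trans_le h)]

namespace AdmissibleMesh

variable {d : ℕ} {Ω : Set (Space (d + 1))} (m : AdmissibleMesh Ω)

theorem sum_volume_cell (hΩ : IsRegularDomain Ω) :
    ∑ i, volume.real (m.cell i) = volume.real Ω := by
  have h := m.setIntegral_eq_sum_cell (g := fun _ => 1)
    (fun i => integrableOn_const (m.isBounded_cell hΩ i).measure_lt_top.ne)
  simpa using h.symm

/-- The space integral of the entropy functional as a sum over the control volumes. -/
theorem setIntegral_entropy (hΩ : IsRegularDomain Ω) {θ η : Space (d + 1) → ℝ}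
    (hθ : ContDiff ℝ 1 θ) (hη : Continuous η) (f : ℝ → Space (d + 1)) (U w : Fin m.card → ℝ)
    (k : ℝ) :
    ∫ x in Ω, (|m.piecewiseConst U x - k| * η x + Real.sign (m.piecewiseConst U x - k) *
      ⟪f (m.piecewiseConst U x) - f k - m.discreteGradient w x, gradient θ x⟫) =
    ∑ i, (|U i - k| * (∫ x in m.cell i, η x) +
      ((∫ x in m.cell i, ⟪Real.sign (U i - k) • (f (U i) - f k), gradient θ x⟫) -
      ∑ j ∈ m.neighbors i, Real.sign (U i - k) * ((w j - w i) *
        (((d + 1 : ℕ) : ℝ) / m.centerDist i j *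
          ∫ x in m.halfDiamond i j, ⟪m.normal i j, gradient θ x⟫)))) := by
  have hgc := continuous_gradient hθ
  have hnc : ∀ v : Space (d + 1), Continuous fun x => ⟪v, gradient θ x⟫ := fun v =>
    continuous_const.inner hgc
  have hpt : ∀ i, ∀ x ∈ m.cell i,
      |m.piecewiseConst U x - k| * η x + Real.sign (m.piecewiseConst U x - k) *
        ⟪f (m.piecewiseConst U x) - f k - m.discreteGradient w x, gradient θ x⟫ =
      |U i - k| * η x + (⟪Real.sign (U i - k) • (f (U i) - f k), gradient θ x⟫ -
        ∑ j ∈ m.neighbors i, Real.sign (U i - k) * ((w j - w i) *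
          (((d + 1 : ℕ) : ℝ) / m.centerDist i j *
            (m.halfDiamond i j).indicator (fun x => ⟪m.normal i j, gradient θ x⟫) x))) := by
    intro i x hx
    rw [m.piecewiseConst_of_mem U hx, m.discreteGradient_of_mem w hx, inner_sub_left, mul_sub,
      real_inner_smul_left, sum_inner, Finset.mul_sum]
    congr 2
    refine Finset.sum_congr rfl fun j _ => ?_
    by_cases hxj : x ∈ m.halfDiamond i j
    · rw [indicator_of_mem hxj, indicator_of_mem hxj, real_inner_smul_left]
      ring
    · rw [indicator_of_notMem hxj, indicator_of_notMem hxj, inner_zero_left]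
      ring
  have hi1 : ∀ i, IntegrableOn (fun x => |U i - k| * η x) (m.cell i) := fun i =>
    (m.integrableOn_cell hΩ hη i).const_mul _
  have hi2 : ∀ i, IntegrableOn
      (fun x => ⟪Real.sign (U i - k) • (f (U i) - f k), gradient θ x⟫) (m.cell i) := fun i =>
    m.integrableOn_cell hΩ (hnc _) i
  have hi3 : ∀ i, ∀ j ∈ m.neighbors i, IntegrableOn (fun x =>
      Real.sign (U i - k) * ((w j - w i) * (((d + 1 : ℕ) : ℝ) / m.centerDist i j *
        (m.halfDiamond i j).indicator (fun x => ⟪m.normal i j, gradient θ x⟫) x)))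
      (m.cell i) := by
    intro i j hj
    refine Integrable.const_mul (Integrable.const_mul (Integrable.const_mul ?_ _) _) _
    exact (m.integrableOn_cell hΩ (hnc (m.normal i j)) i).indicator₀
      ((m.nullMeasurableSet_halfDiamond hΩ (m.mem_neighbors.1 hj)).mono_ac
        Measure.restrict_le_self.absolutelyContinuous)
  have hi4 : ∀ i, IntegrableOn (fun x => ∑ j ∈ m.neighbors i,
      Real.sign (U i - k) * ((w j - w i) * (((d + 1 : ℕ) : ℝ) / m.centerDist i j *
        (m.halfDiamond i j).indicator (fun x => ⟪m.normal i j, gradient θ x⟫) x)))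
      (m.cell i) := fun i => integrable_finsetSum _ (hi3 i)
  have hi5 : ∀ i, IntegrableOn (fun x =>
      ⟪Real.sign (U i - k) • (f (U i) - f k), gradient θ x⟫ - ∑ j ∈ m.neighbors i,
      Real.sign (U i - k) * ((w j - w i) * (((d + 1 : ℕ) : ℝ) / m.centerDist i j *
        (m.halfDiamond i j).indicator (fun x => ⟪m.normal i j, gradient θ x⟫) x)))
      (m.cell i) := fun i => (hi2 i).sub (hi4 i)
  rw [m.setIntegral_eq_sum_cell]
  · refine Finset.sum_congr rfl fun i _ => ?_
    rw [setIntegral_congr_fun (m.cell_open i).measurableSet (hpt i), integral_add (hi1 i) (hi5 i),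
      integral_sub (hi2 i) (hi4 i), integral_const_mul, integral_finsetSum _ (hi3 i)]
    congr 2
    refine Finset.sum_congr rfl fun j hj => ?_
    rw [integral_const_mul, integral_const_mul, integral_const_mul,
      m.setIntegral_halfDiamond hΩ (m.mem_neighbors.1 hj)]
  · intro i
    exact ((hi1 i).add (hi5 i)).congr_fun (fun x hx => (hpt i x hx).symm)
      (m.cell_open i).measurableSet

end AdmissibleMesh

namespace Discretization

open AdmissibleMesh

variable {d : ℕ} {Ω : Set (Space (d + 1))} {f : ℝ → Space (d + 1)} {D : Discretization Ω f}
  {φ : ℝ → ℝ} {U V : Fin D.mesh.card → ℝ} {B : Set (Space (d + 1))} {K ζ M r : ℝ}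
  {θ : Space (d + 1) → ℝ}

theorem interfaceSum_diam_mul_area_le (hΩ : IsRegularDomain Ω) (hu : D.IsUniform ζ M) :
    (D.mesh.interfaceSum fun i j => Metric.diam (D.mesh.cell i) * D.mesh.area i j) ≤
      ζ * volume.real Ω := by
  rw [← D.mesh.sum_volume_cell hΩ, Finset.mul_sum, ← sum_mul_sum_neighbors]
  exact Finset.sum_le_sum fun i _ => hu.1 i

/-- Young's inequality with weight `centerDist`: the distance is at most the sum of the two
diameters and is summed by shape regularity, while the squared increment over the distance is at
most `C` times a term of the dissipation. -/
theorem interfaceSum_area_mul_abs_le (hΩ : IsRegularDomain Ω) (hu : D.IsUniform ζ M)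
    {C : NNReal} (hφ : LipschitzWith C φ) (hφm : Monotone φ) :
    (D.mesh.interfaceSum fun i j => D.mesh.area i j * |φ (U j) - φ (U i)|) ≤
      ζ * volume.real Ω + C * D.dissipation φ U := by
  have h1 := D.interfaceSum_diam_mul_area_le hΩ hu
  have h2 : (D.mesh.interfaceSum fun i j => Metric.diam (D.mesh.cell j) * D.mesh.area i j) =
      D.mesh.interfaceSum fun i j => Metric.diam (D.mesh.cell i) * D.mesh.area i j := by
    rw [← interfaceSum_swap
      (h := fun i j => Metric.diam (D.mesh.cell i) * D.mesh.area i j)]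
    exact interfaceSum_congr fun i j _ => by rw [D.mesh.area_comm]
  have h3 := D.interfaceSum_diffusion_le φ U
  have h4 : (D.mesh.interfaceSum fun i j => D.mesh.area i j * |φ (U j) - φ (U i)|) ≤
      D.mesh.interfaceSum fun i j => 1 / 2 * ((Metric.diam (D.mesh.cell i) * D.mesh.area i j +
        Metric.diam (D.mesh.cell j) * D.mesh.area i j) +
        C * (D.mesh.transmissivity i j * (φ (U j) - φ (U i)) * (U j - U i))) := by
    refine interfaceSum_mono fun i j hij => ?_
    have hd := D.mesh.centerDist_pos hij
    have hA := D.mesh.area_nonneg i j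
    have hdd := D.mesh.centerDist_le hΩ hij
    have hmul : (φ (U j) - φ (U i)) ^ 2 ≤ C * ((φ (U j) - φ (U i)) * (U j - U i)) := by
      have hl := hφ.dist_le_mul (U j) (U i)
      rw [Real.dist_eq, Real.dist_eq] at hl
      have hp : 0 ≤ (φ (U j) - φ (U i)) * (U j - U i) := by
        rcases le_total (U i) (U j) with h | h
        · exact mul_nonneg (sub_nonneg.2 (hφm h)) (sub_nonneg.2 h)
        · exact mul_nonneg_of_nonpos_of_nonpos (sub_nonpos.2 (hφm h)) (sub_nonpos.2 h)
      rw [← abs_of_nonneg hp, abs_mul, ← sq_abs]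
      nlinarith [abs_nonneg (φ (U j) - φ (U i))]
    have h5 : |φ (U j) - φ (U i)| ≤
        1 / 2 * (D.mesh.centerDist i j + (φ (U j) - φ (U i)) ^ 2 / D.mesh.centerDist i j) := by
      have h6 : 0 ≤ (D.mesh.centerDist i j - |φ (U j) - φ (U i)|) ^ 2 / D.mesh.centerDist i j := by
        positivity
      have h7 : (D.mesh.centerDist i j - |φ (U j) - φ (U i)|) ^ 2 / D.mesh.centerDist i j =
          D.mesh.centerDist i j + (φ (U j) - φ (U i)) ^ 2 / D.mesh.centerDist i j -
            2 * |φ (U j) - φ (U i)| := by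
        rw [← sq_abs (φ (U j) - φ (U i))]
        field_simp
        ring
      linarith
    have h8 : (φ (U j) - φ (U i)) ^ 2 / D.mesh.centerDist i j ≤
        C * ((φ (U j) - φ (U i)) * (U j - U i)) / D.mesh.centerDist i j := by gcongr
    calc D.mesh.area i j * |φ (U j) - φ (U i)|
        ≤ D.mesh.area i j * (1 / 2 * ((Metric.diam (D.mesh.cell i) +
          Metric.diam (D.mesh.cell j)) +
          C * ((φ (U j) - φ (U i)) * (U j - U i)) / D.mesh.centerDist i j)) :=
          mul_le_mul_of_nonneg_left (by linarith) hA
      _ = _ := by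
          rw [transmissivity]
          ring
  rw [interfaceSum_const_mul, interfaceSum_add, interfaceSum_add, interfaceSum_const_mul, h2] at h4
  have h9 := mul_le_mul_of_nonneg_left h3 C.2
  have h10 : (C : ℝ) * (D.mesh.interfaceSum fun i j =>
    D.mesh.transmissivity i j * (φ (U j) - φ (U i)) * (U j - U i)) ≤
      C * (2 * D.dissipation φ U) := h9
  linarith

/-- The diffusion terms of the entropy inequality for one time step. -/
theorem diffusion_consistency (hΩ : IsRegularDomain Ω) (hB : closure Ω ⊆ B) (hBc : Convex ℝ B)
    (hθ : IsControlled B K θ) (hK : 0 ≤ K) (hφm : Monotone φ) (k : ℝ) :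
    (D.mesh.interfaceSum fun i j => Real.sign (U i - k) * ((φ (U j) - φ (U i)) *
        (((d + 1 : ℕ) : ℝ) / D.mesh.centerDist i j *
          ∫ x in D.mesh.halfDiamond i j, ⟪D.mesh.normal i j, gradient θ x⟫))) ≤
      2 * K * D.mesh.size *
        (D.mesh.interfaceSum fun i j => D.mesh.area i j * |φ (U j) - φ (U i)|) -
      D.mesh.interfaceSum fun i j => θ (D.mesh.center i) * (Real.sign (U i - k) *
        (D.mesh.transmissivity i j * (φ (U j) - φ (U i)))) := by
  set s : Fin D.mesh.card → ℝ := fun i => Real.sign (U i - k) with hs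
  -- The foot is common to both sides, so the weight `θ (foot i j)` is symmetric; summation by parts
  -- leaves the products of increments of `sign` and of `φ`, which are nonnegative.
  have h1 : (D.mesh.interfaceSum fun i j => s i *
      (D.mesh.transmissivity i j * (φ (U j) - φ (U i)) * θ (D.mesh.foot i j))) ≤ 0 := by
    rw [interfaceSum_mul_eq (h := fun i j =>
      D.mesh.transmissivity i j * (φ (U j) - φ (U i)) * θ (D.mesh.foot i j))]
    · have h2 : 0 ≤ D.mesh.interfaceSum fun i j => -1 * ((s i - s j) *
          (D.mesh.transmissivity i j * (φ (U j) - φ (U i)) * θ (D.mesh.foot i j))) := by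
        refine interfaceSum_nonneg fun i j _ => ?_
        have h3 : 0 ≤ (s j - s i) * (φ (U j) - φ (U i)) := by
          rcases le_total (U i) (U j) with h | h
          · exact mul_nonneg (sub_nonneg.2 (sign_monotone (by linarith)))
              (sub_nonneg.2 (hφm h))
          · exact mul_nonneg_of_nonpos_of_nonpos (sub_nonpos.2 (sign_monotone (by linarith)))
              (sub_nonpos.2 (hφm h))
        have h4 := mul_nonneg (mul_nonneg (D.mesh.transmissivity_nonneg i j) h3)
          (hθ.nonneg (D.mesh.foot i j))
        refine h4.trans (le_of_eq ?_)
        ring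
      rw [interfaceSum_const_mul] at h2
      linarith
    · intro i j hij
      rw [D.mesh.transmissivity_comm, D.mesh.foot_comm hij]
      ring
  have h2 : (D.mesh.interfaceSum fun i j => s i * ((φ (U j) - φ (U i)) *
        (((d + 1 : ℕ) : ℝ) / D.mesh.centerDist i j *
          ∫ x in D.mesh.halfDiamond i j, ⟪D.mesh.normal i j, gradient θ x⟫))) ≤
      D.mesh.interfaceSum fun i j => s i *
        (D.mesh.transmissivity i j * (φ (U j) - φ (U i)) * θ (D.mesh.foot i j)) -
        θ (D.mesh.center i) * (s i * (D.mesh.transmissivity i j * (φ (U j) - φ (U i)))) +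
        2 * K * D.mesh.size * (D.mesh.area i j * |φ (U j) - φ (U i)|) := by
    refine interfaceSum_mono fun i j hij => ?_
    have h3 := D.mesh.abs_halfDiamond_consistency_le hΩ hB hBc hθ hK hij
    set T := ((d + 1 : ℕ) : ℝ) / D.mesh.centerDist i j *
          ∫ x in D.mesh.halfDiamond i j, ⟪D.mesh.normal i j, gradient θ x⟫
    have h4 : s i * (φ (U j) - φ (U i)) *
        (T - D.mesh.transmissivity i j * (θ (D.mesh.foot i j) - θ (D.mesh.center i))) ≤
        |φ (U j) - φ (U i)| * (2 * K * D.mesh.size * D.mesh.area i j) := by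
      refine (le_abs_self _).trans ?_
      rw [abs_mul, abs_mul]
      exact mul_le_mul (mul_le_of_le_one_left (abs_nonneg _) (abs_sign_le _)) h3
        (abs_nonneg _) (abs_nonneg _)
    linarith
  rw [interfaceSum_add, interfaceSum_sub, interfaceSum_const_mul] at h2
  linarith

/-- The convection terms of the entropy inequality for one time step. -/
theorem convection_consistency (hΩ : IsRegularDomain Ω) (hB : closure Ω ⊆ B)
    (hθ : IsControlled B K θ) (hK : 0 ≤ K) (hu : D.IsUniform ζ M) (hM : 0 ≤ M) (hr : 0 ≤ r)
    (hsize : D.mesh.size ≤ r ^ 2) (hφm : Monotone φ) {W : ℝ} (hW0 : 0 ≤ W)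
    (k : ℝ) (hW : ∀ i, ‖f (U i) - f k‖ ≤ W) (hWk : ‖f k‖ ≤ W) :
    (-D.mesh.interfaceSum fun i j => θ (D.mesh.center i) * (Real.sign (U i - k) *
        D.flux i j (U i) (U j))) ≤
      (∑ i, ∫ x in D.mesh.cell i, ⟪Real.sign (U i - k) • (f (U i) - f k), gradient θ x⟫) +
      (∫ x in frontier Ω, |⟪f k, exteriorNormal Ω x⟫| * θ x ∂surfaceMeasure (d + 1)) +
      K * ((d + 2 : ℕ) * W * (surfaceMeasure (d + 1)).real (frontier Ω) * r ^ 2 +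
        2 * r * (M * ζ * volume.real Ω + 2 * D.dissipation φ U)) := by
  set H := (surfaceMeasure (d + 1)).real (frontier Ω) with hH
  have hH0 : 0 ≤ H := measureReal_nonneg
  set s : Fin D.mesh.card → ℝ := fun i => Real.sign (U i - k) with hs
  set w : Fin D.mesh.card → Space (d + 1) := fun i => s i • (f (U i) - f k) with hw
  have hwW : ∀ i, ‖w i‖ ≤ W := fun i => by
    rw [hw, norm_smul, Real.norm_eq_abs]
    exact (mul_le_of_le_one_left (norm_nonneg _) (abs_sign_le _)).trans (hW i)
  have h1 := D.mesh.abs_convection_consistency_le hΩ hB hθ hK hW0 hwW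
  have h2 := D.mesh.abs_boundary_consistency_le hΩ hB hθ hK (f k) (s := s) fun i => abs_sign_le _
  set G : Fin D.mesh.card → Fin D.mesh.card → ℝ := fun i j => entropyFlux (D.flux i j) k (U i) (U j) with hG
  have hGself : ∀ i j, D.mesh.Adj i j →
      D.mesh.area i j * ⟪w i, D.mesh.normal i j⟫ = entropyFlux (D.flux i j) k (U i) (U i) := by
    intro i j hij
    rw [entropyFlux_self, D.consistent i j hij, D.consistent i j hij, hw, real_inner_smul_left,
      inner_sub_left]
    ring
  have hGanti : ∀ i j, D.mesh.Adj i j → G i j = -G j i := by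
    intro i j hij
    simp only [hG, entropyFlux]
    rw [D.conservative i j hij, D.conservative i j hij]
    ring
  -- The numerical flux splits into the entropy flux `G`, which is antisymmetric, and the flux of
  -- the constant state `k`, which becomes the boundary term.
  have h3 : (D.mesh.interfaceSum fun i j => θ (D.mesh.center i) * (s i * D.flux i j (U i) (U j))) ≥
      D.mesh.interfaceSum fun i j => θ (D.mesh.center i) * G i j +
        θ (D.mesh.center i) * (s i * (D.mesh.area i j * ⟪f k, D.mesh.normal i j⟫)) := by
    refine interfaceSum_mono fun i j hij => ?_
    rw [← mul_add]
    refine mul_le_mul_of_nonneg_left ?_ (hθ.nonneg _)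
    rw [← D.consistent i j hij k]
    exact entropyFlux_le (D.antitone_right i j hij) k (U i) (U j)
  -- A symmetric weight against an antisymmetric flux: the interface mean may be subtracted from `θ
  -- (center i)` for free, which gains a factor of the diameter.
  have h4 : (D.mesh.interfaceSum fun i j => D.mesh.interfaceMean θ i j * G i j) = 0 :=
    interfaceSum_eq_zero fun i j hij => by
      rw [hGanti i j hij, D.mesh.interfaceMean_comm]; ring
  have h5 : |D.mesh.interfaceSum fun i j =>
      (D.mesh.area i j * ⟪w i, D.mesh.normal i j⟫ - G i j) *
        (D.mesh.interfaceMean θ i j - θ (D.mesh.center i))| ≤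
      K * (2 * r * (M * (ζ * volume.real Ω) + 2 * D.dissipation φ U)) := by
    refine abs_interfaceSum_le.trans ?_
    have h6 : (D.mesh.interfaceSum fun i j => |(D.mesh.area i j * ⟪w i, D.mesh.normal i j⟫ - G i j) *
        (D.mesh.interfaceMean θ i j - θ (D.mesh.center i))|) ≤ D.mesh.interfaceSum fun i j =>
        K * (2 * r * (M * (Metric.diam (D.mesh.cell i) * D.mesh.area i j) +
          fluxDissipation (D.flux i j) (U i) (U j))) := by
      refine interfaceSum_mono fun i j hij => ?_
      have hA := D.mesh.area_nonneg i j
      have hE := D.fluxDissipation_nonneg U hij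
      have hdiam : 0 ≤ Metric.diam (D.mesh.cell i) := Metric.diam_nonneg
      have hdr : Metric.diam (D.mesh.cell i) ≤ r ^ 2 := (D.mesh.diam_le_size i).trans hsize
      have hsq := sq_entropyFlux_sub_le (D.monotone_left i j hij) (D.antitone_right i j hij)
        (hu.2 i j hij) k (U i) (U j)
      rw [hGself i j hij, abs_mul]
      set X := entropyFlux (D.flux i j) k (U i) (U i) - G i j with hX
      set E := fluxDissipation (D.flux i j) (U i) (U j) with hEdef
      have h7 := D.mesh.abs_interfaceMean_sub_le hΩ hB hθ hK hij
      -- From `X ^ 2 ≤ 16 * (M * area) * E` and `diam ≤ r ^ 2`, by `4 * x * y ≤ (x + y) ^ 2` with `x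
      -- = M * diam * area` and `y = E`. This is where the rate drops to the square root of the mesh
      -- size.
      have h8 : |X| * Metric.diam (D.mesh.cell i) ≤
          2 * r * (M * (Metric.diam (D.mesh.cell i) * D.mesh.area i j) + E) := by
        refine abs_le_of_sq_le_sq' ?_ (by positivity) |>.2
        have h9 : X ^ 2 * Metric.diam (D.mesh.cell i) ^ 2 ≤
            16 * (M * D.mesh.area i j) * E * (Metric.diam (D.mesh.cell i) * r ^ 2) := by
          rw [sq (Metric.diam (D.mesh.cell i))]
          have : 0 ≤ 16 * (M * D.mesh.area i j) * E := by positivity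
          gcongr
        rw [mul_pow, sq_abs]
        refine h9.trans ?_
        have h10 : 0 ≤ r ^ 2 * (M * (Metric.diam (D.mesh.cell i) * D.mesh.area i j) - E) ^ 2 := by positivity
        linarith
      calc |X| * |D.mesh.interfaceMean θ i j - θ (D.mesh.center i)|
          ≤ |X| * (K * Metric.diam (D.mesh.cell i)) := by gcongr
        _ = K * (|X| * Metric.diam (D.mesh.cell i)) := by ring
        _ ≤ _ := mul_le_mul_of_nonneg_left h8 hK
    refine h6.trans ?_
    rw [interfaceSum_const_mul, interfaceSum_const_mul, interfaceSum_add, interfaceSum_const_mul]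
    have h7 := D.interfaceSum_diam_mul_area_le hΩ hu
    have h8 := D.interfaceSum_fluxDissipation_le hφm U
    gcongr
  have h6 : (D.mesh.interfaceSum fun i j =>
      (D.mesh.area i j * ⟪w i, D.mesh.normal i j⟫ - G i j) *
        (D.mesh.interfaceMean θ i j - θ (D.mesh.center i))) =
      (D.mesh.interfaceSum fun i j => D.mesh.area i j * ⟪w i, D.mesh.normal i j⟫ *
        (D.mesh.interfaceMean θ i j - θ (D.mesh.center i))) -
      (D.mesh.interfaceSum fun i j => D.mesh.interfaceMean θ i j * G i j) +
      D.mesh.interfaceSum fun i j => θ (D.mesh.center i) * G i j := by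
    rw [← interfaceSum_sub, ← interfaceSum_add]
    exact interfaceSum_congr fun i j _ => by ring
  rw [interfaceSum_add] at h3
  have h7 := (abs_le.1 h1).1
  have h8 := (abs_le.1 h2).1
  have h9 := (abs_le.1 h5).1
  have h10 : (d + 1 : ℕ) * (W * (K * D.mesh.size) * H) ≤ (d + 1 : ℕ) * (W * (K * r ^ 2) * H) := by
    gcongr
  have h11 : K * D.mesh.size * ‖f k‖ * H ≤ K * r ^ 2 * W * H := by
    gcongr
  have e : K * ((d + 2 : ℕ) * W * H * r ^ 2 +
        2 * r * (M * ζ * volume.real Ω + 2 * D.dissipation φ U)) =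
      (d + 1 : ℕ) * (W * (K * r ^ 2) * H) + K * r ^ 2 * W * H +
      K * (2 * r * (M * (ζ * volume.real Ω) + 2 * D.dissipation φ U)) := by
    push_cast
    ring
  rw [e]
  linarith

/-- The entropy inequality for one time step. -/
theorem IsStep.entropy_consistency (hs : D.IsStep φ V U) (hΩ : IsRegularDomain Ω)
    (hB : closure Ω ⊆ B) (hBc : Convex ℝ B)
    (hθ : IsControlled B K θ) (hK : 0 ≤ K) (hu : D.IsUniform ζ M) (hM : 0 ≤ M) (hr : 0 ≤ r)
    (hsize : D.mesh.size ≤ r ^ 2) {C : NNReal} (hφ : LipschitzWith C φ) (hφm : Monotone φ)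
    {W : ℝ} (hW0 : 0 ≤ W)
    (k : ℝ) (hW : ∀ i, ‖f (U i) - f k‖ ≤ W) (hWk : ‖f k‖ ≤ W) :
    (∑ i, θ (D.mesh.center i) *
      (volume.real (D.mesh.cell i) * ((|U i - k| - |V i - k|) / D.dt))) -
    K * ((d + 2 : ℕ) * W * (surfaceMeasure (d + 1)).real (frontier Ω) * r ^ 2 +
        2 * r * (M * ζ * volume.real Ω + 2 * D.dissipation φ U) +
        2 * r ^ 2 * (ζ * volume.real Ω + C * D.dissipation φ U)) ≤
    (∑ i, ((∫ x in D.mesh.cell i, ⟪Real.sign (U i - k) • (f (U i) - f k), gradient θ x⟫) -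
      ∑ j ∈ D.mesh.neighbors i, Real.sign (U i - k) * ((φ (U j) - φ (U i)) *
        (((d + 1 : ℕ) : ℝ) / D.mesh.centerDist i j *
          ∫ x in D.mesh.halfDiamond i j, ⟪D.mesh.normal i j, gradient θ x⟫)))) +
      (∫ x in frontier Ω, |⟪f k, exteriorNormal Ω x⟫| * θ x ∂surfaceMeasure (d + 1)) := by
  have h1 := hs.entropy_le k (c := fun i => θ (D.mesh.center i)) fun i => hθ.nonneg _
  have h2 := convection_consistency (U := U) hΩ hB hθ hK hu hM hr hsize hφm hW0 k hW hWk
  have h3 := diffusion_consistency (D := D) (U := U) hΩ hB hBc hθ hK hφm k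
  have h4 := D.interfaceSum_area_mul_abs_le (U := U) hΩ hu hφ hφm
  have h5 : (D.mesh.interfaceSum fun i j => θ (D.mesh.center i) *
      (Real.sign (U i - k) * D.totalFlux φ U i j)) =
      (D.mesh.interfaceSum fun i j => θ (D.mesh.center i) *
        (Real.sign (U i - k) * D.flux i j (U i) (U j))) -
      D.mesh.interfaceSum fun i j => θ (D.mesh.center i) * (Real.sign (U i - k) *
        (D.mesh.transmissivity i j * (φ (U j) - φ (U i)))) := by
    rw [← interfaceSum_sub]
    exact interfaceSum_congr fun i j _ => by rw [totalFlux]; ring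
  have h6 : 0 ≤ D.mesh.interfaceSum fun i j => D.mesh.area i j * |φ (U j) - φ (U i)| :=
    interfaceSum_nonneg fun i j _ => mul_nonneg (D.mesh.area_nonneg i j) (abs_nonneg _)
  have h7 : 2 * K * D.mesh.size *
      (D.mesh.interfaceSum fun i j => D.mesh.area i j * |φ (U j) - φ (U i)|) ≤
      2 * K * r ^ 2 * (ζ * volume.real Ω + C * D.dissipation φ U) := by
    gcongr
  rw [Finset.sum_sub_distrib]
  have h8 : (∑ i, ∑ j ∈ D.mesh.neighbors i, Real.sign (U i - k) * ((φ (U j) - φ (U i)) *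
        (((d + 1 : ℕ) : ℝ) / D.mesh.centerDist i j *
          ∫ x in D.mesh.halfDiamond i j, ⟪D.mesh.normal i j, gradient θ x⟫))) =
      D.mesh.interfaceSum fun i j => Real.sign (U i - k) * ((φ (U j) - φ (U i)) *
        (((d + 1 : ℕ) : ℝ) / D.mesh.centerDist i j *
          ∫ x in D.mesh.halfDiamond i j, ⟪D.mesh.normal i j, gradient θ x⟫)) := rfl
  rw [h8]
  linarith

end Discretization

end ZeroFluxFV

namespace ZeroFluxFV

/-! ### Step functions of time -/

section Steps

variable {δ T : ℝ}

/-- Only finitely many time levels occur on a bounded interval, so the function is a finite sum of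
continuous functions cut off to measurable sets. -/
theorem intervalIntegrable_comp_ceil {H : ℕ → ℝ → ℝ} (hH : ∀ n, Continuous (H n)) (δ a b : ℝ) :
    IntervalIntegrable (fun t => H ⌈t / δ⌉₊ t) volume a b := by
  rw [intervalIntegrable_iff]
  have hmeas : Measurable fun t : ℝ => ⌈t / δ⌉₊ :=
    Nat.measurable_ceil.comp (measurable_id.div_const δ)
  obtain ⟨N, hN⟩ : ∃ N : ℕ, ∀ t ∈ uIoc a b, ⌈t / δ⌉₊ < N := by
    have hbd : BddAbove ((fun t => t / δ) '' uIcc a b) :=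
      (isCompact_uIcc.image (continuous_id.div_const δ)).bddAbove
    obtain ⟨c, hc⟩ := hbd
    refine ⟨⌈c⌉₊ + 1, fun t ht => Nat.lt_succ_of_le (Nat.ceil_mono ?_)⟩
    exact hc ⟨t, uIoc_subset_uIcc ht, rfl⟩
  have hsum : IntegrableOn (fun t => ∑ n ∈ Finset.range N,
      ((fun t : ℝ => ⌈t / δ⌉₊) ⁻¹' {n}).indicator (H n) t) (uIoc a b) := by
    refine integrable_finsetSum _ fun n _ => Integrable.indicator ?_ (hmeas (measurableSet_singleton n))
    exact ((hH n).intervalIntegrable a b).def'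
  refine hsum.congr_fun (fun t ht => ?_) measurableSet_uIoc
  simp only
  rw [Finset.sum_eq_single_of_mem ⌈t / δ⌉₊ (Finset.mem_range.2 (hN t ht))]
  · rw [indicator_of_mem (by simp)]
  · intro n _ hn
    rw [indicator_of_notMem]
    simpa using hn.symm

/-- Truncated subtraction agrees with the natural ceiling, which is zero at nonpositive arguments,
so the shift is valid for all `t`, with level 0 before time zero. -/
theorem ceil_sub_div (hδ : 0 < δ) (t : ℝ) : ⌈(t - δ) / δ⌉₊ = ⌈t / δ⌉₊ - 1 := by
  rw [sub_div, div_self hδ.ne', Nat.ceil_sub_one]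

theorem intervalIntegrable_step (c : ℕ → ℝ) (δ a b : ℝ) :
    IntervalIntegrable (fun t => c ⌈t / δ⌉₊) volume a b :=
  intervalIntegrable_comp_ceil (H := fun n _ => c n) (fun _ => continuous_const) δ a b

/-- Summation by parts in time. -/
theorem le_integral_step (hδ : 0 < δ) (hT : 0 ≤ T) {c : ℕ → ℝ} {b K : ℝ} (hc0 : ∀ n, 0 ≤ c n)
    (hcb : ∀ n, c n ≤ b) {g g' : ℝ → ℝ} (hg : Continuous g) (hg' : Continuous g')
    (hg0 : ∀ t, 0 ≤ g t) (hK : 0 ≤ K) (hlip : ∀ s t, |g t - g s| ≤ K * |t - s|)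
    (hbd : ∀ t, |g' t| ≤ K)
    (htay : ∀ s ∈ Icc 0 T, ∀ t ∈ Icc 0 T, |g t - g s - (t - s) * g' s| ≤ K * (t - s) ^ 2) :
    -(c 0 * g 0) - b * K * (T + 3) * δ ≤
      ∫ t in (0 : ℝ)..T, (c ⌈t / δ⌉₊ * g' t +
        g t * ((c ⌈t / δ⌉₊ - c (⌈t / δ⌉₊ - 1)) / δ)) := by
  have hb0 : 0 ≤ b := (hc0 0).trans (hcb 0)
  have i1 : ∀ x y, IntervalIntegrable (fun t => c ⌈t / δ⌉₊ * g' t) volume x y := fun x y =>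
    intervalIntegrable_comp_ceil (H := fun n t => c n * g' t) (fun _ => by fun_prop) δ x y
  have i2 : ∀ x y, IntervalIntegrable (fun t => g t * c ⌈t / δ⌉₊) volume x y := fun x y =>
    intervalIntegrable_comp_ceil (H := fun n t => g t * c n) (fun _ => by fun_prop) δ x y
  have i3 : ∀ x y, IntervalIntegrable (fun t => g t * c (⌈t / δ⌉₊ - 1)) volume x y := fun x y =>
    intervalIntegrable_comp_ceil (H := fun n t => g t * c (n - 1)) (fun _ => by fun_prop) δ x y
  have i4 : ∀ x y, IntervalIntegrable (fun t => g (t + δ) * c ⌈t / δ⌉₊) volume x y := fun x y =>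
    intervalIntegrable_comp_ceil (H := fun n t => g (t + δ) * c n) (fun _ => by fun_prop) δ x y
  -- Lowering the level by one is a translation of time. On `(-δ, 0]` the level is 0, and this layer
  -- gives the initial term.
  have hshift : ∫ t in (0 : ℝ)..T, g t * c (⌈t / δ⌉₊ - 1) =
      ∫ t in (-δ)..(T - δ), g (t + δ) * c ⌈t / δ⌉₊ := by
    have h := intervalIntegral.integral_comp_sub_right (a := 0) (b := T)
      (fun t => g (t + δ) * c ⌈t / δ⌉₊) δ
    simp only [sub_add_cancel, ceil_sub_div hδ, zero_sub] at h
    exact h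
  have hsplit : ∫ t in (-δ)..(T - δ), g (t + δ) * c ⌈t / δ⌉₊ =
      (∫ t in (-δ)..0, g (t + δ) * c ⌈t / δ⌉₊) + (∫ t in (0 : ℝ)..T, g (t + δ) * c ⌈t / δ⌉₊) -
        ∫ t in (T - δ)..T, g (t + δ) * c ⌈t / δ⌉₊ := by
    rw [intervalIntegral.integral_add_adjacent_intervals (i4 _ _) (i4 _ _),
      ← intervalIntegral.integral_add_adjacent_intervals (i4 (-δ) (T - δ)) (i4 (T - δ) T)]
    ring
  -- The test function need not vanish at time `T`; the final layer has the favourable sign and is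
  -- dropped.
  have hlast : 0 ≤ ∫ t in (T - δ)..T, g (t + δ) * c ⌈t / δ⌉₊ :=
    intervalIntegral.integral_nonneg (by linarith) fun t _ => mul_nonneg (hg0 _) (hc0 _)
  have hfirst : ∫ t in (-δ)..0, g (t + δ) * c ⌈t / δ⌉₊ ≤ δ * ((g 0 + K * δ) * c 0) := by
    have h : ∫ t in (-δ)..0, g (t + δ) * c ⌈t / δ⌉₊ ≤ ∫ t in (-δ)..0, (g 0 + K * δ) * c 0 := by
      refine intervalIntegral.integral_mono_on (by linarith) (i4 _ _) (by simp) fun t ht => ?_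
      have hz : ⌈t / δ⌉₊ = 0 := Nat.ceil_eq_zero.2 (div_nonpos_of_nonpos_of_nonneg ht.2 hδ.le)
      rw [hz]
      refine mul_le_mul_of_nonneg_right ?_ (hc0 0)
      have h1 := (le_abs_self _).trans (hlip 0 (t + δ))
      rw [sub_zero, abs_of_nonneg (by linarith [ht.1] : 0 ≤ t + δ)] at h1
      have h2 : K * (t + δ) ≤ K * δ := mul_le_mul_of_nonneg_left (by linarith [ht.2]) hK
      linarith
    rw [intervalIntegral.integral_const, smul_eq_mul, sub_neg_eq_add, zero_add] at h
    exact h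
  -- The Taylor bound requires `t + δ ≤ T`; on the last interval only the bounds by `K` on slope and
  -- derivative remain, that is `2 * K` over a length `δ`. With another `K * δ` from the initial
  -- layer this makes the factor `T + 3`.
  have hmid : -(b * (K * δ * T + 2 * K * δ)) ≤
      ∫ t in (0 : ℝ)..T, (c ⌈t / δ⌉₊ * g' t + δ⁻¹ * (g t * c ⌈t / δ⌉₊) -
        δ⁻¹ * (g (t + δ) * c ⌈t / δ⌉₊)) := by
    have hind : IntervalIntegrable (fun t => (Ioc (T - δ) T).indicator (fun _ => 2 * K) t)
        volume 0 T := by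
      rw [intervalIntegrable_iff]
      exact (integrableOn_const (by simp)).indicator measurableSet_Ioc
    have hlow : ∫ t in (0 : ℝ)..T, -(b * (K * δ + (Ioc (T - δ) T).indicator (fun _ => 2 * K) t)) ≤
        ∫ t in (0 : ℝ)..T, (c ⌈t / δ⌉₊ * g' t + δ⁻¹ * (g t * c ⌈t / δ⌉₊) -
        δ⁻¹ * (g (t + δ) * c ⌈t / δ⌉₊)) := by
      refine intervalIntegral.integral_mono_on hT (((IntervalIntegrable.add (by simp) hind).const_mul _).neg)
        (((i1 _ _).add ((i2 _ _).const_mul _)).sub ((i4 _ _).const_mul _)) fun t ht => ?_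
      have e : c ⌈t / δ⌉₊ * g' t + δ⁻¹ * (g t * c ⌈t / δ⌉₊) - δ⁻¹ * (g (t + δ) * c ⌈t / δ⌉₊) =
          -(c ⌈t / δ⌉₊ * (δ⁻¹ * (g (t + δ) - g t - δ * g' t))) := by
        field_simp
        ring
      rw [e, neg_le_neg_iff]
      have hY : δ⁻¹ * (g (t + δ) - g t - δ * g' t) ≤
          K * δ + (Ioc (T - δ) T).indicator (fun _ => 2 * K) t := by
        rw [inv_mul_le_iff₀ hδ]
        by_cases h : t ∈ Ioc (T - δ) T
        · rw [indicator_of_mem h]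
          have h1 := (le_abs_self _).trans (hlip t (t + δ))
          rw [add_sub_cancel_left, abs_of_pos hδ] at h1
          have h2 := mul_le_mul_of_nonneg_left (abs_le.1 (hbd t)).1 hδ.le
          have h3 : 0 ≤ δ * (K * δ) := by positivity
          linarith
        · rw [indicator_of_notMem h, add_zero]
          have h1 : t ≤ T - δ := by
            by_contra h2
            exact h ⟨not_le.1 h2, ht.2⟩
          have h2 := (le_abs_self _).trans (htay t ht (t + δ) ⟨by linarith [ht.1], by linarith⟩)
          rw [add_sub_cancel_left] at h2
          linarith
      have hE : 0 ≤ K * δ + (Ioc (T - δ) T).indicator (fun _ => 2 * K) t :=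
        add_nonneg (by positivity) (indicator_nonneg (fun _ _ => by positivity) _)
      exact (mul_le_mul_of_nonneg_left hY (hc0 _)).trans (mul_le_mul_of_nonneg_right (hcb _) hE)
    refine le_trans ?_ hlow
    rw [intervalIntegral.integral_neg, neg_le_neg_iff, intervalIntegral.integral_const_mul]
    refine mul_le_mul_of_nonneg_left ?_ hb0
    rw [intervalIntegral.integral_add (by simp) hind, intervalIntegral.integral_const, smul_eq_mul,
      sub_zero]
    have hvol : ∫ t in (0 : ℝ)..T, (Ioc (T - δ) T).indicator (fun _ => 2 * K) t ≤ 2 * K * δ := by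
      rw [intervalIntegral.integral_of_le hT, integral_indicator measurableSet_Ioc,
        integral_const, smul_eq_mul, measureReal_restrict_apply_univ,
        measureReal_restrict_apply measurableSet_Ioc, mul_comm]
      refine mul_le_mul_of_nonneg_left ?_ (by positivity)
      calc volume.real (Ioc (T - δ) T ∩ Ioc 0 T) ≤ volume.real (Ioc (T - δ) T) :=
            measureReal_mono inter_subset_left (by simp)
        _ = δ := by rw [Real.volume_real_Ioc_of_le (by linarith)]; ring
    linarith
  have hmid' : ∫ t in (0 : ℝ)..T, (c ⌈t / δ⌉₊ * g' t + δ⁻¹ * (g t * c ⌈t / δ⌉₊) -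
        δ⁻¹ * (g (t + δ) * c ⌈t / δ⌉₊)) =
      (∫ t in (0 : ℝ)..T, c ⌈t / δ⌉₊ * g' t) + δ⁻¹ * (∫ t in (0 : ℝ)..T, g t * c ⌈t / δ⌉₊) -
        δ⁻¹ * ∫ t in (0 : ℝ)..T, g (t + δ) * c ⌈t / δ⌉₊ := by
    rw [intervalIntegral.integral_sub ((i1 _ _).add ((i2 _ _).const_mul _))
      ((i4 _ _).const_mul _), intervalIntegral.integral_add (i1 _ _) ((i2 _ _).const_mul _),
      intervalIntegral.integral_const_mul, intervalIntegral.integral_const_mul]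
  have hgoal : ∫ t in (0 : ℝ)..T, (c ⌈t / δ⌉₊ * g' t +
        g t * ((c ⌈t / δ⌉₊ - c (⌈t / δ⌉₊ - 1)) / δ)) =
      (∫ t in (0 : ℝ)..T, c ⌈t / δ⌉₊ * g' t) + δ⁻¹ * (∫ t in (0 : ℝ)..T, g t * c ⌈t / δ⌉₊) -
        δ⁻¹ * ∫ t in (0 : ℝ)..T, g t * c (⌈t / δ⌉₊ - 1) := by
    rw [← intervalIntegral.integral_const_mul, ← intervalIntegral.integral_const_mul,
      ← intervalIntegral.integral_add (i1 _ _) ((i2 _ _).const_mul _),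
      ← intervalIntegral.integral_sub ((i1 _ _).add ((i2 _ _).const_mul _))
        ((i3 _ _).const_mul _)]
    refine intervalIntegral.integral_congr fun t _ => ?_
    field_simp
    ring
  rw [hgoal, hshift, hsplit]
  rw [hmid'] at hmid
  have h1 : δ⁻¹ * (∫ t in (-δ)..0, g (t + δ) * c ⌈t / δ⌉₊) ≤ (g 0 + K * δ) * c 0 := by
    rwa [inv_mul_le_iff₀ hδ]
  have h2 : 0 ≤ δ⁻¹ * ∫ t in (T - δ)..T, g (t + δ) * c ⌈t / δ⌉₊ := by positivity
  have h3 : K * δ * c 0 ≤ K * δ * b := mul_le_mul_of_nonneg_left (hcb 0) (by positivity)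
  linarith

end Steps

end ZeroFluxFV

namespace ZeroFluxFV

/-! ### Test functions -/

section TestFunction

variable {ℓ : ℕ} {T : ℝ} {ξ : ℝ × Space ℓ → ℝ}

/-- The projection of the time axis onto `[0, T]`. -/
def clampTime (T t : ℝ) : ℝ := max 0 (min T t)

theorem clampTime_mem (hT : 0 ≤ T) (t : ℝ) : clampTime T t ∈ Icc 0 T :=
  ⟨le_max_left _ _, max_le hT (min_le_left _ _)⟩

theorem clampTime_of_mem {t : ℝ} (ht : t ∈ Icc 0 T) : clampTime T t = t := by
  rw [clampTime, min_eq_right ht.2, max_eq_right ht.1]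

theorem continuous_clampTime (T : ℝ) : Continuous (clampTime T) := by
  unfold clampTime
  fun_prop

theorem abs_clampTime_sub_le (T s t : ℝ) : |clampTime T t - clampTime T s| ≤ |t - s| := by
  have h : LipschitzWith 1 (clampTime T) := (LipschitzWith.id.const_min T).const_max 0
  simpa [Real.dist_eq] using h.dist_le_mul t s

/-- The derivative of a test function, extended to all times. -/
noncomputable def testDeriv (T : ℝ) (ξ : ℝ × Space ℓ → ℝ) (t : ℝ) (x : Space ℓ) :
    ℝ × Space ℓ →L[ℝ] ℝ :=
  fderivWithin ℝ ξ (Icc 0 T ×ˢ univ) (clampTime T t, x)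

/-- A test function at a given time, extended to all times. -/
def testSlice (T : ℝ) (ξ : ℝ × Space ℓ → ℝ) (t : ℝ) (x : Space ℓ) : ℝ := ξ (clampTime T t, x)

theorem uniqueDiffOn_slab (hT : 0 < T) : UniqueDiffOn ℝ (Icc 0 T ×ˢ (univ : Set (Space ℓ))) :=
  (uniqueDiffOn_Icc hT).prod uniqueDiffOn_univ

namespace IsTestFunction

theorem continuous_testSlice (hT : 0 ≤ T) (hξ : IsTestFunction T ξ) :
    Continuous (Function.uncurry (testSlice T ξ)) :=
  hξ.continuousOn.comp_continuous (by
    have := continuous_clampTime T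
    fun_prop) fun p => ⟨clampTime_mem hT p.1, mem_univ _⟩

theorem contDiffOn_fderivWithin (hT : 0 < T) (hξ : IsTestFunction T ξ) :
    ContDiffOn ℝ ∞ (fderivWithin ℝ ξ (Icc 0 T ×ˢ univ)) (Icc 0 T ×ˢ univ) :=
  hξ.fderivWithin (uniqueDiffOn_slab hT) (by simp)

theorem continuous_testDeriv (hT : 0 < T) (hξ : IsTestFunction T ξ) :
    Continuous (Function.uncurry (testDeriv T ξ)) :=
  (hξ.contDiffOn_fderivWithin hT).continuousOn.comp_continuous (by
    have := continuous_clampTime T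
    fun_prop) fun p => ⟨clampTime_mem hT.le p.1, mem_univ _⟩

theorem hasFDerivWithinAt (hT : 0 < T) (hξ : IsTestFunction T ξ) (t : ℝ) (x : Space ℓ) :
    HasFDerivWithinAt ξ (testDeriv T ξ t x) (Icc 0 T ×ˢ univ) (clampTime T t, x) :=
  (hξ.differentiableOn (by simp) _ ⟨clampTime_mem hT.le t, mem_univ _⟩).hasFDerivWithinAt

theorem hasFDerivAt_testSlice (hT : 0 < T) (hξ : IsTestFunction T ξ) (t : ℝ) (x : Space ℓ) :
    HasFDerivAt (testSlice T ξ t)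
      ((testDeriv T ξ t x).comp (ContinuousLinearMap.inr ℝ ℝ (Space ℓ))) x := by
  have h1 : HasFDerivAt (fun y : Space ℓ => (clampTime T t, y))
      (ContinuousLinearMap.inr ℝ ℝ (Space ℓ)) x := hasFDerivAt_prodMk_right _ _
  rw [← hasFDerivWithinAt_univ] at h1 ⊢
  exact (hξ.hasFDerivWithinAt hT t x).comp x h1 fun y _ => ⟨clampTime_mem hT.le t, mem_univ _⟩

theorem contDiff_testSlice (hT : 0 ≤ T) (hξ : IsTestFunction T ξ) (t : ℝ) :
    ContDiff ℝ 1 (testSlice T ξ t) := by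
  rw [← contDiffOn_univ]
  have h1 : ContDiffOn ℝ 1 (fun y : Space ℓ => (clampTime T t, y)) univ :=
    (contDiff_prodMk_right _).contDiffOn
  exact (hξ.of_le (by exact_mod_cast le_top)).comp h1
    fun y _ => ⟨clampTime_mem hT t, mem_univ _⟩

theorem gradient_testSlice (hT : 0 < T) (hξ : IsTestFunction T ξ) (t : ℝ) (x : Space ℓ) :
    gradient (testSlice T ξ t) x = (InnerProductSpace.toDual ℝ (Space ℓ)).symm
      ((testDeriv T ξ t x).comp (ContinuousLinearMap.inr ℝ ℝ (Space ℓ))) := by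
  rw [gradient, (hξ.hasFDerivAt_testSlice hT t x).fderiv]

theorem continuous_gradient_testSlice (hT : 0 < T) (hξ : IsTestFunction T ξ) :
    Continuous fun p : ℝ × Space ℓ => gradient (testSlice T ξ p.1) p.2 := by
  simp only [hξ.gradient_testSlice hT]
  have h := hξ.continuous_testDeriv hT
  exact (InnerProductSpace.toDual ℝ (Space ℓ)).symm.continuous.comp
    (h.clm_comp continuous_const)

/-- Interior times only: `ξ` is arbitrary outside the slab, so its two-sided derivative at the
endpoints is uncontrolled. Time integrals do not see them. -/
theorem deriv_eq (hT : 0 < T) (hξ : IsTestFunction T ξ) {t : ℝ} (ht : t ∈ Ioo 0 T)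
    (x : Space ℓ) : deriv (fun s => ξ (s, x)) t = testDeriv T ξ t x (1, 0) := by
  have h1 := hξ.hasFDerivWithinAt hT t x
  rw [clampTime_of_mem ⟨ht.1.le, ht.2.le⟩] at h1
  have h2 : HasFDerivAt ξ (testDeriv T ξ t x) (t, x) :=
    h1.hasFDerivAt (prod_mem_nhds (Icc_mem_nhds ht.1 ht.2) univ_mem)
  have h3 : HasDerivAt (fun s : ℝ => (s, x)) ((1, 0) : ℝ × Space ℓ) t :=
    (hasDerivAt_id t).prodMk (hasDerivAt_const t x)
  exact (h2.comp_hasDerivAt t h3).deriv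

theorem gradient_eq {t : ℝ} (ht : t ∈ Icc 0 T) :
    gradient (fun y => ξ (t, y)) = gradient (testSlice T ξ t) := by
  unfold testSlice
  rw [clampTime_of_mem ht]

/-- The constants of a test function on a ball. -/
theorem exists_bound (hT : 0 < T) (hξ : IsTestFunction T ξ) (R : ℝ) :
    ∃ K : ℝ, 0 ≤ K ∧
      (∀ t, ∀ x ∈ Metric.closedBall (0 : Space ℓ) R,
        |testSlice T ξ t x| ≤ K ∧ |testDeriv T ξ t x (1, 0)| ≤ K) ∧
      (∀ s t, ∀ x ∈ Metric.closedBall (0 : Space ℓ) R,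
        |testSlice T ξ t x - testSlice T ξ s x| ≤ K * |t - s|) ∧
      (∀ t, ∀ x ∈ Metric.closedBall (0 : Space ℓ) R, ∀ y ∈ Metric.closedBall (0 : Space ℓ) R,
        |testDeriv T ξ t y (1, 0) - testDeriv T ξ t x (1, 0)| ≤ K * ‖y - x‖) ∧
      (∀ s ∈ Icc 0 T, ∀ t ∈ Icc 0 T, ∀ x ∈ Metric.closedBall (0 : Space ℓ) R,
        |testSlice T ξ t x - testSlice T ξ s x - (t - s) * testDeriv T ξ s x (1, 0)| ≤
          K * (t - s) ^ 2) ∧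
      ((∀ t ∈ Icc 0 T, ∀ x, 0 ≤ ξ (t, x)) → ∀ t,
        IsControlled (Metric.closedBall (0 : Space ℓ) R) K (testSlice T ξ t)) := by
  set S : Set (ℝ × Space ℓ) := Icc 0 T ×ˢ univ with hS
  set Q : Set (ℝ × Space ℓ) := Icc 0 T ×ˢ Metric.closedBall (0 : Space ℓ) R with hQ
  set L : ℝ × Space ℓ → ℝ × Space ℓ →L[ℝ] ℝ := fderivWithin ℝ ξ S with hL
  have hQS : Q ⊆ S := prod_mono le_rfl (subset_univ _)
  have hQc : IsCompact Q := isCompact_Icc.prod (isCompact_closedBall _ _)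
  have hQconv : Convex ℝ Q := (convex_Icc 0 T).prod (convex_closedBall _ _)
  have hLd : ContDiffOn ℝ ∞ L S := hξ.contDiffOn_fderivWithin hT
  obtain ⟨K0, hK0⟩ := hQc.exists_bound_of_continuousOn (hξ.continuousOn.mono hQS)
  obtain ⟨K1, hK1⟩ := hQc.exists_bound_of_continuousOn (hLd.continuousOn.mono hQS)
  obtain ⟨K2, hK2⟩ := (hLd.mono hQS).exists_lipschitzOnWith (by simp) hQconv hQc
  set K := max 0 (max K0 (max K1 (K2 : ℝ))) with hK
  have hKnn : 0 ≤ K := le_max_left _ _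
  have hK0' : K0 ≤ K := (le_max_left _ _).trans (le_max_right _ _)
  have hK1' : K1 ≤ K := ((le_max_left _ _).trans (le_max_right _ _)).trans (le_max_right _ _)
  have hK2' : (K2 : ℝ) ≤ K := ((le_max_right _ _).trans (le_max_right _ _)).trans (le_max_right _ _)
  have hdξ : ∀ z ∈ S, HasFDerivWithinAt ξ (L z) S z := fun z hz =>
    (hξ.differentiableOn (by simp) z hz).hasFDerivWithinAt
  have b0 : ∀ z ∈ Q, |ξ z| ≤ K := fun z hz => (hK0 z hz).trans hK0'
  have b1 : ∀ z ∈ Q, ‖L z‖ ≤ K := fun z hz => (hK1 z hz).trans hK1'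
  have l0 : ∀ z ∈ Q, ∀ w ∈ Q, |ξ w - ξ z| ≤ K * ‖w - z‖ := fun z hz w hw =>
    hQconv.norm_image_sub_le_of_norm_hasFDerivWithin_le
      (fun z hz => (hdξ z (hQS hz)).mono hQS) b1 hz hw
  have l1 : ∀ z ∈ Q, ∀ w ∈ Q, ‖L w - L z‖ ≤ K * ‖w - z‖ := fun z hz w hw =>
    (hK2.norm_sub_le hw hz).trans (mul_le_mul_of_nonneg_right hK2' (norm_nonneg _))
  -- Mean value inequality on the part of `Q` within `‖w - z‖` of `z`, a convex set where the
  -- derivative differs from `L z` by at most `K * ‖w - z‖`.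
  have t0 : ∀ z ∈ Q, ∀ w ∈ Q, |ξ w - ξ z - L z (w - z)| ≤ K * ‖w - z‖ ^ 2 := by
    intro z hz w hw
    have hconv : Convex ℝ (Q ∩ Metric.closedBall z ‖w - z‖) :=
      hQconv.inter (convex_closedBall _ _)
    have h := hconv.norm_image_sub_le_of_norm_hasFDerivWithin_le' (𝕜 := ℝ) (f := ξ) (f' := L)
      (φ := L z) (C := K * ‖w - z‖) (x := z) (y := w)
      (fun y hy => (hdξ y (hQS hy.1)).mono (inter_subset_left.trans hQS))
      (fun y hy => (l1 z hz y hy.1).trans (mul_le_mul_of_nonneg_left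
        (by rw [← dist_eq_norm]; exact hy.2) hKnn))
      ⟨hz, Metric.mem_closedBall_self (norm_nonneg _)⟩
      ⟨hw, by rw [Metric.mem_closedBall, dist_eq_norm]⟩
    rw [Real.norm_eq_abs] at h
    refine h.trans (le_of_eq (by ring))
  have hmem : ∀ t, ∀ x ∈ Metric.closedBall (0 : Space ℓ) R, (clampTime T t, x) ∈ Q :=
    fun t x hx => ⟨clampTime_mem hT.le t, hx⟩
  have n1 : ‖((1, 0) : ℝ × Space ℓ)‖ = 1 := by simp [Prod.norm_def]
  have dt : ∀ (s t : ℝ) (x : Space ℓ), (t, x) - (s, x) = (t - s) • ((1, 0) : ℝ × Space ℓ) := by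
    intro s t x
    ext <;> simp
  have nt : ∀ (s t : ℝ) (x : Space ℓ), ‖(t, x) - (s, x)‖ = |t - s| := by
    intro s t x
    rw [dt, norm_smul, n1, mul_one, Real.norm_eq_abs]
  have dx : ∀ (t : ℝ) (x y : Space ℓ), (t, y) - (t, x) = (0, y - x) := by
    intro t x y
    ext <;> simp
  have nx : ∀ (t : ℝ) (x y : Space ℓ), ‖(t, y) - (t, x)‖ = ‖y - x‖ := by
    intro t x y
    rw [dx]
    simp [Prod.norm_def]
  refine ⟨K, hKnn, fun t x hx => ⟨b0 _ (hmem t x hx), ?_⟩, fun s t x hx => ?_,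
    fun t x hx y hy => ?_, fun s hs t ht x hx => ?_, fun hnn t => ⟨hξ.contDiff_testSlice hT.le t,
      fun x => hnn _ (clampTime_mem hT.le t) x, fun x hx y hy => ?_, fun x hx y hy => ?_,
      fun x hx y hy => ?_⟩⟩
  · have h := (L (clampTime T t, x)).le_opNorm (1, 0)
    rw [n1, mul_one] at h
    exact h.trans (b1 _ (hmem t x hx))
  · refine (l0 _ (hmem s x hx) _ (hmem t x hx)).trans ?_
    rw [nt]
    exact mul_le_mul_of_nonneg_left (abs_clampTime_sub_le T s t) hKnn
  · have h := (L (clampTime T t, y) - L (clampTime T t, x)).le_opNorm (1, 0)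
    rw [n1, mul_one] at h
    have h2 := l1 _ (hmem t x hx) _ (hmem t y hy)
    rw [nx] at h2
    exact h.trans h2
  · have h := t0 _ (hmem s x hx) _ (hmem t x hx)
    rw [nt, dt, map_smul, smul_eq_mul, sq_abs, clampTime_of_mem hs, clampTime_of_mem ht] at h
    simp only [testSlice, testDeriv, clampTime_of_mem hs, clampTime_of_mem ht]
    exact h
  · have h := l0 _ (hmem t x hx) _ (hmem t y hy)
    rw [nx] at h
    exact h
  · rw [hξ.gradient_testSlice hT, hξ.gradient_testSlice hT, ← map_sub, LinearIsometryEquiv.norm_map,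
      ← ContinuousLinearMap.sub_comp]
    have h := l1 _ (hmem t x hx) _ (hmem t y hy)
    rw [nx] at h
    refine (ContinuousLinearMap.opNorm_comp_le _ _).trans (le_trans ?_ h)
    exact mul_le_of_le_one_right (norm_nonneg _) (ContinuousLinearMap.norm_inr_le_one ℝ ℝ (Space ℓ))
  · have h := t0 _ (hmem t x hx) _ (hmem t y hy)
    rw [nx, dx] at h
    rw [hξ.gradient_testSlice hT, InnerProductSpace.toDual_symm_apply]
    exact h

end IsTestFunction

end TestFunction

end ZeroFluxFV

/-! ### Bounds for the solutions of the scheme: maximum principle and energy estimate -/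

namespace ZeroFluxFV

/-- `A` may fail to be measurable, as half diamonds are only known to be null measurable; hence the
integration over the compact closure against the measure restricted to `A`. -/
theorem continuous_setIntegral {ℓ : ℕ} {A : Set (Space ℓ)} (hA : Bornology.IsBounded A)
    {g : ℝ → Space ℓ → ℝ} (hg : Continuous (Function.uncurry g)) :
    Continuous fun t => ∫ x in A, g t x := by
  have : IsFiniteMeasure (volume.restrict A) :=
    ⟨by rw [Measure.restrict_apply_univ]; exact hA.measure_lt_top⟩
  have h := continuous_parametric_integral_of_continuous (μ := volume.restrict A) hg
    hA.isCompact_closure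
  rwa [Measure.restrict_restrict isClosed_closure.measurableSet,
    inter_eq_self_of_subset_right subset_closure] at h

namespace Discretization

open AdmissibleMesh

section Solutions

variable {d : ℕ} {Ω : Set (Space (d + 1))} {f : ℝ → Space (d + 1)} {D : Discretization Ω f}
  {φ : ℝ → ℝ} {u₀ : Space (d + 1) → ℝ} {u : ℕ → Fin D.mesh.card → ℝ} {T umax ζ M : ℝ}

theorem IsUniform.abs (hu : D.IsUniform ζ M) : D.IsUniform |ζ| |M| := by
  refine ⟨fun i => (hu.1 i).trans (mul_le_mul_of_nonneg_right (le_abs_self _) measureReal_nonneg),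
    fun i j hij a b a' b' => (hu.2 i j hij a b a' b').trans ?_⟩
  have := D.mesh.area_nonneg i j
  gcongr
  exact le_abs_self _

/-- There are finitely many control volumes, all of positive volume. This makes the explicit error
bound available for each discretization taken alone. -/
theorem exists_isUniform (D : Discretization Ω f) (hΩ : IsRegularDomain Ω) :
    ∃ ζ M, D.IsUniform ζ M := by
  obtain ⟨M, hM⟩ := D.lipschitz
  set q : Fin D.mesh.card → ℝ := fun i => Metric.diam (D.mesh.cell i) *
    (∑ j ∈ D.mesh.neighbors i, D.mesh.area i j) / volume.real (D.mesh.cell i) with hq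
  have hq0 : ∀ i, 0 ≤ q i := fun i => div_nonneg (mul_nonneg Metric.diam_nonneg
    (Finset.sum_nonneg fun j _ => D.mesh.area_nonneg i j)) measureReal_nonneg
  refine ⟨∑ i, q i, M, fun i => ?_, hM⟩
  have hv := D.mesh.volume_cell_pos hΩ i
  rw [← div_le_iff₀ hv]
  exact Finset.single_le_sum (fun i _ => hq0 i) (Finset.mem_univ i)

theorem IsSolution.isStep (hs : D.IsSolution φ u₀ u) (n : ℕ) : D.IsStep φ (u n) (u (n + 1)) :=
  hs.2 n

theorem integrableOn_initial (hu₀m : AEStronglyMeasurable u₀ (volume.restrict Ω))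
    (hΩ : IsRegularDomain Ω) (hu₀ : ∀ᵐ x ∂volume.restrict Ω, u₀ x ∈ Icc 0 umax) :
    IntegrableOn u₀ Ω := by
  have : IsFiniteMeasure (volume.restrict Ω) :=
    ⟨by rw [Measure.restrict_apply_univ]; exact hΩ.isBounded.measure_lt_top⟩
  refine Integrable.of_bound (C := umax) hu₀m ?_
  filter_upwards [hu₀] with x hx
  rw [Real.norm_of_nonneg hx.1]
  exact hx.2

theorem IsSolution.mem_Icc (hs : D.IsSolution φ u₀ u) (hΩ : IsRegularDomain Ω)
    (hφ : Monotone φ) (hf0 : f 0 = 0) (hfmax : f umax = 0)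
    (hu₀m : AEStronglyMeasurable u₀ (volume.restrict Ω))
    (hu₀ : ∀ᵐ x ∂volume.restrict Ω, u₀ x ∈ Icc 0 umax) (n : ℕ) :
    ∀ i, u n i ∈ Icc 0 umax := by
  induction n with
  | zero =>
    intro i
    have hv := D.mesh.volume_cell_pos hΩ i
    have hi := (integrableOn_initial hu₀m hΩ hu₀).mono_set (D.mesh.cell_subset i)
    have hcell : ∀ᵐ x ∂volume.restrict (D.mesh.cell i), u₀ x ∈ Icc 0 umax :=
      ae_mono (Measure.restrict_mono (D.mesh.cell_subset i) le_rfl) hu₀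
    have hfin : volume (D.mesh.cell i) ≠ ⊤ := (D.mesh.isBounded_cell hΩ i).measure_lt_top.ne
    rw [hs.1 i]
    constructor
    · exact mul_nonneg (inv_nonneg.2 hv.le)
        (integral_nonneg_of_ae (hcell.mono fun x hx => hx.1))
    · rw [inv_mul_le_iff₀ hv]
      calc ∫ x in D.mesh.cell i, u₀ x ≤ ∫ x in D.mesh.cell i, umax :=
            integral_mono_ae hi (integrableOn_const hfin) (hcell.mono fun x hx => hx.2)
        _ = _ := by rw [integral_const, measureReal_restrict_apply_univ, smul_eq_mul]
  | succ n ih => exact (hs.isStep n).mem_Icc (D.mesh.volume_cell_pos hΩ) hφ hf0 hfmax ih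

/-- Jensen's inequality for `|· - k|`, the initial values being mean values. -/
theorem IsSolution.volume_mul_abs_le (hs : D.IsSolution φ u₀ u) (hΩ : IsRegularDomain Ω)
    (hi : IntegrableOn u₀ Ω) (k : ℝ) (i : Fin D.mesh.card) :
    volume.real (D.mesh.cell i) * |u 0 i - k| ≤ ∫ x in D.mesh.cell i, |u₀ x - k| := by
  have hv := D.mesh.volume_cell_pos hΩ i
  have hfin : volume (D.mesh.cell i) ≠ ⊤ := (D.mesh.isBounded_cell hΩ i).measure_lt_top.ne
  have e : volume.real (D.mesh.cell i) * (u 0 i - k) = ∫ x in D.mesh.cell i, (u₀ x - k) := by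
    rw [integral_sub (hi.mono_set (D.mesh.cell_subset i)) (integrableOn_const hfin),
      integral_const, measureReal_restrict_apply_univ, smul_eq_mul, hs.1 i, mul_sub,
      mul_inv_cancel_left₀ hv.ne']
  have e2 : volume.real (D.mesh.cell i) * |u 0 i - k| =
      |volume.real (D.mesh.cell i) * (u 0 i - k)| := by rw [abs_mul, abs_of_pos hv]
  rw [e2, e]
  exact abs_integral_le_integral_abs

theorem intervalIntegrable_dissipation (φ : ℝ → ℝ) (u : ℕ → Fin D.mesh.card → ℝ) (a b : ℝ) :
    IntervalIntegrable (fun t => D.dissipation φ (u ⌈t / D.dt⌉₊)) volume a b :=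
  intervalIntegrable_step (fun n => D.dissipation φ (u n)) D.dt a b

theorem ceil_eq_add_one {t δ : ℝ} (hδ : 0 < δ) (ht : 0 < t) : ⌈t / δ⌉₊ = ⌈t / δ⌉₊ - 1 + 1 :=
  (Nat.sub_add_cancel (Nat.one_le_iff_ne_zero.2 (Nat.ceil_pos.2 (div_pos ht hδ)).ne')).symm

/-- The energy estimate. -/
theorem IsSolution.integral_dissipation_le (hs : D.IsSolution φ u₀ u) (hΩ : IsRegularDomain Ω)
    (hT : 0 ≤ T) (hmem : ∀ n i, u n i ∈ Icc 0 umax) (hf : Continuous f) {W : ℝ} (hW0 : 0 ≤ W)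
    (hW : ∀ s ∈ Icc 0 umax, ‖∫ r in (0 : ℝ)..s, f r‖ ≤ W) :
    ∫ t in (0 : ℝ)..T, D.dissipation φ (u ⌈t / D.dt⌉₊) ≤
      (d + 1 : ℕ) * (W * (surfaceMeasure (d + 1)).real (frontier Ω)) * T +
        umax ^ 2 * volume.real Ω := by
  set P := (d + 1 : ℕ) * (W * (surfaceMeasure (d + 1)).real (frontier Ω)) with hP
  have hint : ∀ i, IntervalIntegrable (fun t => volume.real (D.mesh.cell i) *
      ((u ⌈t / D.dt⌉₊ i ^ 2 - u (⌈t / D.dt⌉₊ - 1) i ^ 2) / D.dt)) volume 0 T := fun i =>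
    intervalIntegrable_step (fun n => volume.real (D.mesh.cell i) *
      ((u n i ^ 2 - u (n - 1) i ^ 2) / D.dt)) D.dt 0 T
  have hint' : IntervalIntegrable (fun t => ∑ i, volume.real (D.mesh.cell i) *
      ((u ⌈t / D.dt⌉₊ i ^ 2 - u (⌈t / D.dt⌉₊ - 1) i ^ 2) / D.dt)) volume 0 T :=
    intervalIntegrable_step (fun n => ∑ i, volume.real (D.mesh.cell i) *
      ((u n i ^ 2 - u (n - 1) i ^ 2) / D.dt)) D.dt 0 T
  have h1 : ∫ t in (0 : ℝ)..T, 2 * D.dissipation φ (u ⌈t / D.dt⌉₊) ≤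
      ∫ t in (0 : ℝ)..T, (2 * P - ∑ i, volume.real (D.mesh.cell i) *
        ((u ⌈t / D.dt⌉₊ i ^ 2 - u (⌈t / D.dt⌉₊ - 1) i ^ 2) / D.dt)) := by
    refine intervalIntegral.integral_mono_on_of_le_Ioo hT
      ((intervalIntegrable_dissipation φ u 0 T).const_mul 2)
      (IntervalIntegrable.sub (by simp) hint')
      fun t ht => ?_
    have h2 := hs.isStep (⌈t / D.dt⌉₊ - 1)
    rw [← ceil_eq_add_one D.dt_pos ht.1] at h2
    have h3 := h2.energy_le hΩ hf hW0 fun i => hW _ (hmem _ i)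
    linarith
  have h2 : ∀ i, -umax ^ 2 * volume.real (D.mesh.cell i) ≤
      ∫ t in (0 : ℝ)..T, volume.real (D.mesh.cell i) *
        ((u ⌈t / D.dt⌉₊ i ^ 2 - u (⌈t / D.dt⌉₊ - 1) i ^ 2) / D.dt) := by
    intro i
    -- With `g = 1` and `K = 0`, summation by parts reduces to telescoping of the squares, including
    -- the incomplete last time step.
    have h := le_integral_step (c := fun n => u n i ^ 2) (b := umax ^ 2) (K := 0)
      (g := fun _ => 1) (g' := fun _ => 0) D.dt_pos hT (fun n => sq_nonneg _)
      (fun n => pow_le_pow_left₀ (hmem n i).1 (hmem n i).2 2) continuous_const continuous_const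
      (fun _ => zero_le_one) le_rfl (by simp) (by simp) (by simp)
    simp only [mul_zero, zero_mul, sub_zero, one_mul, mul_one, zero_add] at h
    rw [intervalIntegral.integral_const_mul, mul_comm]
    refine mul_le_mul_of_nonneg_left (le_trans ?_ h) measureReal_nonneg
    exact neg_le_neg (pow_le_pow_left₀ (hmem 0 i).1 (hmem 0 i).2 2)
  rw [intervalIntegral.integral_const_mul, intervalIntegral.integral_sub (by simp)
    hint', intervalIntegral.integral_const,
    intervalIntegral.integral_finsetSum fun i _ => hint i, smul_eq_mul, sub_zero] at h1
  have h3 : -umax ^ 2 * volume.real Ω ≤ ∑ i, ∫ t in (0 : ℝ)..T, volume.real (D.mesh.cell i) *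
        ((u ⌈t / D.dt⌉₊ i ^ 2 - u (⌈t / D.dt⌉₊ - 1) i ^ 2) / D.dt) := by
    rw [← D.mesh.sum_volume_cell hΩ, Finset.mul_sum]
    exact Finset.sum_le_sum fun i _ => h2 i
  have h4 : 0 ≤ umax ^ 2 * volume.real Ω := mul_nonneg (sq_nonneg _) measureReal_nonneg
  linarith

end Solutions

end Discretization

end ZeroFluxFV

/-! ### The entropy functional as a time integral of sums over control volumes -/

namespace ZeroFluxFV

namespace Discretization

open AdmissibleMesh

variable {d : ℕ} {Ω : Set (Space (d + 1))} {f : ℝ → Space (d + 1)} {D : Discretization Ω f}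
  {φ : ℝ → ℝ} {u₀ : Space (d + 1) → ℝ} {u : ℕ → Fin D.mesh.card → ℝ} {T umax ζ M K r R k : ℝ}
  {ξ : ℝ × Space (d + 1) → ℝ}

/-- The space integral of the entropy functional, as a function of the time and of the time
level. -/
noncomputable def entropyRate (D : Discretization Ω f) (φ : ℝ → ℝ)
    (u : ℕ → Fin D.mesh.card → ℝ) (T k : ℝ) (ξ : ℝ × Space (d + 1) → ℝ) (n : ℕ) (t : ℝ) : ℝ :=
  ∑ i, (|u n i - k| * (∫ x in D.mesh.cell i, testDeriv T ξ t x (1, 0)) +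
    ((∫ x in D.mesh.cell i,
      ⟪Real.sign (u n i - k) • (f (u n i) - f k), gradient (testSlice T ξ t) x⟫) -
    ∑ j ∈ D.mesh.neighbors i, Real.sign (u n i - k) * ((φ (u n j) - φ (u n i)) *
      (((d + 1 : ℕ) : ℝ) / D.mesh.centerDist i j *
        ∫ x in D.mesh.halfDiamond i j, ⟪D.mesh.normal i j, gradient (testSlice T ξ t) x⟫))))

theorem continuous_entropyRate (hΩ : IsRegularDomain Ω) (hT : 0 < T) (hξ : IsTestFunction T ξ)
    (n : ℕ) : Continuous (D.entropyRate φ u T k ξ n) := by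
  have h1 : Continuous (Function.uncurry fun (t : ℝ) (x : Space (d + 1)) =>
      testDeriv T ξ t x (1, 0)) := (hξ.continuous_testDeriv hT).clm_apply continuous_const
  have h2 : ∀ v : Space (d + 1), Continuous (Function.uncurry fun (t : ℝ) (x : Space (d + 1)) =>
      ⟪v, gradient (testSlice T ξ t) x⟫) := fun v =>
    continuous_const.inner (hξ.continuous_gradient_testSlice hT)
  unfold entropyRate
  refine continuous_finsetSum _ fun i _ => Continuous.add ?_ (Continuous.sub ?_ ?_)
  · exact continuous_const.mul (continuous_setIntegral (D.mesh.isBounded_cell hΩ i) h1)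
  · exact continuous_setIntegral (D.mesh.isBounded_cell hΩ i) (h2 _)
  · refine continuous_finsetSum _ fun j _ => ?_
    exact continuous_const.mul (continuous_const.mul (continuous_const.mul
      (continuous_setIntegral ((D.mesh.isBounded_cell hΩ i).closure.subset
        (D.mesh.halfDiamond_subset i j)) (h2 _))))

theorem continuous_integral_frontier (hΩ : IsRegularDomain Ω) (hT : 0 ≤ T)
    (hξ : IsTestFunction T ξ) (a : Space (d + 1)) (hB : closure Ω ⊆ Metric.closedBall 0 R)
    (hK : ∀ t, ∀ x ∈ Metric.closedBall (0 : Space (d + 1)) R, |testSlice T ξ t x| ≤ K) :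
    Continuous fun t => ∫ x in frontier Ω, |⟪a, exteriorNormal Ω x⟫| * testSlice T ξ t x
      ∂surfaceMeasure (d + 1) := by
  have hc := hξ.continuous_testSlice hT
  refine continuous_of_dominated (bound := fun x => |⟪a, exteriorNormal Ω x⟫| * K)
    (fun t => (integrableOn_frontier hΩ a (hc.comp (by fun_prop : Continuous fun x =>
      ((t, x) : ℝ × Space (d + 1))))).aestronglyMeasurable) (fun t => ?_)
    (integrableOn_frontier hΩ a continuous_const) (Eventually.of_forall fun x => ?_)
  · filter_upwards [ae_restrict_mem isClosed_frontier.measurableSet] with x hx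
    rw [norm_mul, Real.norm_eq_abs, abs_abs]
    exact mul_le_mul_of_nonneg_left (hK t x (hB (frontier_subset_closure hx))) (abs_nonneg _)
  · exact continuous_const.mul (hc.comp (by fun_prop : Continuous fun t : ℝ =>
      ((t, x) : ℝ × Space (d + 1))))

theorem entropyFunctional_eq (hΩ : IsRegularDomain Ω) (hT : 0 < T) (hξ : IsTestFunction T ξ)
    (u : ℕ → Fin D.mesh.card → ℝ) (k : ℝ) :
    entropyFunctional Ω T f u₀ (D.approxSolution u) (D.approxGradient φ u) k ξ =
      (∫ t in (0 : ℝ)..T, D.entropyRate φ u T k ξ ⌈t / D.dt⌉₊ t) +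
      (∫ t in (0 : ℝ)..T, ∫ x in frontier Ω, |⟪f k, exteriorNormal Ω x⟫| * testSlice T ξ t x
        ∂surfaceMeasure (d + 1)) +
      ∫ x in Ω, |u₀ x - k| * testSlice T ξ 0 x := by
  rw [entropyFunctional]
  congr 1
  · congr 1
    · refine intervalIntegral.integral_congr_Ioo_of_le hT.le fun t ht => ?_
      have hη : Continuous fun x => testDeriv T ξ t x (1, 0) :=
        ((hξ.continuous_testDeriv hT).comp (by fun_prop : Continuous fun x =>
          ((t, x) : ℝ × Space (d + 1)))).clm_apply continuous_const
      have h := D.mesh.setIntegral_entropy hΩ (hξ.contDiff_testSlice hT.le t) hη f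
        (D.valuesAt u t) (fun i => φ (D.valuesAt u t i)) k
      simp only [hξ.deriv_eq hT ht, IsTestFunction.gradient_eq (ξ := ξ) ⟨ht.1.le, ht.2.le⟩]
      exact h
    · refine intervalIntegral.integral_congr_Ioo_of_le hT.le fun t ht => ?_
      simp only [testSlice, clampTime_of_mem (⟨ht.1.le, ht.2.le⟩ : t ∈ Icc 0 T)]
  · simp only [testSlice, clampTime_of_mem (⟨le_rfl, hT.le⟩ : (0 : ℝ) ∈ Icc 0 T)]

/-- The contribution of the initial datum. -/
theorem IsSolution.initial_le (hs : D.IsSolution φ u₀ u) (hΩ : IsRegularDomain Ω)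
    (hB : closure Ω ⊆ Metric.closedBall 0 R) {θ : Space (d + 1) → ℝ}
    (hθ : IsControlled (Metric.closedBall 0 R) K θ) (hK : 0 ≤ K)
    (hu₀m : AEStronglyMeasurable u₀ (volume.restrict Ω))
    (hu₀ : ∀ᵐ x ∂volume.restrict Ω, u₀ x ∈ Icc 0 umax) (hk : k ∈ Icc 0 umax) :
    (∑ i, volume.real (D.mesh.cell i) * (|u 0 i - k| * θ (D.mesh.center i))) -
      umax * (K * D.mesh.size) * volume.real Ω ≤ ∫ x in Ω, |u₀ x - k| * θ x := by
  have humax : 0 ≤ umax := hk.1.trans hk.2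
  have hi := integrableOn_initial hu₀m hΩ hu₀
  have hfin : ∀ i, volume (D.mesh.cell i) ≠ ⊤ := fun i =>
    (D.mesh.isBounded_cell hΩ i).measure_lt_top.ne
  have hik : ∀ i, IntegrableOn (fun x => |u₀ x - k|) (D.mesh.cell i) := fun i =>
    ((hi.mono_set (D.mesh.cell_subset i)).sub (integrableOn_const (hfin i))).abs
  have hθc := hθ.contDiff.continuous
  have hikθ : ∀ i, IntegrableOn (fun x => |u₀ x - k| * θ x) (D.mesh.cell i) := by
    intro i
    obtain ⟨b, hb⟩ := (D.mesh.isBounded_cell hΩ i).isCompact_closure.exists_bound_of_continuousOn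
      hθc.continuousOn
    refine (hik i).mul_bdd (c := b) hθc.aestronglyMeasurable ?_
    filter_upwards [ae_restrict_mem (D.mesh.cell_open i).measurableSet] with x hx
    exact hb x (subset_closure hx)
  rw [D.mesh.setIntegral_eq_sum_cell hikθ, ← D.mesh.sum_volume_cell hΩ, Finset.mul_sum,
    ← Finset.sum_sub_distrib]
  refine Finset.sum_le_sum fun i _ => ?_
  have hcell : closure (D.mesh.cell i) ⊆ Metric.closedBall 0 R :=
    (closure_mono (D.mesh.cell_subset i)).trans hB
  have hae : ∀ᵐ x ∂volume.restrict (D.mesh.cell i), u₀ x ∈ Icc 0 umax :=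
    ae_mono (Measure.restrict_mono (D.mesh.cell_subset i) le_rfl) hu₀
  have h1 : ∫ x in D.mesh.cell i, (|u₀ x - k| * θ (D.mesh.center i) - umax * (K * D.mesh.size)) ≤
      ∫ x in D.mesh.cell i, |u₀ x - k| * θ x := by
    refine integral_mono_ae (((hik i).mul_const _).sub (integrableOn_const (hfin i))) (hikθ i) ?_
    filter_upwards [hae, ae_restrict_mem (D.mesh.cell_open i).measurableSet] with x hx hxi
    have h2 := (le_abs_self _).trans (hθ.abs_sub_le x (hcell (subset_closure hxi)) _
      (hcell (D.mesh.center_mem i)))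
    rw [← dist_eq_norm] at h2
    have h3 := mul_le_mul_of_nonneg_left ((D.mesh.dist_le_diam hΩ (D.mesh.center_mem i)
      (subset_closure hxi)).trans (D.mesh.diam_le_size i)) hK
    have h4 : |u₀ x - k| ≤ umax :=
      abs_le.2 ⟨by linarith [hx.1, hk.2], by linarith [hx.2, hk.1]⟩
    have h5 : |u₀ x - k| * (θ (D.mesh.center i) - θ x) ≤ |u₀ x - k| * (K * D.mesh.size) :=
      mul_le_mul_of_nonneg_left (h2.trans h3) (abs_nonneg _)
    have h6 : |u₀ x - k| * (K * D.mesh.size) ≤ umax * (K * D.mesh.size) :=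
      mul_le_mul_of_nonneg_right h4 (mul_nonneg hK D.mesh.size_nonneg)
    linarith
  rw [integral_sub ((hik i).mul_const _) (integrableOn_const (hfin i)), integral_mul_const,
    integral_const, measureReal_restrict_apply_univ, smul_eq_mul] at h1
  have h2 := mul_le_mul_of_nonneg_right (hs.volume_mul_abs_le hΩ hi k i)
    (hθ.nonneg (D.mesh.center i))
  linarith

end Discretization

end ZeroFluxFV

/-! ### The integrated entropy inequality and its error term -/

namespace ZeroFluxFV

namespace Discretization

open AdmissibleMesh

variable {d : ℕ} {Ω : Set (Space (d + 1))} {f : ℝ → Space (d + 1)} {D : Discretization Ω f}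
  {φ : ℝ → ℝ} {u₀ : Space (d + 1) → ℝ} {u : ℕ → Fin D.mesh.card → ℝ} {T umax ζ M K r R k W : ℝ}
  {ξ : ℝ × Space (d + 1) → ℝ}

/-- The entropy inequality at a given time. -/
theorem IsSolution.le_entropyRate (hs : D.IsSolution φ u₀ u) (hΩ : IsRegularDomain Ω)
    (hB : closure Ω ⊆ Metric.closedBall 0 R) (hK : 0 ≤ K)
    (hθ : ∀ t, IsControlled (Metric.closedBall 0 R) K (testSlice T ξ t))
    (hη : ∀ t, ∀ x ∈ Metric.closedBall (0 : Space (d + 1)) R,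
      ∀ y ∈ Metric.closedBall (0 : Space (d + 1)) R,
        |testDeriv T ξ t y (1, 0) - testDeriv T ξ t x (1, 0)| ≤ K * ‖y - x‖)
    (hT : 0 < T) (hξ : IsTestFunction T ξ)
    (hu : D.IsUniform ζ M) (hM : 0 ≤ M) (hr : 0 ≤ r)
    (hsize : D.mesh.size ≤ r ^ 2) {C : NNReal} (hφ : LipschitzWith C φ) (hφm : Monotone φ)
    (hmem : ∀ n i, u n i ∈ Icc 0 umax) (hW0 : 0 ≤ W) (hk : k ∈ Icc 0 umax)
    (hW : ∀ s ∈ Icc 0 umax, ‖f s - f k‖ ≤ W) (hWk : ‖f k‖ ≤ W) {t : ℝ} (ht : 0 < t) :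
    (∑ i, volume.real (D.mesh.cell i) *
      (|u ⌈t / D.dt⌉₊ i - k| * testDeriv T ξ t (D.mesh.center i) (1, 0) +
        testSlice T ξ t (D.mesh.center i) *
          ((|u ⌈t / D.dt⌉₊ i - k| - |u (⌈t / D.dt⌉₊ - 1) i - k|) / D.dt))) -
    K * (umax * r ^ 2 * volume.real Ω +
      (d + 2 : ℕ) * W * (surfaceMeasure (d + 1)).real (frontier Ω) * r ^ 2 +
        2 * r * (M * ζ * volume.real Ω) + 2 * r ^ 2 * (ζ * volume.real Ω)) -
      K * (4 * r + 2 * r ^ 2 * C) * D.dissipation φ (u ⌈t / D.dt⌉₊) ≤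
    D.entropyRate φ u T k ξ ⌈t / D.dt⌉₊ t +
      ∫ x in frontier Ω, |⟪f k, exteriorNormal Ω x⟫| * testSlice T ξ t x
        ∂surfaceMeasure (d + 1) := by
  set n := ⌈t / D.dt⌉₊ with hn
  have hstep := hs.isStep (n - 1)
  rw [← ceil_eq_add_one D.dt_pos ht] at hstep
  have h1 := hstep.entropy_consistency hΩ hB (convex_closedBall _ _) (hθ t) hK hu hM hr hsize hφ
    hφm hW0 k (fun i => hW _ (hmem n i)) hWk
  have h2 : ∀ i, volume.real (D.mesh.cell i) *
      (|u n i - k| * testDeriv T ξ t (D.mesh.center i) (1, 0)) -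
      K * (umax * r ^ 2) * volume.real (D.mesh.cell i) ≤
      |u n i - k| * ∫ x in D.mesh.cell i, testDeriv T ξ t x (1, 0) := by
    intro i
    have hcell : closure (D.mesh.cell i) ⊆ Metric.closedBall 0 R :=
      (closure_mono (D.mesh.cell_subset i)).trans hB
    have hfin : volume (D.mesh.cell i) < ⊤ := (D.mesh.isBounded_cell hΩ i).measure_lt_top
    have hc : Continuous fun x => testDeriv T ξ t x (1, 0) :=
      ((hξ.continuous_testDeriv hT).comp (by fun_prop : Continuous fun x =>
        ((t, x) : ℝ × Space (d + 1)))).clm_apply continuous_const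
    have h3 := norm_setIntegral_le_of_norm_le_const (μ := volume) (s := D.mesh.cell i)
      (f := fun x => testDeriv T ξ t x (1, 0) - testDeriv T ξ t (D.mesh.center i) (1, 0))
      (C := K * r ^ 2) hfin (fun x hx => by
        refine (hη t _ (hcell (D.mesh.center_mem i)) x (hcell (subset_closure hx))).trans ?_
        rw [← dist_eq_norm]
        exact mul_le_mul_of_nonneg_left (((D.mesh.dist_le_diam hΩ (subset_closure hx)
          (D.mesh.center_mem i)).trans (D.mesh.diam_le_size i)).trans hsize) hK)
    rw [integral_sub (D.mesh.integrableOn_cell hΩ hc i) (integrableOn_const hfin.ne),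
      integral_const, measureReal_restrict_apply_univ, smul_eq_mul] at h3
    have h4 := mul_le_mul_of_nonneg_left (abs_le.1 h3).1 (abs_nonneg (u n i - k))
    have h5 : |u n i - k| ≤ umax :=
      abs_le.2 ⟨by linarith [(hmem n i).1, hk.2], by linarith [(hmem n i).2, hk.1]⟩
    have h6 : |u n i - k| * (K * r ^ 2 * volume.real (D.mesh.cell i)) ≤
        umax * (K * r ^ 2 * volume.real (D.mesh.cell i)) :=
      mul_le_mul_of_nonneg_right h5
        (mul_nonneg (by positivity) measureReal_nonneg)
    linarith
  have h3 := Finset.sum_le_sum fun i (_ : i ∈ Finset.univ) => h2 i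
  rw [Finset.sum_sub_distrib, ← Finset.mul_sum, D.mesh.sum_volume_cell hΩ] at h3
  rw [entropyRate, Finset.sum_add_distrib]
  have h4 : (∑ i, volume.real (D.mesh.cell i) *
      (|u n i - k| * testDeriv T ξ t (D.mesh.center i) (1, 0) +
        testSlice T ξ t (D.mesh.center i) * ((|u n i - k| - |u (n - 1) i - k|) / D.dt))) =
      (∑ i, volume.real (D.mesh.cell i) *
      (|u n i - k| * testDeriv T ξ t (D.mesh.center i) (1, 0))) +
      ∑ i, testSlice T ξ t (D.mesh.center i) *
        (volume.real (D.mesh.cell i) * ((|u n i - k| - |u (n - 1) i - k|) / D.dt)) := by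
    rw [← Finset.sum_add_distrib]
    exact Finset.sum_congr rfl fun i _ => by ring
  rw [h4]
  linarith

/-- The entropy inequality for the solutions of the scheme, with an explicit error term. -/
theorem IsSolution.entropy_bound (hs : D.IsSolution φ u₀ u) (hΩ : IsRegularDomain Ω)
    (hB : closure Ω ⊆ Metric.closedBall 0 R) (hK : 0 ≤ K)
    (hbd : ∀ t, ∀ x ∈ Metric.closedBall (0 : Space (d + 1)) R,
        |testSlice T ξ t x| ≤ K ∧ |testDeriv T ξ t x (1, 0)| ≤ K)
    (hlip : ∀ s t, ∀ x ∈ Metric.closedBall (0 : Space (d + 1)) R,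
        |testSlice T ξ t x - testSlice T ξ s x| ≤ K * |t - s|)
    (hη : ∀ t, ∀ x ∈ Metric.closedBall (0 : Space (d + 1)) R,
      ∀ y ∈ Metric.closedBall (0 : Space (d + 1)) R,
        |testDeriv T ξ t y (1, 0) - testDeriv T ξ t x (1, 0)| ≤ K * ‖y - x‖)
    (htay : ∀ s ∈ Icc 0 T, ∀ t ∈ Icc 0 T, ∀ x ∈ Metric.closedBall (0 : Space (d + 1)) R,
        |testSlice T ξ t x - testSlice T ξ s x - (t - s) * testDeriv T ξ s x (1, 0)| ≤
          K * (t - s) ^ 2)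
    (hθ : ∀ t, IsControlled (Metric.closedBall 0 R) K (testSlice T ξ t))
    (hT : 0 < T) (hξ : IsTestFunction T ξ)
    (hu : D.IsUniform ζ M) (hζ : 0 ≤ ζ) (hM : 0 ≤ M) (hr : 0 ≤ r)
    (hsize : D.size ≤ r ^ 2) {C : NNReal} (hφ : LipschitzWith C φ) (hφm : Monotone φ)
    (hmem : ∀ n i, u n i ∈ Icc 0 umax) (hW0 : 0 ≤ W) (hk : k ∈ Icc 0 umax)
    (hW : ∀ s ∈ Icc 0 umax, ‖f s - f k‖ ≤ W) (hWk : ‖f k‖ ≤ W)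
    (hu₀m : AEStronglyMeasurable u₀ (volume.restrict Ω))
    (hu₀ : ∀ᵐ x ∂volume.restrict Ω, u₀ x ∈ Icc 0 umax) {P : ℝ}
    (hP : ∫ t in (0 : ℝ)..T, D.dissipation φ (u ⌈t / D.dt⌉₊) ≤ P) :
    -(K * (umax * (T + 3) * volume.real Ω + T * (umax * volume.real Ω +
      (d + 2 : ℕ) * W * (surfaceMeasure (d + 1)).real (frontier Ω) +
      2 * (M * ζ * volume.real Ω) + 2 * (ζ * volume.real Ω)) + (4 + 2 * C) * P +
      umax * volume.real Ω) * (r + r ^ 2)) ≤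
    entropyFunctional Ω T f u₀ (D.approxSolution u) (D.approxGradient φ u) k ξ := by
  have humax : 0 ≤ umax := hk.1.trans hk.2
  have hms : D.mesh.size ≤ r ^ 2 := (le_max_left _ _).trans hsize
  have hds : D.dt ≤ r ^ 2 := (le_max_right _ _).trans hsize
  have hcen : ∀ i, D.mesh.center i ∈ Metric.closedBall (0 : Space (d + 1)) R := fun i =>
    hB (closure_mono (D.mesh.cell_subset i) (D.mesh.center_mem i))
  set V := volume.real Ω with hV
  have hV0 : 0 ≤ V := measureReal_nonneg
  set H := (surfaceMeasure (d + 1)).real (frontier Ω) with hH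
  have hH0 : 0 ≤ H := measureReal_nonneg
  have hsl : ∀ x, Continuous fun t => testSlice T ξ t x := fun x =>
    (hξ.continuous_testSlice hT.le).comp (by fun_prop : Continuous fun t : ℝ =>
      ((t, x) : ℝ × Space (d + 1)))
  have hdr : ∀ x, Continuous fun t => testDeriv T ξ t x (1, 0) := fun x =>
    ((hξ.continuous_testDeriv hT).comp (by fun_prop : Continuous fun t : ℝ =>
      ((t, x) : ℝ × Space (d + 1)))).clm_apply continuous_const
  -- `E` bounds the error at every time; `E'` multiplies the dissipation, which is controlled only
  -- after integration in time, by `P`.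
  set E := K * (umax * r ^ 2 * V + (d + 2 : ℕ) * W * H * r ^ 2 +
        2 * r * (M * ζ * V) + 2 * r ^ 2 * (ζ * V)) with hE
  set E' := K * (4 * r + 2 * r ^ 2 * C) with hE'
  have hE'0 : 0 ≤ E' := mul_nonneg hK (by positivity)
  set q : Fin D.mesh.card → ℝ → ℝ := fun i t => volume.real (D.mesh.cell i) *
      (|u ⌈t / D.dt⌉₊ i - k| * testDeriv T ξ t (D.mesh.center i) (1, 0) +
        testSlice T ξ t (D.mesh.center i) *
          ((|u ⌈t / D.dt⌉₊ i - k| - |u (⌈t / D.dt⌉₊ - 1) i - k|) / D.dt)) with hq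
  have iq : ∀ i, IntervalIntegrable (q i) volume 0 T := fun i =>
    intervalIntegrable_comp_ceil (H := fun n t => volume.real (D.mesh.cell i) *
      (|u n i - k| * testDeriv T ξ t (D.mesh.center i) (1, 0) +
        testSlice T ξ t (D.mesh.center i) * ((|u n i - k| - |u (n - 1) i - k|) / D.dt)))
      (fun n => continuous_const.mul ((continuous_const.mul (hdr _)).add
        ((hsl _).mul continuous_const))) D.dt 0 T
  have iqs : IntervalIntegrable (fun t => ∑ i, q i t) volume 0 T :=
    intervalIntegrable_comp_ceil (H := fun n t => ∑ i, volume.real (D.mesh.cell i) *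
      (|u n i - k| * testDeriv T ξ t (D.mesh.center i) (1, 0) +
        testSlice T ξ t (D.mesh.center i) * ((|u n i - k| - |u (n - 1) i - k|) / D.dt)))
      (fun n => continuous_finsetSum _ fun i _ => continuous_const.mul
        ((continuous_const.mul (hdr _)).add ((hsl _).mul continuous_const))) D.dt 0 T
  have idis := (intervalIntegrable_dissipation (D := D) φ u 0 T).const_mul E'
  have irate : IntervalIntegrable (fun t => D.entropyRate φ u T k ξ ⌈t / D.dt⌉₊ t) volume 0 T :=
    intervalIntegrable_comp_ceil (fun n => continuous_entropyRate hΩ hT hξ n) D.dt 0 T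
  have ibd : IntervalIntegrable (fun t => ∫ x in frontier Ω, |⟪f k, exteriorNormal Ω x⟫| *
      testSlice T ξ t x ∂surfaceMeasure (d + 1)) volume 0 T :=
    (continuous_integral_frontier hΩ hT.le hξ (f k) hB
      fun t x hx => (hbd t x hx).1).intervalIntegrable _ _
  have h1 : ∫ t in (0 : ℝ)..T, ((∑ i, q i t) - E -
      E' * D.dissipation φ (u ⌈t / D.dt⌉₊)) ≤
      ∫ t in (0 : ℝ)..T, (D.entropyRate φ u T k ξ ⌈t / D.dt⌉₊ t +
        ∫ x in frontier Ω, |⟪f k, exteriorNormal Ω x⟫| * testSlice T ξ t x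
          ∂surfaceMeasure (d + 1)) := by
    refine intervalIntegral.integral_mono_on_of_le_Ioo hT.le
      ((iqs.sub (by simp)).sub idis) (irate.add ibd) fun t ht => ?_
    exact hs.le_entropyRate hΩ hB hK hθ hη hT hξ hu hM hr hms hφ hφm hmem hW0 hk hW hWk ht.1
  rw [intervalIntegral.integral_add irate ibd, intervalIntegral.integral_sub
    (iqs.sub (by simp)) idis, intervalIntegral.integral_sub iqs (by simp),
    intervalIntegral.integral_const, intervalIntegral.integral_const_mul,
    intervalIntegral.integral_finsetSum fun i _ => iq i, smul_eq_mul, sub_zero] at h1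
  have h2 : ∀ i, -(volume.real (D.mesh.cell i) *
      (|u 0 i - k| * testSlice T ξ 0 (D.mesh.center i))) -
      umax * K * (T + 3) * D.dt * volume.real (D.mesh.cell i) ≤ ∫ t in (0 : ℝ)..T, q i t := by
    -- In each control volume, summation by parts in time applies to `|u n i - k|`, with the test
    -- function frozen at the centre.
    intro i
    have h := le_integral_step (c := fun n => |u n i - k|) (b := umax) (K := K)
      (g := fun t => testSlice T ξ t (D.mesh.center i))
      (g' := fun t => testDeriv T ξ t (D.mesh.center i) (1, 0)) D.dt_pos hT.le
      (fun n => abs_nonneg _)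
      (fun n => abs_le.2 ⟨by linarith [(hmem n i).1, hk.2], by linarith [(hmem n i).2, hk.1]⟩)
      (hsl _) (hdr _) (fun t => (hθ t).nonneg _) hK (fun s t => hlip s t _ (hcen i))
      (fun t => (hbd t _ (hcen i)).2) (fun s hs t ht => htay s hs t ht _ (hcen i))
    have h3 := mul_le_mul_of_nonneg_left h (measureReal_nonneg (μ := volume)
      (s := D.mesh.cell i))
    rw [hq, intervalIntegral.integral_const_mul]
    refine le_trans (le_of_eq ?_) h3
    ring
  have h3 := Finset.sum_le_sum fun i (_ : i ∈ Finset.univ) => h2 i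
  rw [Finset.sum_sub_distrib, Finset.sum_neg_distrib, ← Finset.mul_sum,
    D.mesh.sum_volume_cell hΩ] at h3
  have h4 := hs.initial_le hΩ hB (hθ 0) hK hu₀m hu₀ hk
  rw [entropyFunctional_eq hΩ hT hξ]
  have h5 := mul_le_mul_of_nonneg_left hP hE'0
  have h6 : umax * K * (T + 3) * D.dt * V ≤ umax * K * (T + 3) * r ^ 2 * V := by gcongr
  have h7 : umax * (K * D.mesh.size) * V ≤ umax * (K * r ^ 2) * V := by gcongr
  have hP0 : 0 ≤ P := le_trans (intervalIntegral.integral_nonneg hT.le fun t _ =>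
    D.dissipation_nonneg hφm _) hP
  -- The powers of `r` are not collected sharply: `r + r ^ 2` replaces each of them, and `e1`, `e2`
  -- are the nonnegative surplus.
  have e1 : 0 ≤ K * r * (umax * (T + 3) * V + T * (umax * V + (d + 2 : ℕ) * W * H +
      2 * (ζ * V)) + 2 * C * P + umax * V) := by positivity
  have e2 : 0 ≤ K * r ^ 2 * (T * (2 * (M * ζ * V)) + 4 * P) := by positivity
  have e3 : K * (umax * (T + 3) * V + T * (umax * V + (d + 2 : ℕ) * W * H +
      2 * (M * ζ * V) + 2 * (ζ * V)) + (4 + 2 * C) * P + umax * V) * (r + r ^ 2) =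
      umax * K * (T + 3) * r ^ 2 * V + T * E + E' * P + umax * (K * r ^ 2) * V +
      K * r * (umax * (T + 3) * V + T * (umax * V + (d + 2 : ℕ) * W * H +
      2 * (ζ * V)) + 2 * C * P + umax * V) +
      K * r ^ 2 * (T * (2 * (M * ζ * V)) + 4 * P) := by
    rw [hE, hE']
    ring
  rw [e3]
  linarith

/-- The error term of the entropy inequality depends only on the bounds that are uniform along a
family of discretizations, and on the discretization size. -/
theorem exists_entropy_bound (hΩ : IsRegularDomain Ω) (hT : 0 < T) (humax : 0 < umax)
    (hf : ∃ C, LipschitzWith C f) (hf0 : f 0 = 0) (hfmax : f umax = 0)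
    (hφ : ∃ C, LipschitzWith C φ) (hφm : Monotone φ)
    (hu₀m : AEStronglyMeasurable u₀ (volume.restrict Ω))
    (hu₀ : ∀ᵐ x ∂volume.restrict Ω, u₀ x ∈ Icc 0 umax) (hξ : IsTestFunction T ξ)
    (hξ0 : ∀ t ∈ Icc 0 T, ∀ x, 0 ≤ ξ (t, x)) (ζ M : ℝ) :
    ∃ A : ℝ, ∀ D : Discretization Ω f, D.IsUniform ζ M →
      ∀ u : ℕ → Fin D.mesh.card → ℝ, D.IsSolution φ u₀ u → ∀ k ∈ Icc 0 umax,
        -(|A| * (√D.size + D.size)) ≤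
          entropyFunctional Ω T f u₀ (D.approxSolution u) (D.approxGradient φ u) k ξ := by
  obtain ⟨Cf, hCf⟩ := hf
  obtain ⟨C, hC⟩ := hφ
  obtain ⟨R, -, hR⟩ := hΩ.isBounded.closure.subset_ball_lt 0 (0 : Space (d + 1))
  have hB : closure Ω ⊆ Metric.closedBall 0 R := hR.trans Metric.ball_subset_closedBall
  obtain ⟨K, hK, hbd, hlip, hη, htay, hθ⟩ := hξ.exists_bound hT R
  have hf1 : ∀ s ∈ Icc 0 umax, ‖f s‖ ≤ Cf * umax := by
    intro s hs
    have h := hCf.dist_le_mul s 0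
    rw [hf0, dist_zero_right, Real.dist_eq, sub_zero, abs_of_nonneg hs.1] at h
    exact h.trans (mul_le_mul_of_nonneg_left hs.2 Cf.2)
  have hf2 : ∀ s ∈ Icc 0 umax, ‖∫ r in (0 : ℝ)..s, f r‖ ≤ Cf * umax * umax := by
    intro s hs
    have h := intervalIntegral.norm_integral_le_of_norm_le_const (a := 0) (b := s) (f := f)
      (C := Cf * umax) fun r hr => by
        rw [uIoc_of_le hs.1] at hr
        exact hf1 r ⟨hr.1.le, hr.2.trans hs.2⟩
    rw [sub_zero, abs_of_nonneg hs.1] at h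
    exact h.trans (mul_le_mul_of_nonneg_left hs.2 (by positivity))
  refine ⟨K * (umax * (T + 3) * volume.real Ω + T * (umax * volume.real Ω +
      (d + 2 : ℕ) * (2 * (Cf * umax)) * (surfaceMeasure (d + 1)).real (frontier Ω) +
      2 * (|M| * |ζ| * volume.real Ω) + 2 * (|ζ| * volume.real Ω)) + (4 + 2 * C) *
      ((d + 1 : ℕ) * (Cf * umax * umax * (surfaceMeasure (d + 1)).real (frontier Ω)) * T +
        umax ^ 2 * volume.real Ω) + umax * volume.real Ω), fun D hu u hs k hk => ?_⟩
  have hD : 0 ≤ D.size := D.mesh.size_nonneg.trans (le_max_left _ _)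
  have hmem := hs.mem_Icc hΩ hφm hf0 hfmax hu₀m hu₀
  have hP := hs.integral_dissipation_le hΩ hT.le hmem hCf.continuous (by positivity) hf2
  -- `r` is the square root of the size, and `W = 2 * (Cf * umax)` bounds both `f s - f k` and `f
  -- k`, uniformly in `k`. Absolute values are used because `ζ` and `M` are arbitrary reals.
  have h := hs.entropy_bound hΩ hB hK hbd hlip hη htay (hθ hξ0) hT hξ hu.abs (abs_nonneg ζ)
    (abs_nonneg M) (Real.sqrt_nonneg D.size) (Real.sq_sqrt hD).ge hC hφm hmem
    (W := 2 * (Cf * umax)) (by positivity) hk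
    (fun s hs => (norm_sub_le _ _).trans (by linarith [hf1 s hs, hf1 k hk]))
    ((hf1 k hk).trans (by
      have : 0 ≤ Cf * umax := by positivity
      linarith)) hu₀m hu₀ hP
  rw [Real.sq_sqrt hD] at h
  refine le_trans (neg_le_neg (mul_le_mul_of_nonneg_right (le_abs_self _) ?_)) h
  positivity

end Discretization

end ZeroFluxFV

/-! ### The main theorem -/

theorem theorem1 {ℓ : ℕ} (hℓ : 1 ≤ ℓ) (Ω : Set (ZeroFluxFV.Space ℓ))
    (hΩ : ZeroFluxFV.IsRegularDomain Ω) (T umax : ℝ) (hT : 0 < T) (humax : 0 < umax)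
    (f : ℝ → ZeroFluxFV.Space ℓ) (hf : ∃ C, LipschitzWith C f) (hf0 : f 0 = 0)
    (hfmax : f umax = 0)
    (φ : ℝ → ℝ) (hφ : ∃ C, LipschitzWith C φ) (hφmono : Monotone φ)
    (u₀ : ZeroFluxFV.Space ℓ → ℝ) (hu₀meas : AEStronglyMeasurable u₀ (volume.restrict Ω))
    (hu₀ : ∀ᵐ x ∂volume.restrict Ω, u₀ x ∈ Icc 0 umax) :
    ∃ υ : ZeroFluxFV.Discretization Ω f → (ℝ × ZeroFluxFV.Space ℓ → ℝ) → ℝ,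
      (∀ (D : ZeroFluxFV.Discretization Ω f) (u : ℕ → Fin D.mesh.card → ℝ),
        D.IsSolution φ u₀ u →
        ∀ k ∈ Icc 0 umax, ∀ ξ : ℝ × ZeroFluxFV.Space ℓ → ℝ, ZeroFluxFV.IsTestFunction T ξ →
          (∀ t ∈ Icc 0 T, ∀ x, 0 ≤ ξ (t, x)) →
          -υ D ξ ≤ ZeroFluxFV.entropyFunctional Ω T f u₀ (D.approxSolution u)
            (D.approxGradient φ u) k ξ) ∧
      ∀ ζ M : ℝ, ∀ ξ : ℝ × ZeroFluxFV.Space ℓ → ℝ, ZeroFluxFV.IsTestFunction T ξ →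
        Tendsto (fun D => υ D ξ)
          (comap ZeroFluxFV.Discretization.size (𝓝 0) ⊓ 𝓟 {D | D.IsUniform ζ M}) (𝓝 0) := by
  obtain ⟨d, rfl⟩ := Nat.exists_eq_add_of_le' hℓ
  -- The explicit error involves `ζ` and `M`, on which `υ` must not depend. So `υ` is the infimum of
  -- the nonnegative errors that are valid for all solutions and all `k` at once.
  set S : ZeroFluxFV.Discretization Ω f → (ℝ × ZeroFluxFV.Space (d + 1) → ℝ) → Set ℝ :=
    fun D ξ => {r | 0 ≤ r ∧ ((∀ t ∈ Icc 0 T, ∀ x, 0 ≤ ξ (t, x)) →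
      ∀ u : ℕ → Fin D.mesh.card → ℝ, D.IsSolution φ u₀ u → ∀ k ∈ Icc 0 umax,
        -r ≤ ZeroFluxFV.entropyFunctional Ω T f u₀ (D.approxSolution u)
            (D.approxGradient φ u) k ξ)} with hS
  have hbdd : ∀ D ξ, BddBelow (S D ξ) := fun D ξ => ⟨0, fun r hr => hr.1⟩
  have hbound : ∀ ζ M : ℝ, ∀ ξ : ℝ × ZeroFluxFV.Space (d + 1) → ℝ,
      ZeroFluxFV.IsTestFunction T ξ → ∃ A : ℝ, ∀ D : ZeroFluxFV.Discretization Ω f,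
        D.IsUniform ζ M → |A| * (√D.size + D.size) ∈ S D ξ := by
    intro ζ M ξ hξ
    by_cases hξ0 : ∀ t ∈ Icc 0 T, ∀ x, 0 ≤ ξ (t, x)
    · obtain ⟨A, hA⟩ := ZeroFluxFV.Discretization.exists_entropy_bound hΩ hT humax hf hf0 hfmax
        hφ hφmono hu₀meas hu₀ hξ hξ0 ζ M
      refine ⟨A, fun D hD => ⟨?_, fun _ => hA D hD⟩⟩
      have : 0 ≤ D.size := D.mesh.size_nonneg.trans (le_max_left _ _)
      positivity
    -- The convergence is claimed for test functions of any sign; where `ξ` takes negative values,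
    -- the condition in `S` is vacuous and zero is an admissible error.
    · refine ⟨0, fun D _ => ⟨by simp, fun h => absurd h hξ0⟩⟩
  refine ⟨fun D ξ => sInf (S D ξ), fun D u hs k hk ξ hξ hξ0 => ?_, fun ζ M ξ hξ => ?_⟩
  -- Each single discretization is uniform for some constants, so the set of admissible errors is
  -- nonempty and its infimum is itself admissible.
  · obtain ⟨ζ, M, hu⟩ := D.exists_isUniform hΩ
    obtain ⟨A, hA⟩ := hbound ζ M ξ hξ
    rw [neg_le]
    exact le_csInf ⟨_, hA D hu⟩ fun r hr => neg_le.1 (hr.2 hξ0 u hs k hk)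
  · obtain ⟨A, hA⟩ := hbound ζ M ξ hξ
    have hlim : Tendsto (fun D : ZeroFluxFV.Discretization Ω f => |A| * (√D.size + D.size))
        (comap ZeroFluxFV.Discretization.size (𝓝 0) ⊓ 𝓟 {D | D.IsUniform ζ M}) (𝓝 0) := by
      have h1 : Tendsto (fun h : ℝ => |A| * (√h + h)) (𝓝 0) (𝓝 (|A| * (√0 + 0))) :=
        Continuous.tendsto (by fun_prop) 0
      rw [Real.sqrt_zero, add_zero, mul_zero] at h1
      exact (h1.comp tendsto_comap).mono_left inf_le_left
    refine tendsto_of_tendsto_of_tendsto_of_le_of_le' tendsto_const_nhds hlim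
      (Eventually.of_forall fun D => Real.sInf_nonneg fun r hr => hr.1) ?_
    exact Eventually.filter_mono inf_le_right (eventually_principal.2 fun D hD =>
      csInf_le (hbdd D ξ) (hA D hD))
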